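/- Throughout, cube complexes are considered with the combinatorial (edge-path) metric on their vertices. Let $X$ be a CAT(0) cube complex, i.e. a simply connected cube complex all of whose vertex links are flag complexes (of arbitrary, possibly infinite, dimension), and let $G$ be a group acting on $X$ by automorphisms without inversion: no $h\in G$ and half-space $H$ satisfy $hH=\overline H$, where $\overline H$ is the half-space opposite to $H$. Two half-spaces $H,K$ are *transverse* if $H\cap K$, $H\cap\overline K$, $\overline H\cap K$, $\overline H\cap\overline K$ are all non-empty; they are *tightly nested* if one is properly contained in the other and no third half-space lies properly between them. Let $g\in G$ be *hyperbolic*: $\ell_g=\min_x d(x,gx)>0$, where $x$ ranges over the vertices of $X$. A *combinatorial axis* of $g$ is a bi-infinite combinatorial geodesic on which $g$ acts as translation by $\ell_g$, oriented in the direction of translation. Let $\mathbb A_g^+$ be the set of half-spaces of $X$ dual to a positively oriented edge of some combinatorial axis of $g$ (the half-space dual to an oriented edge $(x,y)$ is the one that contains $y$ but not $x$), let $\mathbb A_g^-=\{\overline H: H\in\mathbb A_g^+\}$ and $\mathbb A_g=\mathbb A_g^+\cup\mathbb A_g^-$. The *essential characteristic set* of $g$ is the cube complex $E_g=X(\mathbb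 A_g)$ given by the Sageev construction applied to $\mathbb A_g$ (ordered by inclusion, with involution $H\mapsto\overline H$): its vertices are the principal ultrafilters on $\mathbb A_g$, two vertices are adjacent if they differ on exactly one hyperplane, and all cubes whose $1$-skeleta are present are filled in. Its half-spaces are identified with the elements of $\mathbb A_g$, and $\langle g\rangle$ acts on it through its action on $\mathbb A_g$. For vertices $x,y$ of $E_g$, $[x,y]$ is the set of half-spaces in $\mathbb A_g$ that contain $y$ but not $x$. Suppose that $\langle g\rangle$ acts *non-transversely* on $E_g$: for every $H\in\mathbb A_g$, $H$ and $gH$ are not transverse in $E_g$. Then $E_g$ has finite dimension $d$. Let $C$ be any cube of $E_g$ of dimension $d$, and let $A\subseteq\mathbb A_g^+$ be the set of elements of $\mathbb A_g^+$ dual to the edges of $C$. There is a vertex $o$ of $C$ such that $A=[o,y]$ for some vertex $y$ of $C$; let $o$ be any such vertex (the *minimal vertex* of $C$). Put $$[A,gA]=\{K\in\mathbb A_g^+ : H\supseteq K\supseteq H'\text{ for some }H,H'\in A\cup gA\},\qquad [A,gA)=[A,gA]\setminus gA .$$ Give $\mathbb R^d$ its standard integer cubing (with vertex set $\mathbb Z^d$).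 For $1\le i\le d$ let $\mathcal H^i=\{\{x\in\mathbb R^d: x_i\ge n+\tfrac12\}: n\in\mathbb Z\}$, and let $\mathcal H^+(\mathbb R^d)=\mathcal H^1\cup\dots\cup\mathcal H^d$. Then there exist an action of $\langle g\rangle$ on $\mathbb R^d$ by automorphisms of the standard cubing and a $\langle g\rangle$-equivariant cubical embedding $\phi\colon E_g\hookrightarrow\mathbb R^d$, isometric for the combinatorial metrics, such that: 1. $\phi(C)=[0,1]^d$. 2. $\phi$ induces a bijection $\phi_*$ from $\mathbb A_g$ onto the set of half-spaces of $\mathbb R^d$ (where $\phi^{-1}(\phi_*(H))=H$), and $\phi_*(\mathbb A_g^+)=\mathcal H^+(\mathbb R^d)$. 3. The set $[A,gA]\cap\phi_*^{-1}(\mathcal H^1)$ is tightly nested in $E_g$: it is a finite chain $H_1\supset H_2\supset\dots\supset H_n$ whose consecutive members are tightly nested in $E_g$. 4. $[A,gA)=[o,go]$. -/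

import Mathlib

open scoped Pointwise

/-- The `1`-skeleton of the cube `[0,1]^n`: two vertices are adjacent when they differ in exactly
one coordinate. -/
def hypercube (n : ℕ) : SimpleGraph (Fin n → Bool) where
  Adj x y := ∃! i, x i ≠ y i
  symm := ⟨fun x y h => by simpa only [ne_comm] using h⟩
  loopless := ⟨fun x h => by obtain ⟨i, hi, -⟩ := h; exact hi rfl⟩

/-- A cube complex with vertex set `V`, presented by its `1`-skeleton and by the vertex sets of its
cubes. Each cube spans a copy of the `1`-skeleton of some `[0,1]^n`; all vertices and edges are
cubes; and faces of cubes are cubes. (The faces of a cube `C` are exactly the subsets of `C` that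
again span the `1`-skeleton of a cube.) Only complexes whose cubes are embedded and determined by
their vertex sets are presented in this way; this includes all CAT(0) cube complexes. -/
structure CubeComplex (V : Type*) where
  graph : SimpleGraph V
  cubes : Set (Set V)
  isCube : ∀ C ∈ cubes, ∃ n, Nonempty (hypercube n ≃g graph.induce C)
  vertex_mem : ∀ v, {v} ∈ cubes
  edge_mem : ∀ u v, graph.Adj u v → {u, v} ∈ cubes
  face_mem : ∀ C ∈ cubes, ∀ F ⊆ C,
    (∃ m, Nonempty (hypercube m ≃g graph.induce F)) → F ∈ cubes

theorem hypercube_iso_singleton {V : Type*} (G : SimpleGraph V) (v : V) :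
    Nonempty (hypercube 0 ≃g G.induce {v}) := by
  refine ⟨⟨⟨fun _ => ⟨v, rfl⟩, fun _ => Fin.elim0, fun x => Subsingleton.elim _ _,
    fun x => Subsingleton.elim _ _⟩, ?_⟩⟩
  intro x y
  constructor
  · intro h
    exact absurd h (G.induce {v}).irrefl
  · rintro ⟨i, -⟩
    exact i.elim0

theorem hypercube_iso_pair {V : Type*} (G : SimpleGraph V) (u v : V) (h : G.Adj u v) :
    Nonempty (hypercube 1 ≃g G.induce {u, v}) := by
  classical
  have hne := h.ne
  refine ⟨⟨⟨fun x => if x 0 then ⟨v, by simp⟩ else ⟨u, by simp⟩,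
    fun w _ => decide (w.1 = v), ?_, ?_⟩, ?_⟩⟩
  · intro x
    funext i
    have hi : i = 0 := Subsingleton.elim _ _
    subst hi
    by_cases hx : x 0 = true <;> simp [hx, hne]
  · rintro ⟨w, hw⟩
    rcases hw with rfl | hw
    · simp [hne]
    · obtain rfl : w = v := hw
      simp
  · intro x y
    have key : (hypercube 1).Adj x y ↔ x 0 ≠ y 0 := by
      constructor
      · rintro ⟨i, hi, -⟩
        have h0 : i = 0 := Subsingleton.elim _ _
        subst h0
        exact hi
      · intro h0
        exact ⟨0, h0, fun j _ => Subsingleton.elim _ _⟩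
    rw [key]
    cases hx : x 0 <;> cases hy : y 0 <;> simp [hx, hy, h, h.symm]

/-- The cube complex obtained from a graph by adding every cube whose `1`-skeleton is present. -/
def SimpleGraph.cubeCompletion {V : Type*} (G : SimpleGraph V) : CubeComplex V where
  graph := G
  cubes := {C | ∃ n, Nonempty (hypercube n ≃g G.induce C)}
  isCube _ h := h
  vertex_mem v := ⟨0, hypercube_iso_singleton G v⟩
  edge_mem u v h := ⟨1, hypercube_iso_pair G u v h⟩
  face_mem _ _ _ _ h := h

namespace CubeComplex

variable {V : Type*} (X : CubeComplex V)

/-- `C` is a cube of `X` of dimension `n`. -/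
def IsCubeOfDim (n : ℕ) (C : Set V) : Prop :=
  C ∈ X.cubes ∧ Nonempty (hypercube n ≃g X.graph.induce C)

/-- The dimension of a cube complex, `⊤` when the dimensions of its cubes are unbounded. -/
noncomputable def dim : ℕ∞ :=
  sSup {m : ℕ∞ | ∃ (n : ℕ) (C : Set V), X.IsCubeOfDim n C ∧ m = n}

/-! ### CAT(0) cube complexes -/

/-- Homotopy of edge paths relative to their endpoints: the equivalence relation generated by
inserting or deleting a backtrack and by pushing an edge path across a square. -/
inductive Homotopic : ∀ {u v : V}, X.graph.Walk u v → X.graph.Walk u v → Prop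
  | refl {u v : V} (p : X.graph.Walk u v) : Homotopic p p
  | symm {u v : V} {p q : X.graph.Walk u v} : Homotopic p q → Homotopic q p
  | trans {u v : V} {p q r : X.graph.Walk u v} : Homotopic p q → Homotopic q r → Homotopic p r
  | backtrack {u v w x : V} (p : X.graph.Walk u v) (h : X.graph.Adj v w)
      (q : X.graph.Walk v x) :
      Homotopic (p.append (.cons h (.cons h.symm q))) (p.append q)
  | square {u a b c d v : V} (p : X.graph.Walk u a) (hab : X.graph.Adj a b)
      (hbc : X.graph.Adj b c) (had : X.graph.Adj a d) (hdc : X.graph.Adj d c)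
      (q : X.graph.Walk c v) (hsq : {a, b, c, d} ∈ X.cubes) :
      Homotopic (p.append (.cons hab (.cons hbc q))) (p.append (.cons had (.cons hdc q)))

/-- Connected, with every closed edge path null-homotopic (trivial edge-path group). -/
def IsSimplyConnected : Prop :=
  X.graph.Connected ∧ ∀ (v : V) (p : X.graph.Walk v v), X.Homotopic p .nil

/-- The vertices of `link v` are the neighbours of `v`; a cube `C` at `v` contributes the simplex
whose vertices are the neighbours of `v` in `C`. -/
def linkSimplex (v : V) (C : Set V) : Set V := {w ∈ C | X.graph.Adj v w}

/-- The link of `v` is a flag complex: it is a simplicial complex (different cubes at `v` give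
different simplices), and finitely many vertices of the link, pairwise joined by edges of the link,
span a simplex of the link. -/
def IsFlagLink (v : V) : Prop :=
  (∀ C ∈ X.cubes, ∀ C' ∈ X.cubes, v ∈ C → v ∈ C' →
    X.linkSimplex v C = X.linkSimplex v C' → C = C') ∧
  ∀ S : Finset V, (∀ a ∈ S, X.graph.Adj v a) →
    (∀ a ∈ S, ∀ b ∈ S, a ≠ b → ∃ Q ∈ X.cubes, v ∈ Q ∧ X.linkSimplex v Q = {a, b}) →
    ∃ C ∈ X.cubes, v ∈ C ∧ X.linkSimplex v C = S

/-- A cube complex is CAT(0) when it is simply connected and nonpositively curved, that is, all its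
vertex links are flag complexes. -/
structure IsCAT0 : Prop where
  simplyConnected : X.IsSimplyConnected
  flagLink : ∀ v, X.IsFlagLink v

/-! ### Hyperplanes and half-spaces -/

/-- `e` and `f` are opposite edges of a square, i.e. they meet a common midcube of it. -/
def OppositeEdges (e f : Sym2 V) : Prop :=
  ∃ a b c d : V, X.graph.Adj a b ∧ X.graph.Adj b c ∧ X.graph.Adj c d ∧ X.graph.Adj d a ∧
    {a, b, c, d} ∈ X.cubes ∧ e = s(a, b) ∧ f = s(d, c)

/-- The hyperplane dual to the edge `e`, given as the set of all edges that it crosses. -/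
def hyperplane (e : Sym2 V) : Set (Sym2 V) := {f | Relation.EqvGen X.OppositeEdges e f}

/-- The half-spaces of `X`, given by their vertex sets: the components of the complement of a
hyperplane. The opposite half-space `H̄` of `H` is the complement `Hᶜ`. -/
def halfspaces : Set (Set V) :=
  {H | ∃ e ∈ X.graph.edgeSet, ∃ v : V,
    H = {w | (X.graph.deleteEdges (X.hyperplane e)).Reachable v w}}

end CubeComplex

/-- Two half-spaces are transverse when all four intersections are non-empty. -/
def Transverse {W : Type*} (H K : Set W) : Prop :=
  (H ∩ K).Nonempty ∧ (H ∩ Kᶜ).Nonempty ∧ (Hᶜ ∩ K).Nonempty ∧ (Hᶜ ∩ Kᶜ).Nonempty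

/-- With respect to a collection `𝓗` of half-spaces, `H` and `K` are tightly nested when they are
nested and no third element of `𝓗` lies properly between them. -/
def TightlyNested {V : Type*} (𝓗 : Set (Set V)) (H K : Set V) : Prop :=
  (H ⊂ K ∨ K ⊂ H) ∧ ¬ ∃ L ∈ 𝓗, (H ⊂ L ∧ L ⊂ K) ∨ (K ⊂ L ∧ L ⊂ H)

/-- A segment `H₁ ⊃ H₂ ⊃ ⋯ ⊃ Hₙ` in `𝓗`: consecutive elements are tightly nested. -/
def IsSegment {V : Type*} (𝓗 : Set (Set V)) (l : List (Set V)) : Prop :=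
  (∀ H ∈ l, H ∈ 𝓗) ∧ l.IsChain (fun H K => K ⊂ H ∧ TightlyNested 𝓗 H K)

/-! ### The Sageev construction -/

/-- The vertices of the cube complex `X(𝓗)` that the Sageev construction associates with a
collection `𝓗` of half-spaces, ordered by inclusion and with involution `H ↦ Hᶜ`: the principal
ultrafilters on `𝓗`. -/
@[ext]
structure SageevVertex {V : Type*} (𝓗 : Set (Set V)) where
  carrier : Set (Set V)
  subset : carrier ⊆ 𝓗
  /-- exactly one of each pair of opposite half-spaces is chosen -/
  choice : ∀ H ∈ 𝓗, Xor (H ∈ carrier) (Hᶜ ∈ carrier)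
  /-- no two chosen half-spaces are disjoint -/
  meet : ∀ H ∈ carrier, ∀ K ∈ carrier, ¬ H ⊆ Kᶜ
  /-- the descending chain condition -/
  dcc : carrier.IsWF

namespace SageevVertex

variable {V : Type*} {𝓗 : Set (Set V)}

instance : Membership (Set V) (SageevVertex 𝓗) := ⟨fun σ H => H ∈ σ.carrier⟩

/-- Two principal ultrafilters are adjacent when they differ on a single hyperplane. -/
def graph (𝓗 : Set (Set V)) : SimpleGraph (SageevVertex 𝓗) where
  Adj σ τ := ∃ H, σ.carrier \ τ.carrier = {H} ∧ τ.carrier \ σ.carrier = {Hᶜ}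
  symm := ⟨fun σ τ ⟨H, h1, h2⟩ => ⟨Hᶜ, h2, by rw [compl_compl]; exact h1⟩⟩
  loopless := ⟨fun σ ⟨H, h1, _⟩ => by
    rw [Set.sdiff_self] at h1
    exact (Set.singleton_ne_empty H) h1.symm⟩

/-- The Sageev complex `X(𝓗)`: cubes are added whenever their `1`-skeleta are present. -/
def complex (𝓗 : Set (Set V)) : CubeComplex (SageevVertex 𝓗) := (graph 𝓗).cubeCompletion

/-- The half-space of `X(𝓗)` corresponding to `H ∈ 𝓗`. -/
def half (𝓗 : Set (Set V)) (H : Set V) : Set (SageevVertex 𝓗) := {σ | H ∈ σ}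

/-- The interval `[σ, τ]`: the half-spaces that contain `τ` but not `σ`. -/
def interval (σ τ : SageevVertex 𝓗) : Set (Set V) := {H ∈ 𝓗 | τ ∈ half 𝓗 H ∧ σ ∉ half 𝓗 H}

/-- Elements that preserve `𝓗` act on the vertices of `X(𝓗)` through their action on `𝓗`. -/
instance {G : Type*} [Group G] [MulAction G V] :
    MulAction (MulAction.stabilizer G 𝓗) (SageevVertex 𝓗) where
  smul g σ :=
    { carrier := (g : G) • σ.carrier
      subset := by
        have h : (g : G) • 𝓗 = 𝓗 := g.2
        calc (g : G) • σ.carrier ⊆ (g : G) • 𝓗 := Set.smul_set_mono σ.subset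
          _ = 𝓗 := h
      choice := by
        intro H hH
        have h : (g : G) • 𝓗 = 𝓗 := g.2
        rw [← h, Set.mem_smul_set_iff_inv_smul_mem] at hH
        rw [Set.mem_smul_set_iff_inv_smul_mem, Set.mem_smul_set_iff_inv_smul_mem,
          Set.smul_set_compl]
        exact σ.choice _ hH
      meet := by
        intro H hH K hK hHK
        rw [Set.mem_smul_set_iff_inv_smul_mem] at hH hK
        refine σ.meet _ hH _ hK ?_
        rw [← Set.smul_set_compl]
        exact Set.smul_set_mono hHK
      dcc := by
        rw [Set.isWF_iff_no_descending_seq]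
        intro f hf hmem
        refine Set.isWF_iff_no_descending_seq.1 σ.dcc (fun n => (g : G)⁻¹ • f n) ?_ ?_
        · intro m n hmn
          have h1 : f n ⊂ f m := hf hmn
          refine ⟨Set.smul_set_mono h1.1, fun h2 => h1.2 ?_⟩
          exact Set.smul_set_subset_smul_set_iff.1 h2
        · intro n
          exact Set.mem_smul_set_iff_inv_smul_mem.1 (hmem n) }
  one_smul σ := SageevVertex.ext (one_smul G σ.carrier)
  mul_smul g h σ := SageevVertex.ext (mul_smul (g : G) (h : G) σ.carrier)

end SageevVertex

/-! ### Automorphisms, axes, and the essential characteristic set -/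

/-- `G` acts on the cube complex `X` by automorphisms. -/
class CubicalAction {V : Type*} (G : Type*) [Group G] [MulAction G V] (X : CubeComplex V) :
    Prop where
  smul_mem : ∀ (g : G), ∀ C ∈ X.cubes, g • C ∈ X.cubes

namespace CubeComplex

variable {V : Type*} (X : CubeComplex V) {G : Type*} [Group G] [MulAction G V]

/-- `g` acts without inversion: no half-space is exchanged with its opposite. -/
def ActsWithoutInversion (g : G) : Prop := ∀ H ∈ X.halfspaces, g • H ≠ Hᶜ

/-- The translation distance `ℓ_g`, the minimum of `d(x, gx)` over the vertices `x`. -/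
noncomputable def translationDist (g : G) : ℕ := ⨅ v : V, X.graph.dist v (g • v)

def IsHyperbolic (g : G) : Prop := X.ActsWithoutInversion g ∧ 0 < X.translationDist g

/-- `L` is a combinatorial axis of `g`, parametrized in the forward direction: a bi-infinite
geodesic on which `g` acts as translation by `ℓ_g`. -/
def IsAxis (g : G) (L : ℤ → V) : Prop :=
  (∀ m n : ℤ, X.graph.dist (L m) (L n) = (m - n).natAbs) ∧
    ∀ n : ℤ, g • L n = L (n + X.translationDist g)

/-- The positive half-space axis `𝔸_g⁺`: the half-spaces dual to a positively oriented edge in a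
combinatorial axis of `g`. -/
def axisPos (g : G) : Set (Set V) :=
  {H ∈ X.halfspaces | ∃ L : ℤ → V, X.IsAxis g L ∧ ∃ n : ℤ, L n ∉ H ∧ L (n + 1) ∈ H}

/-- The full half-space axis `𝔸_g = 𝔸_g⁺ ⊔ 𝔸_g⁻`. -/
def axis (g : G) : Set (Set V) := X.axisPos g ∪ {H | Hᶜ ∈ X.axisPos g}

section Invariance

variable [CubicalAction G X]

theorem smul_adj (g : G) {u v : V} (h : X.graph.Adj u v) : X.graph.Adj (g • u) (g • v) := by
  have h1 : g • ({u, v} : Set V) ∈ X.cubes := CubicalAction.smul_mem g _ (X.edge_mem u v h)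
  have hne : g • u ≠ g • v := fun h0 => h.ne (MulAction.injective g h0)
  have h2 : g • ({u, v} : Set V) = {g • u, g • v} := by
    rw [← Set.image_smul, Set.image_pair]
  rw [h2] at h1
  obtain ⟨n, ⟨e⟩⟩ := X.isCube _ h1
  have hcon : ∀ x y : Fin n → Bool, x ≠ y → (e x).1 ≠ (e y).1 := fun x y hxy h0 =>
    hxy (e.injective (Subtype.ext h0))
  have hex : ∃ x y : Fin n → Bool, (hypercube n).Adj x y := by
    rcases n with _ | n
    · exfalso
      apply hne
      have := e.symm.injective (Subsingleton.elim (e.symm ⟨g • u, by simp⟩)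
        (e.symm ⟨g • v, by simp⟩))
      exact congrArg Subtype.val this
    · refine ⟨fun _ => false, Function.update (fun _ => false) 0 true, 0, by simp, ?_⟩
      intro j hj
      by_contra hj0
      exact hj (by simp [Function.update_of_ne hj0])
  obtain ⟨x, y, hxy⟩ := hex
  have ha : X.graph.Adj (e x).1 (e y).1 := e.map_rel_iff.2 hxy
  have hx := (e x).2
  have hy := (e y).2
  rcases hx with hx | hx <;> rcases hy with hy | hy
  · exact absurd (hx.trans hy.symm) ha.ne
  · rw [hx, Set.mem_singleton_iff.1 hy] at ha
    exact ha
  · rw [hy, Set.mem_singleton_iff.1 hx] at ha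
    exact ha.symm
  · exact absurd ((Set.mem_singleton_iff.1 hx).trans (Set.mem_singleton_iff.1 hy).symm) ha.ne

theorem smul_hyperplane (g : G) {e f : Sym2 V} (h : f ∈ X.hyperplane e) :
    f.map (g • ·) ∈ X.hyperplane (e.map (g • ·)) := by
  change Relation.EqvGen _ _ _ at h
  change Relation.EqvGen _ _ _
  induction h with
  | rel e f h =>
    refine Relation.EqvGen.rel _ _ ?_
    obtain ⟨a, b, c, d, h1, h2, h3, h4, h5, rfl, rfl⟩ := h
    refine ⟨g • a, g • b, g • c, g • d, X.smul_adj g h1, X.smul_adj g h2, X.smul_adj g h3,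
      X.smul_adj g h4, ?_, rfl, rfl⟩
    have h6 := CubicalAction.smul_mem g _ h5
    simpa only [← Set.image_smul, Set.image_insert_eq, Set.image_singleton] using h6
  | refl e => exact Relation.EqvGen.refl _
  | symm e f _ ih => exact Relation.EqvGen.symm _ _ ih
  | trans e f k _ _ ih1 ih2 => exact Relation.EqvGen.trans _ _ _ ih1 ih2

theorem smul_reachable (g : G) {e : Sym2 V} {u v : V}
    (h : (X.graph.deleteEdges (X.hyperplane e)).Reachable u v) :
    (X.graph.deleteEdges (X.hyperplane (e.map (g • ·)))).Reachable (g • u) (g • v) := by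
  let φ : X.graph.deleteEdges (X.hyperplane e) →g
      X.graph.deleteEdges (X.hyperplane (e.map (g • ·))) :=
    { toFun := (g • ·)
      map_rel' := by
        intro a b hab
        rw [SimpleGraph.deleteEdges_adj] at hab ⊢
        refine ⟨X.smul_adj g hab.1, fun h0 => hab.2 ?_⟩
        have h1 := X.smul_hyperplane g⁻¹ h0
        simpa [Sym2.map_map, Function.comp_def] using h1 }
  exact h.map φ

theorem smul_mem_halfspaces (g : G) {H : Set V} (hH : H ∈ X.halfspaces) :
    g • H ∈ X.halfspaces := by
  obtain ⟨e, he, v, rfl⟩ := hH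
  refine ⟨e.map (g • ·), ?_, g • v, ?_⟩
  · induction e with
    | _ a b => exact X.smul_adj g he
  · ext w
    rw [Set.mem_smul_set_iff_inv_smul_mem]
    constructor
    · intro h
      simpa using X.smul_reachable g h
    · intro h
      have h1 := X.smul_reachable g⁻¹ h
      simpa [Sym2.map_map, Function.comp_def] using h1

theorem smul_mem_axisPos (g : G) {H : Set V} (hH : H ∈ X.axisPos g) : g • H ∈ X.axisPos g := by
  obtain ⟨h1, L, hL, n, h2, h3⟩ := hH
  refine ⟨X.smul_mem_halfspaces g h1, L, hL, n + X.translationDist g, ?_, ?_⟩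
  · rwa [← hL.2, Set.smul_mem_smul_set_iff]
  · rw [add_right_comm, ← hL.2, Set.smul_mem_smul_set_iff]
    exact h3

theorem inv_smul_mem_axisPos (g : G) {H : Set V} (hH : H ∈ X.axisPos g) :
    g⁻¹ • H ∈ X.axisPos g := by
  obtain ⟨h1, L, hL, n, h2, h3⟩ := hH
  have key : ∀ m : ℤ, L m = g • L (m - X.translationDist g) := fun m => by
    rw [hL.2, sub_add_cancel]
  refine ⟨X.smul_mem_halfspaces g⁻¹ h1, L, hL, n - X.translationDist g, ?_, ?_⟩
  · rw [Set.mem_inv_smul_set_iff, ← key]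
    exact h2
  · rw [Set.mem_inv_smul_set_iff, show n - (X.translationDist g : ℤ) + 1 =
      n + 1 - X.translationDist g by ring, ← key]
    exact h3

theorem zpowers_le_stabilizer_axis (g : G) :
    Subgroup.zpowers g ≤ MulAction.stabilizer G (X.axis g) := by
  rw [Subgroup.zpowers_le, MulAction.mem_stabilizer_iff]
  ext H
  rw [Set.mem_smul_set_iff_inv_smul_mem]
  constructor
  · rintro (h | h)
    · left
      simpa using X.smul_mem_axisPos g h
    · right
      have h1 := X.smul_mem_axisPos g h
      rw [← Set.smul_set_compl] at h1
      simpa using h1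
  · rintro (h | h)
    · exact Or.inl (X.inv_smul_mem_axisPos g h)
    · right
      have h1 := X.inv_smul_mem_axisPos g h
      rw [Set.smul_set_compl] at h1
      exact h1

end Invariance

/-- The vertices of the essential characteristic set `X(𝔸_g)` of `g`. -/
abbrev EssVertex (g : G) : Type _ := SageevVertex (X.axis g)

/-- The essential characteristic set of `g`: the Sageev complex `X(𝔸_g)`. -/
abbrev ess (g : G) : CubeComplex (X.EssVertex g) := SageevVertex.complex (X.axis g)

/-- The action of `⟨g⟩` on the essential characteristic set, induced by its action on `𝔸_g`. -/
instance [CubicalAction G X] (g : G) : MulAction (Subgroup.zpowers g) (X.EssVertex g) :=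
  MulAction.compHom _ (Subgroup.inclusion (X.zpowers_le_stabilizer_axis g))

/-- `⟨g⟩` acts non-transversely on the essential characteristic set: for `H ∈ 𝔸_g`, the
half-spaces of `X(𝔸_g)` given by `H` and `gH` are not transverse. -/
def ActsNonTransversely (g : G) : Prop :=
  ∀ H ∈ X.axis g,
    ¬ Transverse (SageevVertex.half (X.axis g) H) (SageevVertex.half (X.axis g) (g • H))

/-- The elements of `𝔸_g⁺` dual to the edges of a cube `C` of the essential characteristic set. -/
def dualPos (g : G) (C : Set (X.EssVertex g)) : Set (Set V) :=
  {H ∈ X.axisPos g | ∃ x ∈ C, ∃ y ∈ C, (X.ess g).graph.Adj x y ∧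
    x ∉ SageevVertex.half (X.axis g) H ∧ y ∈ SageevVertex.half (X.axis g) H}

/-- `o` is the minimal vertex of the cube `C`: the elements of `𝔸_g⁺` dual to `C` form the interval
`[o, y]` for a vertex `y` of `C`. -/
def IsMinimalVertex (g : G) (C : Set (X.EssVertex g)) (o : X.EssVertex g) : Prop :=
  o ∈ C ∧ ∃ y ∈ C, X.dualPos g C = SageevVertex.interval o y

/-- `[A, gA]`, computed in `𝔸_g⁺` ordered by inclusion. -/
def closedSpan (g : G) (A : Set (Set V)) : Set (Set V) :=
  {K ∈ X.axisPos g | ∃ H ∈ A ∪ g • A, ∃ H' ∈ A ∪ g • A, H' ⊆ K ∧ K ⊆ H}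

/-- `[A, gA) = [A, gA] - gA`. -/
def halfOpenSpan (g : G) (A : Set (Set V)) : Set (Set V) := X.closedSpan g A \ (g • A)

end CubeComplex

/-! ### The standard cubing of `ℝ^d` -/

/-- The standard integer cubing of `ℝ^d`: the vertices are the integer points, the edges are the
unit segments parallel to a coordinate axis, and all cubes are filled in. -/
def stdCubing (d : ℕ) : CubeComplex (Fin d → ℤ) :=
  SimpleGraph.cubeCompletion
    { Adj := fun x y => ∃ i, (y i = x i + 1 ∨ x i = y i + 1) ∧ ∀ j, j ≠ i → x j = y j
      symm := ⟨fun _ _ ⟨i, h1, h2⟩ => ⟨i, h1.symm, fun j hj => (h2 j hj).symm⟩⟩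
      loopless := ⟨fun _ ⟨_, h1, _⟩ => by omega⟩ }

/-- The cube `[0,1]^d`. -/
def unitCube (d : ℕ) : Set (Fin d → ℤ) := {x | ∀ i, x i = 0 ∨ x i = 1}

/-- `𝓗^i`, the set of the half-spaces `H^i_n = {x | x_i ≥ n + 1/2}` of `ℝ^d` with `n ∈ ℤ`. -/
def coordHalfspaces (d : ℕ) (i : Fin d) : Set (Set (Fin d → ℤ)) :=
  {K | ∃ n : ℤ, K = {x | (n : ℝ) + 1 / 2 ≤ (x i : ℝ)}}

/-- `𝓗⁺(ℝ^d)`, the union of the sets `𝓗^i`. -/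
def stdPosHalfspaces (d : ℕ) : Set (Set (Fin d → ℤ)) := ⋃ i, coordHalfspaces d i

/-!
As `X` is simply connected with flag links, two edge paths with the same endpoints differ by
square moves only, provided that no sequence of such moves makes either of them backtrack.
Therefore a geodesic crosses every hyperplane at most once, and a combinatorial axis `L` of `g`
enters every half-space of `𝔸_g⁺` exactly once. The times of entry rank `𝔸_g⁺` injectively by
integers, compatibly with inclusion, and `g` moves every member properly into itself, by `ℓ_g`
ranks. In particular antichains in `𝔸_g⁺` have at most `ℓ_g` members.

Let `A` be a maximum antichain. Dilworth's theorem colors the part of `𝔸_g⁺` between `A` and `gA`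
by `d = |A|` chains, and the powers of `g` carry this coloring to all of `𝔸_g⁺`: it splits into
`d` bi-infinite chains, which `g` permutes and shifts. Counting along the chains the half-spaces
that contain a vertex of `E_g` embeds `E_g` in `ℤ^d`. The embedding is isometric because one of the
half-spaces that separate two vertices can always be crossed in a single step. The half-spaces dual
to a cube of dimension `d` are themselves a maximum antichain, so the chains can be made to start
there, and the first chain can be chosen maximal, hence without gaps, between `A` and `gA`.
-/

/-! ### Faces of cubes -/

section Hypercube

variable {m n : ℕ}

/-- The vertex of the hypercube joined to `a` by the edge in the `i`-th direction. -/
def flipCoord (a : Fin n → Bool) (i : Fin n) : Fin n → Bool := Function.update a i (!a i)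

theorem flipCoord_self (a : Fin n → Bool) (i : Fin n) : flipCoord a i i = !a i :=
  Function.update_self ..

theorem flipCoord_of_ne {i j : Fin n} (h : j ≠ i) (a : Fin n → Bool) : flipCoord a i j = a j :=
  Function.update_of_ne h ..

theorem flipCoord_comm (a : Fin n → Bool) (i j : Fin n) :
    flipCoord (flipCoord a i) j = flipCoord (flipCoord a j) i := by
  rcases eq_or_ne i j with rfl | hij
  · rfl
  · rw [flipCoord, flipCoord_of_ne hij.symm, flipCoord, Function.update_comm hij, flipCoord,
      flipCoord_of_ne hij, flipCoord]

theorem flipCoord_injective (a : Fin n → Bool) : Function.Injective (flipCoord a) := by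
  intro i j h
  by_contra hij
  simpa [flipCoord_self, flipCoord_of_ne hij] using congrFun h i

theorem flipCoord_flipCoord_ne {i j : Fin n} (hij : i ≠ j) (a : Fin n → Bool) :
    flipCoord (flipCoord a i) j ≠ a := by
  intro h
  simpa [flipCoord_self, flipCoord_of_ne hij.symm] using congrFun h j

theorem hypercube_adj_iff {x y : Fin n → Bool} :
    (hypercube n).Adj x y ↔ ∃ i, y = flipCoord x i := by
  constructor
  · rintro ⟨i, hi, hu⟩
    refine ⟨i, funext fun j => ?_⟩
    by_cases hj : j = i
    · subst hj
      rw [flipCoord_self]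
      exact Bool.eq_not.2 hi.symm
    · rw [flipCoord_of_ne hj]
      exact not_not.1 fun hne => hj (hu j (Ne.symm hne))
  · rintro ⟨i, rfl⟩
    refine ⟨i, by simp [flipCoord_self], fun j hj => ?_⟩
    by_contra hne
    exact hj (flipCoord_of_ne hne x).symm

theorem hypercube_adj_flipCoord (a : Fin n → Bool) (i : Fin n) :
    (hypercube n).Adj a (flipCoord a i) :=
  hypercube_adj_iff.2 ⟨i, rfl⟩

/-- The face of a hypercube through `a` in the directions `ι`. -/
noncomputable def hypercubeFace (a : Fin n → Bool) (ι : Fin m ↪ Fin n) :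
    hypercube m ↪g hypercube n where
  toFun y l := xor (a l) (Function.extend ι y (fun _ => false) l)
  inj' y y' h := funext fun k => by simpa [ι.injective.extend_apply] using congrFun h (ι k)
  map_rel_iff' {y y'} := by
    have differ_iff (k : Fin m) :
        xor (a (ι k)) (Function.extend ι y (fun _ => false) (ι k)) ≠
          xor (a (ι k)) (Function.extend ι y' (fun _ => false) (ι k)) ↔ y k ≠ y' k := by
      simp [ι.injective.extend_apply]
    have mem_range_of_differ (l : Fin n)
        (hl : xor (a l) (Function.extend ι y (fun _ => false) l) ≠
          xor (a l) (Function.extend ι y' (fun _ => false) l)) : ∃ k, ι k = l := by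
      by_contra hne
      simp [Function.extend_apply' _ _ _ hne] at hl
    constructor
    · rintro ⟨l, hl, hu⟩
      obtain ⟨k, rfl⟩ := mem_range_of_differ l hl
      exact ⟨k, (differ_iff k).1 hl, fun k' hk' => ι.injective (hu _ ((differ_iff k').2 hk'))⟩
    · rintro ⟨k, hk, hu⟩
      refine ⟨ι k, (differ_iff k).2 hk, fun l hl => ?_⟩
      obtain ⟨k', rfl⟩ := mem_range_of_differ l hl
      rw [hu k' ((differ_iff k').1 hl)]

theorem hypercubeFace_apply (a : Fin n → Bool) (ι : Fin m ↪ Fin n) (y : Fin m → Bool)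
    (l : Fin n) : hypercubeFace a ι y l = xor (a l) (Function.extend ι y (fun _ => false) l) :=
  rfl

theorem range_hypercubeFace_pair (a : Fin n → Bool) {i j : Fin n} (ι : Fin 2 ↪ Fin n)
    (hi : ι 0 = i) (hj : ι 1 = j) : Set.range (hypercubeFace a ι) =
      {a, flipCoord a i, flipCoord (flipCoord a i) j, flipCoord a j} := by
  have hij : i ≠ j := by
    rintro rfl
    exact zero_ne_one (ι.injective (hi.trans hj.symm))
  have face_apply (y : Fin 2 → Bool) : hypercubeFace a ι y =
      Function.update (Function.update a i (xor (a i) (y 0))) j (xor (a j) (y 1)) := by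
    funext l
    rw [hypercubeFace_apply]
    by_cases hlj : l = j
    · rw [hlj, Function.update_self, ← hj, ι.injective.extend_apply]
    by_cases hli : l = i
    · rw [hli, Function.update_of_ne hij, Function.update_self, ← hi, ι.injective.extend_apply]
    · rw [Function.update_of_ne hlj, Function.update_of_ne hli, Function.extend_apply',
        Bool.xor_false]
      rintro ⟨k, hk⟩
      fin_cases k
      exacts [hli (hk.symm.trans hi), hlj (hk.symm.trans hj)]
  have update_self : Function.update (flipCoord a i) j (a j) = flipCoord a i := by
    rw [Function.update_eq_self_iff, flipCoord_of_ne hij.symm]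
  have flip_flip : Function.update (flipCoord a i) j (!a j) = flipCoord (flipCoord a i) j := by
    rw [flipCoord.eq_1 (flipCoord a i), flipCoord_of_ne hij.symm]
  ext x
  simp only [Set.mem_insert_iff, Set.mem_singleton_iff, Set.mem_range, face_apply]
  constructor
  · rintro ⟨y, rfl⟩
    cases y 0 <;> cases y 1 <;> simp [← flipCoord.eq_1, update_self, flip_flip]
  · rintro (rfl | rfl | rfl | rfl)
    · exact ⟨![false, false], by simp⟩
    · exact ⟨![true, false], by simp [← flipCoord.eq_1, update_self]⟩
    · exact ⟨![true, true], by simp [← flipCoord.eq_1, flip_flip]⟩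
    · exact ⟨![false, true], by simp [← flipCoord.eq_1]⟩

theorem hypercube_not_adj_of_adj_of_adj {x y z : Fin n → Bool} (hxy : (hypercube n).Adj x y)
    (hyz : (hypercube n).Adj y z) : ¬ (hypercube n).Adj x z := by
  obtain ⟨i, rfl⟩ := hypercube_adj_iff.1 hxy
  obtain ⟨j, rfl⟩ := hypercube_adj_iff.1 hyz
  rintro ⟨k, hk, hku⟩
  rcases eq_or_ne i j with rfl | hij
  · rcases eq_or_ne k i with rfl | hki
    · simp [flipCoord_self] at hk
    · simp [flipCoord_of_ne hki] at hk
  · exact hij <| (hku i (by simp [flipCoord_self, flipCoord_of_ne hij])).trans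
      (hku j (by simp [flipCoord_self, flipCoord_of_ne hij.symm])).symm

end Hypercube

namespace CubeComplex

variable {V : Type*} {X : CubeComplex V}

/-- `a, b, c, d` are the successive vertices of a square of `X`. -/
structure Square (X : CubeComplex V) (a b c d : V) : Prop where
  ab : X.graph.Adj a b
  bc : X.graph.Adj b c
  cd : X.graph.Adj c d
  da : X.graph.Adj d a
  ac : a ≠ c
  bd : b ≠ d
  mem : {a, b, c, d} ∈ X.cubes

namespace Square

variable {a b c d : V}

theorem rotate (h : X.Square a b c d) : X.Square b c d a where
  ab := h.bc
  bc := h.cd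
  cd := h.da
  da := h.ab
  ac := h.bd
  bd := h.ac.symm
  mem := by
    convert h.mem using 1
    grind

theorem reflect (h : X.Square a b c d) : X.Square a d c b where
  ab := h.da.symm
  bc := h.cd.symm
  cd := h.bc.symm
  da := h.ab.symm
  ac := h.ac
  bd := h.bd.symm
  mem := by
    convert h.mem using 1
    grind

theorem not_adj (h : X.Square a b c d) : ¬ X.graph.Adj a c := by
  intro hac
  obtain ⟨n, ⟨e⟩⟩ := X.isCube _ h.mem
  let C : Set V := {a, b, c, d}
  let a' : C := ⟨a, by simp [C]⟩
  let b' : C := ⟨b, by simp [C]⟩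
  let c' : C := ⟨c, by simp [C]⟩
  have symm_adj (x y : C) (hxy : X.graph.Adj x.1 y.1) :
      (hypercube n).Adj (e.symm x) (e.symm y) := e.symm.map_rel_iff.2 hxy
  exact hypercube_not_adj_of_adj_of_adj (symm_adj a' b' h.ab) (symm_adj b' c' h.bc)
    (symm_adj a' c' hac)

theorem linkSimplex_eq (h : X.Square a b c d) : X.linkSimplex a {a, b, c, d} = {b, d} := by
  ext x
  simp only [linkSimplex, Set.mem_ofPred_eq, Set.mem_insert_iff, Set.mem_singleton_iff]
  constructor
  · rintro ⟨rfl | rfl | rfl | rfl, hx⟩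
    · exact absurd hx X.graph.irrefl
    · exact Or.inl rfl
    · exact absurd hx h.not_adj
    · exact Or.inr rfl
  · rintro (rfl | rfl)
    · exact ⟨by simp, h.ab⟩
    · exact ⟨by simp, h.da.symm⟩

theorem eq_of_isFlagLink (ha : X.IsFlagLink a) {c' : V} (h : X.Square a b c d)
    (h' : X.Square a b c' d) : c = c' := by
  have same_cube : ({a, b, c, d} : Set V) = {a, b, c', d} :=
    ha.1 _ h.mem _ h'.mem (by simp) (by simp) (h.linkSimplex_eq.trans h'.linkSimplex_eq.symm)
  have hc : c ∈ ({a, b, c', d} : Set V) := by simp [← same_cube]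
  rcases hc with hc | hc | hc | hc
  · exact absurd hc h.ac.symm
  · exact absurd hc h.bc.ne.symm
  · exact hc
  · exact absurd hc h.cd.ne

end Square

theorem ncard_cube_ne_three {C : Set V} (hC : C ∈ X.cubes) : C.ncard ≠ 3 := by
  obtain ⟨n, ⟨e⟩⟩ := X.isCube C hC
  have ncard_eq : C.ncard = 2 ^ n := by
    rw [← Nat.card_coe_set_eq, ← Nat.card_congr e.toEquiv]
    simp
  rw [ncard_eq]
  rcases n with _ | n
  · norm_num
  · rw [pow_succ]
    omega

/-- The alternative is not excluded by the definition of `OppositeEdges`: there, an edge counts as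
opposite to its own reverse. -/
theorem square_or_eq_and_eq {a b c d : V} (hab : X.graph.Adj a b) (hbc : X.graph.Adj b c)
    (hcd : X.graph.Adj c d) (hda : X.graph.Adj d a) (h : {a, b, c, d} ∈ X.cubes) :
    X.Square a b c d ∨ (a = c ∧ b = d) := by
  by_cases hac : a = c
  · subst hac
    refine Or.inr ⟨rfl, not_not.1 fun hbd => ncard_cube_ne_three h ?_⟩
    exact Set.ncard_eq_three.2 ⟨a, b, d, hab.ne, hda.ne.symm, hbd, by grind⟩
  · refine Or.inl ⟨hab, hbc, hcd, hda, hac, ?_, h⟩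
    rintro rfl
    exact ncard_cube_ne_three h (Set.ncard_eq_three.2 ⟨a, b, c, hab.ne, hac, hbc.ne, by grind⟩)

theorem face_image_mem {C : Set V} (hC : C ∈ X.cubes) {m n : ℕ}
    (e : hypercube n ≃g X.graph.induce C) (ψ : hypercube m ↪g hypercube n) :
    (fun x => (e x : V)) '' Set.range ψ ∈ X.cubes := by
  let f : hypercube m ↪g X.graph :=
    (SimpleGraph.Embedding.induce C).comp (e.toEmbedding.comp ψ)
  have range_f : (fun x => (e x : V)) '' Set.range ψ = Set.range f := (Set.range_comp _ ψ).symm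
  rw [range_f]
  refine X.face_mem C hC _ ?_ ⟨m, ⟨f.isoInduceRange⟩⟩
  rintro _ ⟨y, rfl⟩
  exact (e (ψ y)).2

theorem square_of_cube {C : Set V} (hC : C ∈ X.cubes) {n : ℕ}
    (e : hypercube n ≃g X.graph.induce C) (a : Fin n → Bool) {i j : Fin n} (hij : i ≠ j) :
    X.Square (e a) (e (flipCoord a i)) (e (flipCoord (flipCoord a i) j)) (e (flipCoord a j)) := by
  have adj_flip (x : Fin n → Bool) (k : Fin n) : X.graph.Adj (e x : V) (e (flipCoord x k)) :=
    e.map_rel_iff.2 (hypercube_adj_flipCoord x k)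
  have coe_injective : Function.Injective fun x => (e x : V) :=
    Subtype.val_injective.comp e.injective
  refine ⟨adj_flip _ _, adj_flip _ _, ?_, (adj_flip _ _).symm,
    coe_injective.ne (flipCoord_flipCoord_ne hij a).symm,
    coe_injective.ne ((flipCoord_injective a).ne hij), ?_⟩
  · rw [flipCoord_comm]
    exact (adj_flip _ _).symm
  · let ι : Fin 2 ↪ Fin n := ⟨![i, j], by
      intro p q
      fin_cases p <;> fin_cases q <;> simp [hij, hij.symm]⟩
    have face_mem := face_image_mem hC e (hypercubeFace a ι)
    rwa [range_hypercubeFace_pair (i := i) (j := j) a ι rfl rfl, Set.image_insert_eq,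
      Set.image_insert_eq, Set.image_pair] at face_mem

theorem exists_flipCoord_of_mem_linkSimplex {C : Set V} {n : ℕ}
    (e : hypercube n ≃g X.graph.induce C) {a : Fin n → Bool} {v : V}
    (hv : v ∈ X.linkSimplex (e a) C) : ∃ i, (e (flipCoord a i) : V) = v := by
  obtain ⟨b, hb⟩ := e.surjective ⟨v, hv.1⟩
  have hab : (hypercube n).Adj a b := by
    refine e.map_rel_iff.1 ?_
    rw [hb]
    exact hv.2
  obtain ⟨i, rfl⟩ := hypercube_adj_iff.1 hab
  exact ⟨i, by rw [hb]⟩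

theorem exists_cube_of_three_squares {w x y z p q r : V} (hw : X.IsFlagLink w)
    (hxy : X.Square w x p y) (hyz : X.Square w y q z) (hxz : X.Square w x r z) :
    ∃ C ∈ X.cubes, w ∈ C ∧ X.linkSimplex w C = {x, y, z} := by
  classical
  have edge {a b c : V} (h : X.Square w a c b) :
      ∃ Q ∈ X.cubes, w ∈ Q ∧ X.linkSimplex w Q = {a, b} :=
    ⟨_, h.mem, by simp, h.linkSimplex_eq⟩
  obtain ⟨C, hC, hwC, hlink⟩ := hw.2 {x, y, z}
    (by
      simp only [Finset.forall_mem_insert, Finset.mem_singleton, forall_eq]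
      exact ⟨hxy.ab, hyz.ab, hyz.da.symm⟩)
    (by
      simp only [Finset.forall_mem_insert, Finset.mem_singleton, forall_eq, ne_eq,
        not_true_eq_false, IsEmpty.forall_iff, true_and, and_true]
      exact ⟨⟨fun _ => edge hxy, fun _ => edge hxz⟩,
        ⟨fun _ => edge hxy.reflect, fun _ => edge hyz⟩,
        fun _ => edge hxz.reflect, fun _ => edge hyz.reflect⟩)
  exact ⟨C, hC, hwC, by simpa using hlink⟩

/-- The three squares span a `3`-cube, by flagness; `c` is its vertex opposite to `w`. -/
theorem exists_opposite_vertex (hX : ∀ v, X.IsFlagLink v) {w x y z p q r : V}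
    (hxy : X.Square w x p y) (hyz : X.Square w y q z) (hxz : X.Square w x r z) :
    ∃ c, X.Square x p c r ∧ X.Square y p c q ∧ X.Square z r c q := by
  obtain ⟨C, hC, hw, hlink⟩ := exists_cube_of_three_squares (hX w) hxy hyz hxz
  obtain ⟨n, ⟨e⟩⟩ := X.isCube C hC
  obtain ⟨a, ha⟩ := e.surjective ⟨w, hw⟩
  obtain rfl : (e a : V) = w := by rw [ha]
  obtain ⟨i, rfl⟩ := exists_flipCoord_of_mem_linkSimplex e (hlink.ge (by simp) : x ∈ _)
  obtain ⟨j, rfl⟩ := exists_flipCoord_of_mem_linkSimplex e (hlink.ge (by simp) : y ∈ _)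
  obtain ⟨k, rfl⟩ := exists_flipCoord_of_mem_linkSimplex e (hlink.ge (by simp) : z ∈ _)
  have hij : i ≠ j := fun h => hxy.bd (by rw [h])
  have hjk : j ≠ k := fun h => hyz.bd (by rw [h])
  have hik : i ≠ k := fun h => hxz.bd (by rw [h])
  obtain rfl := hxy.eq_of_isFlagLink (hX _) (square_of_cube hC e a hij)
  obtain rfl := hyz.eq_of_isFlagLink (hX _) (square_of_cube hC e a hjk)
  obtain rfl := hxz.eq_of_isFlagLink (hX _) (square_of_cube hC e a hik)
  refine ⟨e (flipCoord (flipCoord (flipCoord a i) j) k),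
    square_of_cube hC e (flipCoord a i) hjk, ?_, ?_⟩
  · rw [flipCoord_comm a i j]
    exact square_of_cube hC e (flipCoord a j) hik
  · rw [flipCoord_comm a i k, flipCoord_comm a j k, flipCoord_comm (flipCoord a i) j k,
      flipCoord_comm a i k]
    exact square_of_cube hC e (flipCoord a k) hij

end CubeComplex

/-! ### Edge paths up to square moves -/

namespace CubeComplex

variable {V : Type*} (X : CubeComplex V)

/-- Edge paths that differ by pushing across squares. An edge path is listed from its last vertex
to its first, so that prolonging a path is `List.cons`. -/
inductive SwapEq : List V → List V → Prop
  | refl (l : List V) : SwapEq l l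
  | symm {l l' : List V} : SwapEq l l' → SwapEq l' l
  | trans {l l' l'' : List V} : SwapEq l l' → SwapEq l' l'' → SwapEq l l''
  | cons {l l' : List V} (x : V) : SwapEq l l' → SwapEq (x :: l) (x :: l')
  | square {v w z t : V} (l : List V) (h : X.Square v w z t) :
      SwapEq (z :: w :: v :: l) (z :: t :: v :: l)

/-- What `x :: p` and `x :: p'` being related by `SwapEq` says about `p` and `p'`: either these are
related as well, or square moves bring both of the final edges into one square at `x`. -/
inductive TailEq (x : V) (p p' : List V) : Prop
  | same : X.SwapEq p p' → TailEq x p p'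
  | square {w t w' : V} {q : List V} : X.Square x w t w' → X.SwapEq p (w :: t :: q) →
      X.SwapEq p' (w' :: t :: q) → TailEq x p p'

variable {X}

namespace SwapEq

theorem head?_eq {l l' : List V} (h : X.SwapEq l l') : l.head? = l'.head? := by
  induction h with
  | refl | cons | square => rfl
  | symm _ ih => exact ih.symm
  | trans _ _ ih ih' => exact ih.trans ih'

theorem head_eq {x y : V} {l l' : List V} (h : X.SwapEq (x :: l) (y :: l')) : x = y := by
  simpa using h.head?_eq

theorem length_eq {l l' : List V} (h : X.SwapEq l l') : l.length = l'.length := by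
  induction h with
  | refl | square => rfl
  | symm _ ih => exact ih.symm
  | trans _ _ ih ih' => exact ih.trans ih'
  | cons x _ ih => simp [ih]

theorem getLast?_eq {l l' : List V} (h : X.SwapEq l l') : l.getLast? = l'.getLast? := by
  induction h with
  | refl => rfl
  | symm _ ih => exact ih.symm
  | trans _ _ ih ih' => exact ih.trans ih'
  | cons x _ ih => simp [List.getLast?_cons, ih]
  | square => simp [List.getLast?_cons]

theorem isChain_iff {l l' : List V} (h : X.SwapEq l l') :
    l.IsChain X.graph.Adj ↔ l'.IsChain X.graph.Adj := by
  induction h with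
  | refl => rfl
  | symm _ ih => exact ih.symm
  | trans _ _ ih ih' => exact ih.trans ih'
  | cons x h ih => rw [List.isChain_cons, List.isChain_cons, ih, h.head?_eq]
  | square l h => simp only [List.isChain_cons_cons, h.bc.symm, h.ab.symm, h.cd, h.da, true_and]

end SwapEq

namespace TailEq

theorem symm {x : V} {p p' : List V} (h : X.TailEq x p p') : X.TailEq x p' p := by
  cases h with
  | same h => exact .same h.symm
  | square hs h h' => exact .square hs.reflect h' h

/-- Two squares at `x` that share the middle edge `x - w` are joined by the square below `w`: this
is where flagness of the link of `x` enters. -/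
theorem trans (hX : ∀ v, X.IsFlagLink v) {x : V} {p₁ p₂ p₃ : List V}
    (IH : ∀ y r r', r.length < p₁.length → X.SwapEq (y :: r) (y :: r') → X.TailEq y r r')
    (h₁₂ : X.TailEq x p₁ p₂) (h₂₃ : X.TailEq x p₂ p₃) : X.TailEq x p₁ p₃ := by
  rcases h₁₂ with h₁ | @⟨w₁, t, w₂, q, s₁₂, h₁, h₂⟩
  · rcases h₂₃ with h₂ | ⟨s₂₃, h₂, h₃⟩
    · exact .same (h₁.trans h₂)
    · exact .square s₂₃ (h₁.trans h₂) h₃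
  rcases h₂₃ with h₃ | ⟨s₂₃, h₂', h₃⟩
  · exact .square s₁₂ h₁ (h₃.symm.trans h₂)
  have tails := h₂.symm.trans h₂'
  obtain rfl := tails.head_eq
  have shorter : (t :: q).length < p₁.length := by simp [h₁.length_eq]
  rcases IH _ _ _ shorter tails with h | ⟨s, h, h'⟩
  · obtain rfl := h.head_eq
    obtain rfl := s₁₂.reflect.rotate.eq_of_isFlagLink (hX _) s₂₃.rotate
    exact .same (h₁.trans ((h.cons _).trans h₃.symm))
  · obtain rfl := h.head_eq
    obtain rfl := h'.head_eq
    obtain ⟨c, hc, hc₁, hc₃⟩ := exists_opposite_vertex hX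
      s₁₂.reflect.rotate.reflect s s₂₃.rotate.reflect
    exact .square hc
      ((h₁.trans (h.cons _)).trans (.square _ hc₁.rotate.rotate.rotate))
      ((h₃.trans (h'.cons _)).trans (.square _ hc₃.rotate.rotate.rotate))

end TailEq

theorem SwapEq.tailEq (hX : ∀ v, X.IsFlagLink v) {x : V} {p p' : List V}
    (h : X.SwapEq (x :: p) (x :: p')) : X.TailEq x p p' := by
  induction hn : p.length using Nat.strong_induction_on generalizing x p p' with
  | _ n IH =>
  subst hn
  suffices H : ∀ l l', X.SwapEq l l' → ∀ p₁ p₂, l = x :: p₁ → l' = x :: p₂ →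
      p₁.length = p.length → X.TailEq x p₁ p₂ from H _ _ h _ _ rfl rfl rfl
  intro l l' h
  induction h with
  | refl l =>
    rintro p₁ p₂ rfl ⟨⟩ -
    exact .same (.refl _)
  | symm h ih =>
    rintro p₁ p₂ rfl rfl hn
    exact (ih _ _ rfl rfl ((by simpa using h.length_eq : p₂.length = p₁.length).trans hn)).symm
  | @trans _ l₂ _ h₁₂ h₂₃ ih₁₂ ih₂₃ =>
    rintro p₁ p₃ rfl rfl hn
    obtain ⟨p₂, rfl⟩ : ∃ p₂, l₂ = x :: p₂ := by
      simpa [List.head?_eq_some_iff] using h₁₂.head?_eq.symm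
    have hn₂ : p₂.length = p.length := by simpa [hn] using h₁₂.length_eq.symm
    exact TailEq.trans hX (fun _ _ _ hr e => IH _ (hn ▸ hr) e rfl)
      (ih₁₂ _ _ rfl rfl hn) (ih₂₃ _ _ rfl rfl hn₂)
  | cons y h =>
    rintro p₁ p₂ ⟨⟩ ⟨⟩ -
    exact .same h
  | square l h =>
    rintro p₁ p₂ ⟨⟩ ⟨⟩ -
    exact .square h.rotate.rotate.reflect (.refl _) (.refl _)

/-- Edge paths that contain a backtrack. -/
inductive Backtracks : List V → Prop
  | here (x y : V) (l : List V) : Backtracks (x :: y :: x :: l)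
  | cons (x : V) {l : List V} : Backtracks l → Backtracks (x :: l)

theorem Backtracks.exists_shorter {l : List V} (h : Backtracks l) :
    ∃ l' : List V, l'.length + 2 = l.length ∧ l'.head? = l.head? ∧ l'.getLast? = l.getLast? ∧
      (l.IsChain X.graph.Adj → l'.IsChain X.graph.Adj) := by
  induction h with
  | here x y l =>
    refine ⟨x :: l, rfl, rfl, by simp [List.getLast?_cons], fun h => ?_⟩
    rw [List.isChain_cons_cons, List.isChain_cons_cons] at h
    exact h.2.2
  | cons x _ ih =>
    obtain ⟨l', length_eq, head_eq, last_eq, chain⟩ := ih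
    refine ⟨x :: l', by simp [← length_eq], rfl, by simp [List.getLast?_cons, last_eq],
      fun h => ?_⟩
    rw [List.isChain_cons] at h ⊢
    rw [head_eq]
    exact ⟨h.1, chain h.2⟩

variable (X) in
/-- No sequence of square moves produces a backtrack. -/
def Reduced (l : List V) : Prop := ∀ l', X.SwapEq l l' → ¬ Backtracks l'

variable (X) in
/-- After square moves, the last edge of the path `l` comes from `w`. -/
def EndsFrom (l : List V) (w : V) : Prop := ∃ y s, X.SwapEq l (y :: w :: s)

theorem EndsFrom.congr {l l' : List V} {w : V} (h : X.EndsFrom l w) (e : X.SwapEq l l') :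
    X.EndsFrom l' w :=
  let ⟨y, s, h⟩ := h
  ⟨y, s, e.symm.trans h⟩

namespace Reduced

theorem congr {l l' : List V} (h : X.Reduced l) (e : X.SwapEq l l') : X.Reduced l' :=
  fun _ e' => h _ (e.trans e')

theorem of_cons {x : V} {l : List V} (h : X.Reduced (x :: l)) : X.Reduced l :=
  fun _ e' hb => h _ (e'.cons x) (hb.cons x)

theorem not_endsFrom {x : V} {l : List V} (h : X.Reduced (x :: l)) : ¬ X.EndsFrom l x :=
  fun ⟨_, _, e⟩ => h _ (e.cons x) (.here _ _ _)

theorem singleton (b : V) : X.Reduced [b] := by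
  intro l h hb
  have length_eq := h.length_eq
  rcases hb with _ | ⟨x, hb⟩
  · simp at length_eq
  · cases hb <;> simp at length_eq

theorem endsFrom_of_backtracks (hX : ∀ v, X.IsFlagLink v) {x : V} {l r : List V}
    (h : X.Reduced l) (hr : X.SwapEq (x :: l) r) (hb : Backtracks r) : X.EndsFrom l x := by
  induction hn : l.length using Nat.strong_induction_on generalizing x l r with
  | _ n IH =>
  subst hn
  rcases hb with ⟨_, y, b⟩ | @⟨_, r, hb⟩ <;> obtain rfl := hr.head_eq
  · rcases hr.tailEq hX with e | @⟨w, t, w', q, hs, e, e'⟩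
    · exact ⟨_, _, e⟩
    obtain rfl := e'.head_eq
    rcases e'.tailEq hX with f | ⟨hs', f, f'⟩
    · exact absurd f.head_eq hs.ac
    · obtain rfl := f.head_eq
      obtain rfl := f'.head_eq
      obtain rfl := hs'.eq_of_isFlagLink (hX _) hs.reflect.rotate.reflect
      exact absurd (.here _ _ _) (h _ (e.trans (f'.cons _)))
  · rcases hr.tailEq hX with e | @⟨w, t, w', q, hs, e, e'⟩
    · exact absurd hb (h _ e)
    · have shorter : (t :: q).length < l.length := by simp [e.length_eq]
      obtain ⟨y, s, f⟩ := IH _ shorter (h.congr e).of_cons e'.symm hb rfl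
      obtain rfl := f.head_eq
      exact ⟨w, w' :: s, (e.trans (f.cons _)).trans (.square _ hs.reflect.rotate)⟩

theorem cons (hX : ∀ v, X.IsFlagLink v) {x : V} {l : List V} (h : X.Reduced l)
    (hne : ¬ X.EndsFrom l x) : X.Reduced (x :: l) :=
  fun _ hr hb => hne (h.endsFrom_of_backtracks hX hr hb)

end Reduced

theorem exists_eq_cons_of_head? {l : List V} {v : V} (h : l.head? = some v) :
    ∃ l', l = v :: l' :=
  (List.head?_eq_some_iff ..).1 h

open Classical in
variable (X) in
/-- Prolong a reduced path by an edge to `w`, or delete its last edge if that one comes from `w`. -/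
noncomputable def step (l : List V) (w : V) : List V :=
  if h : ∃ s y, X.SwapEq l (y :: w :: s) then w :: h.choose else w :: l

theorem step_of_not_endsFrom {l : List V} {w : V} (h : ¬ X.EndsFrom l w) :
    X.step l w = w :: l := by
  rw [step, dif_neg]
  rintro ⟨s, y, h'⟩
  exact h ⟨y, s, h'⟩

theorem step_of_swapEq (hX : ∀ v, X.IsFlagLink v) {l s : List V} {y w : V}
    (h : X.SwapEq l (y :: w :: s)) : X.SwapEq (X.step l w) (w :: s) := by
  have hex : ∃ s y, X.SwapEq l (y :: w :: s) := ⟨s, y, h⟩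
  rw [step, dif_pos hex]
  obtain ⟨y', h'⟩ := hex.choose_spec
  have e := h'.symm.trans h
  obtain rfl := e.head_eq
  rcases e.tailEq hX with e | ⟨hs, e, e'⟩
  · exact e
  · exact absurd (e.head_eq.symm.trans e'.head_eq) hs.bd

theorem step_congr (hX : ∀ v, X.IsFlagLink v) {l l' : List V} (h : X.SwapEq l l') (w : V) :
    X.SwapEq (X.step l w) (X.step l' w) := by
  by_cases hw : X.EndsFrom l w
  · obtain ⟨y, s, e⟩ := hw
    exact (step_of_swapEq hX e).trans (step_of_swapEq hX (h.symm.trans e)).symm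
  · rw [step_of_not_endsFrom hw, step_of_not_endsFrom fun hw' => hw (hw'.congr h.symm)]
    exact h.cons w

theorem head?_step (l : List V) (w : V) : (X.step l w).head? = some w := by
  rw [step]
  split_ifs <;> rfl

theorem Reduced.step (hX : ∀ v, X.IsFlagLink v) {l : List V} (h : X.Reduced l) (w : V) :
    X.Reduced (X.step l w) := by
  by_cases hw : X.EndsFrom l w
  · obtain ⟨y, s, e⟩ := hw
    exact (h.congr e).of_cons.congr (step_of_swapEq hX e).symm
  · rw [step_of_not_endsFrom hw]
    exact h.cons hX hw

theorem step_step (hX : ∀ v, X.IsFlagLink v) {l : List V} {v : V} (h : X.Reduced l)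
    (hv : l.head? = some v) (w : V) : X.SwapEq (X.step (X.step l w) v) l := by
  obtain ⟨l, rfl⟩ := exists_eq_cons_of_head? hv
  by_cases hw : X.EndsFrom (v :: l) w
  · obtain ⟨y, s, e⟩ := hw
    obtain rfl := e.head_eq
    refine (step_congr hX (step_of_swapEq hX e) v).trans ?_
    rw [step_of_not_endsFrom (h.congr e).not_endsFrom]
    exact e.symm
  · rw [step_of_not_endsFrom hw]
    exact step_of_swapEq hX (.refl _)

section StepSquare

variable {l : List V} {v w z t : V}

theorem step_square_of_endsFrom_both (hX : ∀ v, X.IsFlagLink v) (hs : X.Square v w z t)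
    (hw : X.EndsFrom (v :: l) w) (ht : X.EndsFrom (v :: l) t) :
    X.SwapEq (X.step (X.step (v :: l) w) z) (X.step (X.step (v :: l) t) z) := by
  obtain ⟨_, s, ew⟩ := hw
  obtain ⟨_, s', et⟩ := ht
  obtain rfl := ew.head_eq
  obtain rfl := et.head_eq
  rcases (ew.symm.trans et).tailEq hX with e | ⟨hs', e, e'⟩
  · exact absurd e.head_eq hs.bd
  · obtain rfl := e.head_eq
    obtain rfl := e'.head_eq
    obtain rfl := hs.eq_of_isFlagLink (hX _) hs'
    exact (step_of_swapEq hX ((step_of_swapEq hX ew).trans e)).trans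
      (step_of_swapEq hX ((step_of_swapEq hX et).trans e')).symm

theorem step_square_of_endsFrom_left (hX : ∀ v, X.IsFlagLink v) (hs : X.Square v w z t)
    (hw : X.EndsFrom (v :: l) w) (ht : ¬ X.EndsFrom (v :: l) t) :
    X.SwapEq (X.step (X.step (v :: l) w) z) (X.step (X.step (v :: l) t) z) := by
  obtain ⟨_, s, ew⟩ := hw
  obtain rfl := ew.head_eq
  have not_endsFrom : ¬ X.EndsFrom (w :: s) z := by
    rintro ⟨_, s', e⟩
    obtain rfl := e.head_eq
    exact ht ⟨v, z :: s', (ew.trans (e.cons v)).trans (.square _ hs.rotate.rotate.reflect)⟩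
  have left_eq := step_congr hX (step_of_swapEq hX ew) z
  rw [step_of_not_endsFrom not_endsFrom] at left_eq
  refine left_eq.trans ?_
  rw [step_of_not_endsFrom ht]
  exact (step_of_swapEq hX ((ew.cons t).trans
    (.square s hs.reflect.rotate.rotate.rotate))).symm

theorem not_endsFrom_cons_of_square (hX : ∀ v, X.IsFlagLink v) (hs : X.Square v w z t)
    (ht : ¬ X.EndsFrom (v :: l) t) : ¬ X.EndsFrom (w :: v :: l) z := by
  rintro ⟨_, s, e⟩
  obtain rfl := e.head_eq
  rcases e.tailEq hX with e | ⟨hs', e, e'⟩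
  · exact hs.ac e.head_eq
  · obtain rfl := e.head_eq
    obtain rfl := e'.head_eq
    obtain rfl := hs'.eq_of_isFlagLink (hX _) hs.reflect.rotate.rotate.rotate
    exact ht ⟨_, _, e⟩

theorem step_square (hX : ∀ v, X.IsFlagLink v) (hv : l.head? = some v) (hs : X.Square v w z t) :
    X.SwapEq (X.step (X.step l w) z) (X.step (X.step l t) z) := by
  obtain ⟨l, rfl⟩ := exists_eq_cons_of_head? hv
  by_cases hw : X.EndsFrom (v :: l) w <;> by_cases ht : X.EndsFrom (v :: l) t
  · exact step_square_of_endsFrom_both hX hs hw ht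
  · exact step_square_of_endsFrom_left hX hs hw ht
  · exact (step_square_of_endsFrom_left hX hs.reflect ht hw).symm
  · rw [step_of_not_endsFrom hw, step_of_not_endsFrom ht,
      step_of_not_endsFrom (not_endsFrom_cons_of_square hX hs ht),
      step_of_not_endsFrom (not_endsFrom_cons_of_square hX hs.reflect hw)]
    exact .square _ hs

end StepSquare

variable (X) in
/-- The reduced form of the concatenation of the reduced path `l` with an edge path. -/
noncomputable def transport : ∀ {u v : V}, X.graph.Walk u v → List V → List V
  | _, _, .nil, l => l
  | _, _, .cons (v := w) _ p, l => transport p (X.step l w)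

theorem transport_append {u v w : V} (p : X.graph.Walk u v) (q : X.graph.Walk v w) (l : List V) :
    X.transport (p.append q) l = X.transport q (X.transport p l) := by
  induction p generalizing l with
  | nil => rfl
  | cons _ _ ih => exact ih _ _

theorem transport_congr (hX : ∀ v, X.IsFlagLink v) {u v : V} (p : X.graph.Walk u v)
    {l l' : List V} (h : X.SwapEq l l') : X.SwapEq (X.transport p l) (X.transport p l') := by
  induction p generalizing l l' with
  | nil => exact h
  | cons _ _ ih => exact ih (step_congr hX h _)

theorem head?_transport {u v : V} (p : X.graph.Walk u v) {l : List V} (h : l.head? = some u) :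
    (X.transport p l).head? = some v := by
  induction p generalizing l with
  | nil => exact h
  | cons _ _ ih => exact ih (head?_step _ _)

theorem Reduced.transport (hX : ∀ v, X.IsFlagLink v) {u v : V} (p : X.graph.Walk u v)
    {l : List V} (h : X.Reduced l) : X.Reduced (X.transport p l) := by
  induction p generalizing l with
  | nil => exact h
  | cons _ _ ih => exact ih (h.step hX _)

theorem transport_reverse (hX : ∀ v, X.IsFlagLink v) {u v : V} (p : X.graph.Walk u v)
    {l : List V} (hl : X.Reduced l) (hu : l.head? = some u) :
    X.SwapEq (X.transport p.reverse (X.transport p l)) l := by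
  induction p generalizing l with
  | nil => exact .refl _
  | @cons u w _ _ _ ih =>
    rw [SimpleGraph.Walk.reverse_cons, transport_append]
    exact (step_congr hX (ih (hl.step hX w) (head?_step _ _)) u).trans (step_step hX hl hu w)

theorem Homotopic.transport (hX : ∀ v, X.IsFlagLink v) {u v : V} {p q : X.graph.Walk u v}
    (h : X.Homotopic p q) {l : List V} (hl : X.Reduced l) (hu : l.head? = some u) :
    X.SwapEq (X.transport p l) (X.transport q l) := by
  induction h with
  | refl p => exact .refl _
  | symm _ ih => exact ih.symm
  | trans _ _ ih ih' => exact ih.trans ih'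
  | @backtrack _ w _ p _ q =>
    rw [transport_append, transport_append]
    exact transport_congr hX q (step_step hX (hl.transport hX p) (head?_transport p hu) w)
  | @square _ _ _ _ _ p hab hbc had hdc q hsq =>
    rw [transport_append, transport_append]
    refine transport_congr hX q ?_
    rcases square_or_eq_and_eq hab hbc hdc.symm had.symm hsq with h | ⟨rfl, rfl⟩
    · exact step_square hX (head?_transport p hu) h
    · exact .refl _

theorem IsCAT0.transport_swapEq (hX : X.IsCAT0) {u v : V} (p q : X.graph.Walk u v) {l : List V}
    (hl : X.Reduced l) (hu : l.head? = some u) :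
    X.SwapEq (X.transport p l) (X.transport q l) := by
  have closed : X.SwapEq (X.transport q.reverse (X.transport p l)) l := by
    rw [← transport_append]
    exact (hX.simplyConnected.2 u (p.append q.reverse)).transport hX.flagLink hl hu
  have back := transport_reverse hX.flagLink q.reverse (hl.transport hX.flagLink p)
    (head?_transport p hu)
  rw [SimpleGraph.Walk.reverse_reverse] at back
  exact back.symm.trans (transport_congr hX.flagLink q closed)

variable (X) in
/-- `l` is an edge path from `b` to `v`, listed from `v` to `b`. -/
structure IsEdgePath (l : List V) (b v : V) : Prop where
  isChain : l.IsChain X.graph.Adj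
  head?_eq : l.head? = some v
  getLast?_eq : l.getLast? = some b

namespace IsEdgePath

theorem singleton (b : V) : X.IsEdgePath [b] b b := ⟨List.isChain_singleton b, rfl, rfl⟩

theorem congr {l l' : List V} {b v : V} (h : X.IsEdgePath l b v) (e : X.SwapEq l l') :
    X.IsEdgePath l' b v :=
  ⟨e.isChain_iff.1 h.isChain, e.head?_eq ▸ h.head?_eq, e.getLast?_eq ▸ h.getLast?_eq⟩

theorem cons {l : List V} {b v x : V} (h : X.IsEdgePath l b v) (hvx : X.graph.Adj v x) :
    X.IsEdgePath (x :: l) b x := by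
  refine ⟨List.isChain_cons.2 ⟨fun y hy => ?_, h.isChain⟩, rfl, ?_⟩
  · obtain rfl : v = y := by simpa [h.head?_eq] using hy
    exact hvx.symm
  · rw [List.getLast?_cons, h.getLast?_eq]
    rfl

theorem of_cons {l : List V} {b v x y : V} (h : X.IsEdgePath (x :: y :: l) b v) :
    x = v ∧ X.graph.Adj v y ∧ X.IsEdgePath (y :: l) b y := by
  obtain ⟨chain, head, last⟩ := h
  obtain rfl : x = v := by simpa using head
  rw [List.isChain_cons_cons] at chain
  exact ⟨rfl, chain.1, chain.2, rfl, by simpa [List.getLast?_cons] using last⟩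

theorem exists_transport_swapEq {b v : V} {l : List V} (h : X.IsEdgePath l b v)
    (hl : X.Reduced l) : ∃ p : X.graph.Walk b v, X.SwapEq (X.transport p [b]) l := by
  induction l generalizing v with
  | nil => simpa using h.head?_eq
  | cons x l ih =>
    cases l with
    | nil =>
      obtain rfl : x = v := by simpa using h.head?_eq
      obtain rfl : x = b := by simpa using h.getLast?_eq
      exact ⟨.nil, .refl _⟩
    | cons y l =>
      obtain ⟨rfl, adj, h⟩ := h.of_cons
      obtain ⟨p, hp⟩ := ih h hl.of_cons
      refine ⟨p.append (.cons adj.symm .nil), ?_⟩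
      rw [transport_append]
      change X.SwapEq (X.step _ _) _
      rw [step_of_not_endsFrom fun hx => hl.not_endsFrom (hx.congr hp)]
      exact hp.cons x

end IsEdgePath

theorem IsCAT0.swapEq_of_reduced (hX : X.IsCAT0) {l l' : List V} {b v : V}
    (h : X.IsEdgePath l b v) (h' : X.IsEdgePath l' b v) (hl : X.Reduced l) (hl' : X.Reduced l') :
    X.SwapEq l l' := by
  obtain ⟨p, hp⟩ := h.exists_transport_swapEq hl
  obtain ⟨q, hq⟩ := h'.exists_transport_swapEq hl'
  exact hp.symm.trans ((hX.transport_swapEq p q (.singleton b) rfl).trans hq)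

end CubeComplex

/-! ### Geodesics and half-spaces of CAT(0) cube complexes -/

namespace CubeComplex

variable {V : Type*} {X : CubeComplex V}

namespace IsEdgePath

theorem dist_lt_length {b v : V} {l : List V} (h : X.IsEdgePath l b v) :
    X.graph.dist v b < l.length := by
  suffices ∃ p : X.graph.Walk v b, p.length + 1 = l.length by
    obtain ⟨p, hp⟩ := this
    exact hp ▸ Nat.lt_succ_of_le (SimpleGraph.dist_le p)
  induction l generalizing v with
  | nil => simpa using h.head?_eq
  | cons x l ih =>
    cases l with
    | nil =>
      obtain rfl : x = v := by simpa using h.head?_eq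
      obtain rfl : x = b := by simpa using h.getLast?_eq
      exact ⟨.nil, rfl⟩
    | cons y l =>
      obtain ⟨rfl, adj, h⟩ := h.of_cons
      obtain ⟨p, hp⟩ := ih h
      exact ⟨.cons adj p, by simpa using hp⟩

theorem reduced_of_length_eq {b v : V} {l : List V} (h : X.IsEdgePath l b v)
    (hl : l.length = X.graph.dist v b + 1) : X.Reduced l := by
  intro l' e backtracks
  have h' := h.congr e
  obtain ⟨l'', length_eq, head_eq, last_eq, chain⟩ := backtracks.exists_shorter (X := X)
  have shorter := dist_lt_length
    ⟨chain h'.isChain, head_eq.trans h'.head?_eq, last_eq.trans h'.getLast?_eq⟩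
  have := e.length_eq
  omega

theorem exists_length_eq_dist (hX : X.graph.Connected) (v b : V) :
    ∃ l, X.IsEdgePath l b v ∧ l.length = X.graph.dist v b + 1 := by
  obtain ⟨p, hp⟩ := hX.exists_walk_length_eq_dist v b
  rw [← hp]
  clear hp
  induction p with
  | nil => exact ⟨_, .singleton _, rfl⟩
  | cons adj _ ih =>
    obtain ⟨l, h, length_eq⟩ := ih
    exact ⟨_, h.cons adj.symm, by simp [length_eq]⟩

end IsEdgePath

theorem exists_reduced_of_dist_eq_add_one (hX : X.graph.Connected) {b v u : V}
    (hvu : X.graph.Adj v u) (hu : X.graph.dist v b = X.graph.dist u b + 1) :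
    ∃ p, X.IsEdgePath (u :: p) b u ∧ (u :: p).length = X.graph.dist u b + 1 ∧
      X.IsEdgePath (v :: u :: p) b v ∧ X.Reduced (v :: u :: p) := by
  obtain ⟨l, hl, length_eq⟩ := IsEdgePath.exists_length_eq_dist hX u b
  obtain ⟨p, rfl⟩ := exists_eq_cons_of_head? hl.head?_eq
  have hvl := hl.cons hvu.symm
  exact ⟨p, hl, length_eq, hvl, hvl.reduced_of_length_eq (by rw [List.length_cons, length_eq, hu])⟩

namespace IsCAT0

theorem exists_square_of_dist_eq_add_one (hX : X.IsCAT0) {b v u w : V} (hvu : X.graph.Adj v u)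
    (hvw : X.graph.Adj v w) (huw : u ≠ w) (hu : X.graph.dist v b = X.graph.dist u b + 1)
    (hw : X.graph.dist v b = X.graph.dist w b + 1) :
    ∃ t, X.Square v u t w ∧ X.graph.dist t b < X.graph.dist u b := by
  obtain ⟨p, hup, length_eq, hvup, redu⟩ :=
    exists_reduced_of_dist_eq_add_one hX.simplyConnected.1 hvu hu
  obtain ⟨p', -, -, hvwp, redw⟩ := exists_reduced_of_dist_eq_add_one hX.simplyConnected.1 hvw hw
  rcases (hX.swapEq_of_reduced hvup hvwp redu redw).tailEq hX.flagLink with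
    e | @⟨_, t, _, q, hs, e, e'⟩
  · exact absurd e.head_eq huw
  · obtain rfl := e.head_eq
    obtain rfl := e'.head_eq
    refine ⟨t, hs, ?_⟩
    have shorter := ((hup.congr e).of_cons).2.2.dist_lt_length
    have := e.length_eq
    simp only [List.length_cons] at shorter length_eq this
    omega

end IsCAT0

theorem Homotopic.length_mod_two {u v : V} {p q : X.graph.Walk u v} (h : X.Homotopic p q) :
    p.length % 2 = q.length % 2 := by
  induction h with
  | refl => rfl
  | symm _ ih => exact ih.symm
  | trans _ _ ih ih' => exact ih.trans ih'
  | backtrack =>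
    simp only [SimpleGraph.Walk.length_append, SimpleGraph.Walk.length_cons]
    omega
  | square => simp only [SimpleGraph.Walk.length_append, SimpleGraph.Walk.length_cons]

namespace IsCAT0

theorem dist_ne_of_adj (hX : X.IsCAT0) {u v : V} (h : X.graph.Adj u v) (b : V) :
    X.graph.dist u b ≠ X.graph.dist v b := by
  intro heq
  obtain ⟨p, hp⟩ := hX.simplyConnected.1.exists_walk_length_eq_dist u b
  obtain ⟨q, hq⟩ := hX.simplyConnected.1.exists_walk_length_eq_dist v b
  have even_length := (hX.simplyConnected.2 b (p.reverse.append (.cons h q))).length_mod_two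
  simp only [SimpleGraph.Walk.length_append, SimpleGraph.Walk.length_cons,
    SimpleGraph.Walk.length_reverse, SimpleGraph.Walk.length_nil] at even_length
  omega

theorem dist_eq_add_one_or (hX : X.IsCAT0) {u v : V} (h : X.graph.Adj u v) (b : V) :
    X.graph.dist u b = X.graph.dist v b + 1 ∨ X.graph.dist v b = X.graph.dist u b + 1 := by
  have hne := hX.dist_ne_of_adj h b
  have huv := hX.simplyConnected.1.dist_triangle (u := u) (v := v) (w := b)
  have hvu := hX.simplyConnected.1.dist_triangle (u := v) (v := u) (w := b)
  rw [SimpleGraph.dist_eq_one_iff_adj.2 h] at huv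
  rw [SimpleGraph.dist_eq_one_iff_adj.2 h.symm] at hvu
  omega

theorem dist_lt_of_square (hX : X.IsCAT0) {a b c d : V} (h : X.Square a b c d) (p : V)
    (hab : X.graph.dist a p < X.graph.dist b p) : X.graph.dist d p < X.graph.dist c p := by
  by_contra hcd
  have := hX.dist_eq_add_one_or h.ab p
  have := hX.dist_eq_add_one_or h.bc p
  have := hX.dist_eq_add_one_or h.cd p
  have := hX.dist_eq_add_one_or h.da p
  obtain ⟨t, hs, ht⟩ :=
    hX.exists_square_of_dist_eq_add_one (b := p) h.ab.symm h.bc h.ac (by omega) (by omega)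
  obtain rfl := hs.eq_of_isFlagLink (hX.flagLink _) h.rotate.reflect
  omega

theorem dist_lt_iff_of_square (hX : X.IsCAT0) {a b c d : V} (h : X.Square a b c d) (p : V) :
    X.graph.dist a p < X.graph.dist b p ↔ X.graph.dist d p < X.graph.dist c p :=
  ⟨hX.dist_lt_of_square h p, hX.dist_lt_of_square h.reflect.rotate p⟩

end IsCAT0

variable (X) in
/-- `p` and `q` lie on the same side of the edge `e`: they have the same nearest endpoint. -/
def SameSide (p q : V) (e : Sym2 V) : Prop :=
  ∀ u v, e = s(u, v) → (X.graph.dist u p < X.graph.dist v p ↔ X.graph.dist u q < X.graph.dist v q)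

theorem sameSide_mk_iff {p q x y : V} : X.SameSide p q s(x, y) ↔
    (X.graph.dist x p < X.graph.dist y p ↔ X.graph.dist x q < X.graph.dist y q) ∧
    (X.graph.dist y p < X.graph.dist x p ↔ X.graph.dist y q < X.graph.dist x q) := by
  constructor
  · exact fun h => ⟨h x y rfl, h y x Sym2.eq_swap⟩
  · rintro ⟨hxy, hyx⟩ u v huv
    rcases Sym2.eq_iff.1 huv with ⟨rfl, rfl⟩ | ⟨rfl, rfl⟩
    exacts [hxy, hyx]

theorem IsCAT0.sameSide_iff (hX : X.IsCAT0) {e f : Sym2 V} (h : f ∈ X.hyperplane e) (p q : V) :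
    X.SameSide p q e ↔ X.SameSide p q f := by
  change Relation.EqvGen _ _ _ at h
  induction h with
  | refl => rfl
  | symm _ _ _ ih => exact ih.symm
  | trans _ _ _ _ _ ih ih' => exact ih.trans ih'
  | rel e f h =>
    obtain ⟨a, b, c, d, hab, hbc, hcd, hda, hC, rfl, rfl⟩ := h
    rw [sameSide_mk_iff, sameSide_mk_iff]
    rcases square_or_eq_and_eq hab hbc hcd hda hC with h | ⟨rfl, rfl⟩
    · have h' : X.Square b a d c := h.reflect.rotate.rotate.rotate
      rw [hX.dist_lt_iff_of_square h p, hX.dist_lt_iff_of_square h q,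
        hX.dist_lt_iff_of_square h' p, hX.dist_lt_iff_of_square h' q]
    · exact and_comm

variable (X) in
/-- `L` is a bi-infinite combinatorial geodesic parametrized by arc length. -/
def IsGeodesicLine (L : ℤ → V) : Prop :=
  ∀ m n : ℤ, X.graph.dist (L m) (L n) = (m - n).natAbs

namespace IsGeodesicLine

variable {L : ℤ → V} {m n : ℤ}

theorem adj (hL : X.IsGeodesicLine L) (n : ℤ) : X.graph.Adj (L n) (L (n + 1)) := by
  rw [← SimpleGraph.dist_eq_one_iff_adj, hL]
  omega

theorem notMem_hyperplane (hX : X.IsCAT0) (hL : X.IsGeodesicLine L) (hnm : n ≠ m) :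
    s(L m, L (m + 1)) ∉ X.hyperplane s(L n, L (n + 1)) := by
  wlog hlt : n < m generalizing m n
  · intro h
    exact this hnm.symm (by omega) (Relation.EqvGen.symm _ _ h)
  intro h
  have same_side : X.SameSide (L m) (L (m + 1)) s(L n, L (n + 1)) := by
    rw [sameSide_mk_iff]
    simp only [hL _ _]
    omega
  have lt_iff := (hX.sameSide_iff h _ _).1 same_side _ _ rfl
  simp only [hL _ _] at lt_iff
  omega

end IsGeodesicLine

theorem halfspace_eq_setOf_reachable {H : Set V} (hH : H ∈ X.halfspaces) {x y : V}
    (hxy : X.graph.Adj x y) (hx : x ∉ H) (hy : y ∈ H) :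
    H = {w | (X.graph.deleteEdges (X.hyperplane s(x, y))).Reachable y w} := by
  obtain ⟨e, -, v, rfl⟩ := hH
  have crosses : s(x, y) ∈ X.hyperplane e := by
    by_contra hne
    refine hx (SimpleGraph.Reachable.trans hy (SimpleGraph.Adj.reachable ?_))
    rw [SimpleGraph.deleteEdges_adj]
    exact ⟨hxy.symm, by rwa [Sym2.eq_swap]⟩
  have hyperplane_eq : X.hyperplane s(x, y) = X.hyperplane e := by
    ext f
    exact ⟨fun h => Relation.EqvGen.trans _ _ _ crosses h,
      fun h => Relation.EqvGen.trans _ _ _ (Relation.EqvGen.symm _ _ crosses) h⟩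
  rw [hyperplane_eq]
  ext w
  exact ⟨fun h => SimpleGraph.Reachable.trans (SimpleGraph.Reachable.symm hy) h,
    fun h => SimpleGraph.Reachable.trans hy h⟩

theorem eq_of_mem_halfspaces {H K : Set V} (hH : H ∈ X.halfspaces) (hK : K ∈ X.halfspaces)
    {x y : V} (hxy : X.graph.Adj x y) (hxH : x ∉ H) (hyH : y ∈ H) (hxK : x ∉ K) (hyK : y ∈ K) :
    H = K :=
  (halfspace_eq_setOf_reachable hH hxy hxH hyH).trans
    (halfspace_eq_setOf_reachable hK hxy hxK hyK).symm

theorem finite_separating (hX : X.graph.Connected) (x y : V) :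
    {H ∈ X.halfspaces | x ∉ H ∧ y ∈ H}.Finite := by
  obtain ⟨p⟩ := hX.preconnected x y
  induction p with
  | nil => simp
  | @cons u w v h _ ih =>
    have subsingleton : {H ∈ X.halfspaces | u ∉ H ∧ w ∈ H}.Subsingleton := fun H hH K hK =>
      eq_of_mem_halfspaces hH.1 hK.1 h hH.2.1 hH.2.2 hK.2.1 hK.2.2
    refine (subsingleton.finite.union ih).subset ?_
    rintro H ⟨hH, hu, hv⟩
    by_cases hw : w ∈ H
    · exact Or.inl ⟨hH, hu, hw⟩
    · exact Or.inr ⟨hH, hw, hv⟩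

namespace IsGeodesicLine

variable {L : ℤ → V} {H : Set V} {n : ℤ}

theorem mem_succ_iff (hX : X.IsCAT0) (hL : X.IsGeodesicLine L) (hH : H ∈ X.halfspaces)
    (hn : L n ∉ H) (hn' : L (n + 1) ∈ H) {j : ℤ} (hj : j ≠ n) : L (j + 1) ∈ H ↔ L j ∈ H := by
  have not_crossed :
      (X.graph.deleteEdges (X.hyperplane s(L n, L (n + 1)))).Adj (L j) (L (j + 1)) := by
    rw [SimpleGraph.deleteEdges_adj]
    exact ⟨hL.adj j, hL.notMem_hyperplane hX hj.symm⟩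
  rw [halfspace_eq_setOf_reachable hH (hL.adj n) hn hn']
  exact ⟨fun h => SimpleGraph.Reachable.trans h not_crossed.symm.reachable,
    fun h => SimpleGraph.Reachable.trans h not_crossed.reachable⟩

theorem mem_iff (hX : X.IsCAT0) (hL : X.IsGeodesicLine L) (hH : H ∈ X.halfspaces)
    (hn : L n ∉ H) (hn' : L (n + 1) ∈ H) (m : ℤ) : L m ∈ H ↔ n < m := by
  have mem_of_lt (m : ℤ) (hm : n + 1 ≤ m) : L m ∈ H := by
    induction m, hm using Int.leInduction with
    | base => exact hn'
    | succ j hj ih => exact (hL.mem_succ_iff hX hH hn hn' (by omega)).2 ih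
  have notMem_of_le (m : ℤ) (hm : m ≤ n) : L m ∉ H := by
    induction m, hm using Int.leInductionDown with
    | base => exact hn
    | pred j hj ih =>
      rwa [← hL.mem_succ_iff hX hH hn hn' (by omega : j - 1 ≠ n), sub_add_cancel]
  exact ⟨fun h => not_le.1 fun hm => notMem_of_le m hm h, mem_of_lt m⟩

end IsGeodesicLine

end CubeComplex

/-! ### The half-space axis of a hyperbolic automorphism -/

theorem exists_not_and_succ {p : ℤ → Prop} {i j : ℤ} (hij : i ≤ j) (hi : ¬ p i) (hj : p j) :
    ∃ n, ¬ p n ∧ p (n + 1) := by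
  by_contra! never
  exact Int.leInduction (motive := fun n _ => ¬ p n) hi (fun n _ => never n) j hij hj

section RankedSystems

variable {V : Type*} {P : Set (Set V)} {pos : Set V → ℤ}

/-- A collection `P` of sets, ranked by integers compatibly with inclusion, in which no two members
are disjoint or cover the whole space. -/
structure IsRankedSystem (P : Set (Set V)) (pos : Set V → ℤ) : Prop where
  not_subset_compl : ∀ H ∈ P, ∀ K ∈ P, ¬ H ⊆ Kᶜ
  not_compl_subset : ∀ H ∈ P, ∀ K ∈ P, ¬ Hᶜ ⊆ K
  injOn : Set.InjOn pos P
  le_of_subset : ∀ H ∈ P, ∀ K ∈ P, H ⊆ K → pos K ≤ pos H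

/-- A ranked system `P` each of whose members is moved properly into itself by `g`, by `ℓ` ranks. -/
structure IsTranslatedSystem {G : Type*} [Group G] [MulAction G V] (P : Set (Set V))
    (pos : Set V → ℤ) (ℓ : ℤ) (g : G) : Prop extends IsRankedSystem P pos where
  length_pos : 0 < ℓ
  smul_mem : ∀ H ∈ P, g • H ∈ P
  inv_smul_mem : ∀ H ∈ P, g⁻¹ • H ∈ P
  smul_ssubset : ∀ H ∈ P, g • H ⊂ H
  pos_smul : ∀ H ∈ P, pos (g • H) = pos H + ℓ

theorem IsRankedSystem.of_forall_mem_iff {L : ℤ → V} (hL : ∀ H ∈ P, ∀ m, L m ∈ H ↔ pos H < m)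
    (hinj : Set.InjOn pos P) : IsRankedSystem P pos where
  not_subset_compl H hH K hK h := by
    refine h ((hL H hH (max (pos H) (pos K) + 1)).2 ?_) ((hL K hK _).2 ?_) <;> omega
  not_compl_subset H hH K hK h := by
    have notMem : L (min (pos H) (pos K)) ∉ H := by rw [hL H hH]; omega
    have mem := (hL K hK _).1 (h notMem)
    omega
  injOn := hinj
  le_of_subset H hH K hK h := by
    have mem := (hL K hK _).1 (h ((hL H hH (pos H + 1)).2 (lt_add_one _)))
    omega

namespace IsRankedSystem

variable {H K : Set V} (h : IsRankedSystem P pos) (hH : H ∈ P) (hK : K ∈ P)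
include h hH hK

theorem lt_of_ssubset (hHK : H ⊂ K) : pos K < pos H :=
  lt_of_le_of_ne (h.le_of_subset H hH K hK hHK.subset) fun e => hHK.ne (h.injOn hK hH e).symm

theorem subset_or_subset_of_not_transverse (hnt : ¬ Transverse H K) : H ⊆ K ∨ K ⊆ H := by
  by_contra! incomparable
  refine hnt ⟨?_, ?_, ?_, ?_⟩
  · rw [← Set.not_disjoint_iff_nonempty_inter, ← Set.subset_compl_iff_disjoint_right]
    exact h.not_subset_compl H hH K hK
  · rw [← Set.sdiff_eq, Set.sdiff_nonempty]
    exact incomparable.1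
  · rw [Set.inter_comm, ← Set.sdiff_eq, Set.sdiff_nonempty]
    exact incomparable.2
  · rw [← Set.sdiff_eq, Set.sdiff_nonempty]
    exact h.not_compl_subset H hH K hK

end IsRankedSystem

end RankedSystems

namespace CubeComplex

variable {V : Type*} {X : CubeComplex V}

section Ultrafilters

variable {𝓗 : Set (Set V)}

/-- The ultrafilter of the half-spaces that contain the vertex `x`. -/
def ultrafilterAt (hX : X.graph.Connected) (h𝓗 : ∀ H ∈ 𝓗, H ∈ X.halfspaces ∨ Hᶜ ∈ X.halfspaces)
    (hc : ∀ H ∈ 𝓗, Hᶜ ∈ 𝓗) (x : V) : SageevVertex 𝓗 where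
  carrier := {H ∈ 𝓗 | x ∈ H}
  subset _ h := h.1
  choice H hH := by
    by_cases hx : x ∈ H
    · exact Or.inl ⟨⟨hH, hx⟩, fun h => h.2 hx⟩
    · exact Or.inr ⟨⟨hc H hH, hx⟩, fun h => hx h.2⟩
  meet H hH K hK h := h hH.2 hK.2
  dcc := by
    rw [Set.isWF_iff_no_descending_seq]
    intro f hf hmem
    obtain ⟨y, -, hy⟩ := Set.exists_of_ssubset (hf zero_lt_one : f 1 ⊂ f 0)
    have finite : ({H ∈ X.halfspaces | y ∉ H ∧ x ∈ H} ∪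
        compl '' {H ∈ X.halfspaces | x ∉ H ∧ y ∈ H}).Finite :=
      (finite_separating hX y x).union ((finite_separating hX x y).image _)
    refine Set.infinite_of_injective_forall_mem
      (hf.injective.comp (add_left_injective 1)) (fun n => ?_) finite
    have y_notMem : y ∉ f (n + 1) := fun h => hy (hf.antitone (Nat.le_add_left 1 n) h)
    obtain ⟨mem, x_mem⟩ := hmem (n + 1)
    rcases h𝓗 _ mem with h | h
    · exact Or.inl ⟨h, y_notMem, x_mem⟩
    · exact Or.inr ⟨_, ⟨h, fun h' => h' x_mem, y_notMem⟩, compl_compl _⟩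

theorem transverse_half (hX : X.graph.Connected)
    (h𝓗 : ∀ H ∈ 𝓗, H ∈ X.halfspaces ∨ Hᶜ ∈ X.halfspaces) (hc : ∀ H ∈ 𝓗, Hᶜ ∈ 𝓗)
    {H K : Set V} (hH : H ∈ 𝓗) (hK : K ∈ 𝓗) (hHK : Transverse H K) :
    Transverse (SageevVertex.half 𝓗 H) (SageevVertex.half 𝓗 K) := by
  have mem_half (x : V) {H : Set V} (hH : H ∈ 𝓗) :
      ultrafilterAt hX h𝓗 hc x ∈ SageevVertex.half 𝓗 H ↔ x ∈ H :=
    ⟨fun h => h.2, fun h => ⟨hH, h⟩⟩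
  obtain ⟨⟨a, ha⟩, ⟨b, hb⟩, ⟨c, hc'⟩, ⟨d, hd⟩⟩ := hHK
  refine ⟨⟨ultrafilterAt hX h𝓗 hc a, ?_⟩, ⟨ultrafilterAt hX h𝓗 hc b, ?_⟩,
    ⟨ultrafilterAt hX h𝓗 hc c, ?_⟩, ⟨ultrafilterAt hX h𝓗 hc d, ?_⟩⟩ <;>
  simpa only [Set.mem_inter_iff, Set.mem_compl_iff, mem_half _ hH, mem_half _ hK]

end Ultrafilters

variable {G : Type*} [Group G] [MulAction G V] {g : G} {H : Set V} {L : ℤ → V}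

theorem compl_mem_axis (h : H ∈ X.axis g) : Hᶜ ∈ X.axis g :=
  h.symm.imp id fun h => by rwa [Set.mem_ofPred_eq, compl_compl]

theorem mem_halfspaces_or_compl_mem_of_mem_axis (h : H ∈ X.axis g) :
    H ∈ X.halfspaces ∨ Hᶜ ∈ X.halfspaces :=
  h.imp And.left And.left

namespace IsAxis

theorem inv_smul (hL : X.IsAxis g L) (n : ℤ) : g⁻¹ • L n = L (n - X.translationDist g) := by
  rw [inv_smul_eq_iff, hL.2, sub_add_cancel]

theorem zpow_smul (hL : X.IsAxis g L) (k n : ℤ) :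
    g ^ k • L n = L (n + k * X.translationDist g) := by
  induction k generalizing n with
  | zero => simp
  | succ k ih =>
    rw [zpow_add_one, mul_smul, hL.2, ih]
    congr 1
    ring
  | pred k ih =>
    rw [zpow_sub_one, mul_smul, hL.inv_smul, ih]
    congr 1
    ring

theorem mem_zpow_smul_iff (hL : X.IsAxis g L) {n : ℤ} (hn : ∀ m, L m ∈ H ↔ n < m) (k m : ℤ) :
    L m ∈ g ^ k • H ↔ n + k * X.translationDist g < m := by
  rw [Set.mem_smul_set_iff_inv_smul_mem, ← zpow_neg, hL.zpow_smul, hn, neg_mul,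
    ← sub_eq_add_neg, lt_sub_iff_add_lt]

theorem zpow_smul_injective (hL : X.IsAxis g L) (hg : 0 < X.translationDist g) {n : ℤ}
    (hn : ∀ m, L m ∈ H ↔ n < m) : Function.Injective fun k : ℤ => g ^ k • H := by
  intro k k' (hk : g ^ k • H = g ^ k' • H)
  have lt_iff (m : ℤ) : n + k * X.translationDist g < m ↔ n + k' * X.translationDist g < m := by
    rw [← hL.mem_zpow_smul_iff hn, hk, hL.mem_zpow_smul_iff hn]
  have shift_eq : k * (X.translationDist g : ℤ) = k' * X.translationDist g :=
    add_left_cancel (eq_of_forall_gt_iff lt_iff)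
  exact mul_right_cancel₀ (by positivity) shift_eq

end IsAxis

variable [CubicalAction G X]

theorem IsAxis.finite_zpow_separating (hL : X.IsAxis g L) (hX : X.graph.Connected)
    (hg : 0 < X.translationDist g) (hH : H ∈ X.halfspaces) {n : ℤ}
    (hn : ∀ m, L m ∈ H ↔ n < m) (x y : V) : {k : ℤ | x ∉ g ^ k • H ∧ y ∈ g ^ k • H}.Finite :=
  ((finite_separating hX x y).preimage (hL.zpow_smul_injective hg hn).injOn).subset
    fun k hk => ⟨X.smul_mem_halfspaces (g ^ k) hH, hk⟩

/-- Otherwise infinitely many translates of `H` would separate a vertex of `L` from a vertex of the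
axis that defines `H`. -/
theorem IsCAT0.exists_forall_mem_iff (hX : X.IsCAT0) (hg : 0 < X.translationDist g)
    (hH : H ∈ X.axisPos g) (hL : X.IsAxis g L) : ∃ n : ℤ, ∀ m, L m ∈ H ↔ n < m := by
  obtain ⟨hHs, L₀, hL₀, n₀, hn₀, hn₀'⟩ := hH
  have mem_L₀ := IsGeodesicLine.mem_iff hX hL₀.1 hHs hn₀ hn₀'
  have finite := hL₀.finite_zpow_separating hX.simplyConnected.1 hg hHs mem_L₀
  have mem_zpow_smul (k : ℤ) : L 0 ∈ g ^ k • H ↔ L (-k * X.translationDist g) ∈ H := by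
    rw [Set.mem_smul_set_iff_inv_smul_mem, ← zpow_neg, hL.zpow_smul, zero_add]
  obtain ⟨a, ha, not_sep⟩ := (Set.Iic_infinite (min 0 (-n₀ - 1))).exists_notMem_finite
    (finite (L 0) (L₀ 0))
  obtain ⟨b, hb, not_sep'⟩ := (Set.Ici_infinite (max 0 (-n₀))).exists_notMem_finite
    (finite (L₀ 0) (L 0))
  rw [Set.mem_Iic, le_min_iff] at ha
  rw [Set.mem_Ici, max_le_iff] at hb
  have pos_mem : L (-a * X.translationDist g) ∈ H := by
    rw [← mem_zpow_smul]
    refine not_not.1 fun h => not_sep ⟨h, (hL₀.mem_zpow_smul_iff mem_L₀ _ _).2 ?_⟩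
    nlinarith [Nat.one_le_cast (α := ℤ).2 hg]
  have neg_notMem : L (-b * X.translationDist g) ∉ H := by
    rw [← mem_zpow_smul]
    refine fun h => not_sep' ⟨fun h' => ?_, h⟩
    rw [hL₀.mem_zpow_smul_iff mem_L₀] at h'
    nlinarith [Nat.one_le_cast (α := ℤ).2 hg]
  obtain ⟨n, hn, hn'⟩ := exists_not_and_succ (p := fun m => L m ∈ H)
    (by nlinarith [Nat.one_le_cast (α := ℤ).2 hg]) neg_notMem pos_mem
  exact ⟨n, IsGeodesicLine.mem_iff hX hL.1 hHs hn hn'⟩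

theorem ActsNonTransversely.not_transverse_smul (hX : X.graph.Connected)
    (hnt : X.ActsNonTransversely g) (hH : H ∈ X.axisPos g) : ¬ Transverse H (g • H) := fun h =>
  hnt H (Or.inl hH) <| transverse_half hX (fun _ => mem_halfspaces_or_compl_mem_of_mem_axis)
    (fun _ => compl_mem_axis) (Or.inl hH) (Or.inl (X.smul_mem_axisPos g hH)) h

theorem IsCAT0.isTranslatedSystem (hX : X.IsCAT0) (hg : 0 < X.translationDist g)
    (hnt : X.ActsNonTransversely g) (hL : X.IsAxis g L) {pos : Set V → ℤ}
    (hpos : ∀ H ∈ X.axisPos g, ∀ m, L m ∈ H ↔ pos H < m) :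
    IsTranslatedSystem (X.axisPos g) pos (X.translationDist g) g := by
  have injOn : Set.InjOn pos (X.axisPos g) := by
    intro H hH K hK h
    refine eq_of_mem_halfspaces hH.1 hK.1 (IsGeodesicLine.adj hL.1 (pos H)) ?_ ?_ ?_ ?_ <;>
    simp [hpos, hH, hK, h]
  have ranked := IsRankedSystem.of_forall_mem_iff hpos injOn
  have pos_smul : ∀ H ∈ X.axisPos g, pos (g • H) = pos H + X.translationDist g := fun H hH =>
    eq_of_forall_gt_iff fun m => by
      rw [← hpos _ (X.smul_mem_axisPos g hH), ← zpow_one g, hL.mem_zpow_smul_iff (hpos H hH),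
        one_mul, zpow_one]
  refine ⟨ranked, by exact_mod_cast hg, fun _ => X.smul_mem_axisPos g,
    fun _ => X.inv_smul_mem_axisPos g, fun H hH => ?_, pos_smul⟩
  have hgH := X.smul_mem_axisPos g hH
  have subset : g • H ⊆ H :=
    (ranked.subset_or_subset_of_not_transverse hH hgH
      (hnt.not_transverse_smul hX.simplyConnected.1 hH)).resolve_left fun h => by
        have := ranked.le_of_subset H hH _ hgH h
        have := pos_smul H hH
        omega
  refine subset.ssubset_of_ne fun h => ?_
  have := pos_smul H hH
  rw [h] at this
  omega

theorem IsCAT0.exists_isTranslatedSystem (hX : X.IsCAT0) (hg : 0 < X.translationDist g)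
    (hnt : X.ActsNonTransversely g) :
    ∃ pos, IsTranslatedSystem (X.axisPos g) pos (X.translationDist g) g := by
  by_cases exists_axis : ∃ L, X.IsAxis g L
  · obtain ⟨L, hL⟩ := exists_axis
    choose! pos hpos using fun H (hH : H ∈ X.axisPos g) => hX.exists_forall_mem_iff hg hH hL
    exact ⟨pos, hX.isTranslatedSystem hg hnt hL hpos⟩
  · have axisPos_eq : X.axisPos g = ∅ :=
      Set.eq_empty_of_forall_notMem fun H ⟨_, L, hL, _⟩ => exists_axis ⟨L, hL⟩
    rw [axisPos_eq]
    refine ⟨0, ⟨⟨?_, ?_, ?_, ?_⟩, by exact_mod_cast hg, ?_, ?_, ?_, ?_⟩⟩ <;> simp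

end CubeComplex

/-! ### Dilworth's theorem -/

section ChainColoring

variable {Q : Type*} [PartialOrder Q]

/-- A decomposition of `F` into at most `d` chains, presented by the number `col x < d` of the chain
that contains `x ∈ F`. The values of `col` outside `F` are irrelevant. -/
structure IsChainColoring (F : Set Q) (d : ℕ) (col : Q → ℕ) : Prop where
  lt : ∀ x ∈ F, col x < d
  comparable : ∀ x ∈ F, ∀ y ∈ F, col x = col y → x ≤ y ∨ y ≤ x

namespace IsChainColoring

variable {F : Set Q} {d : ℕ} {col : Q → ℕ}

theorem mono_right {e : ℕ} (h : IsChainColoring F d col) (hde : d ≤ e) :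
    IsChainColoring F e col where
  lt x hx := (h.lt x hx).trans_le hde
  comparable := h.comparable

theorem injOn (h : IsChainColoring F d col) {B : Set Q} (hBF : B ⊆ F) (hB : IsAntichain (· ≤ ·) B) :
    Set.InjOn col B := by
  intro x hx y hy hxy
  rcases h.comparable x (hBF hx) y (hBF hy) hxy with hle | hle
  exacts [hB.eq hx hy hle, (hB.eq hy hx hle).symm]

theorem exists_mem_eq (h : IsChainColoring F d col) {B : Finset Q} (hBF : ↑B ⊆ F)
    (hB : IsAntichain (· ≤ ·) (B : Set Q)) (hcard : B.card = d) {i : ℕ} (hi : i < d) :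
    ∃ z ∈ B, col z = i :=
  Finset.surj_on_of_inj_on_of_card_le (t := Finset.range d) (fun x _ => col x)
    (fun x hx => Finset.mem_range.2 (h.lt x (hBF hx)))
    (fun _ _ hx hy hxy => h.injOn hBF hB hx hy hxy) (by simp [hcard]) i (Finset.mem_range.2 hi)
    |>.imp fun _ ⟨hz, e⟩ => ⟨hz, e.symm⟩

open Classical in
theorem ite_of_sdiff {K : Set Q} (h : IsChainColoring (F \ K) d col) (hK : IsChain (· ≤ ·) K) :
    IsChainColoring F (d + 1) fun x => if x ∈ K then d else col x where
  lt x hx := by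
    split_ifs with hxK
    exacts [lt_add_one d, (h.lt x ⟨hx, hxK⟩).trans (lt_add_one d)]
  comparable x hx y hy hxy := by
    by_cases hxK : x ∈ K <;> by_cases hyK : y ∈ K <;> simp only [hxK, hyK, if_true, if_false] at hxy
    · exact hK.total hxK hyK
    · exact absurd hxy (h.lt y ⟨hy, hyK⟩).ne'
    · exact absurd hxy (h.lt x ⟨hx, hxK⟩).ne
    · exact h.comparable x ⟨hx, hxK⟩ y ⟨hy, hyK⟩ hxy

/-- In every chain, take the largest element that belongs to an antichain of `d` elements. -/
theorem exists_dominating_antichain {F : Finset Q} (h : IsChainColoring (F : Set Q) d col)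
    {B₀ : Finset Q} (hB₀F : B₀ ⊆ F) (hB₀ : IsAntichain (· ≤ ·) (B₀ : Set Q)) (hcard : B₀.card = d) :
    ∃ A ⊆ F, IsAntichain (· ≤ ·) (A : Set Q) ∧ A.card = d ∧
      ∀ a ∈ A, ∀ B ⊆ F, IsAntichain (· ≤ ·) (B : Set Q) → B.card = d →
        ∃ z ∈ B, col z = col a ∧ z ≤ a := by
  classical
  cases isEmpty_or_nonempty Q
  · exact ⟨B₀, hB₀F, hB₀, hcard, fun a => isEmptyElim a⟩
  let S (i : ℕ) : Finset Q := {x ∈ F | col x = i ∧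
    ∃ B ⊆ F, IsAntichain (· ≤ ·) (B : Set Q) ∧ B.card = d ∧ x ∈ B}
  have exists_maximal (i : ℕ) (hi : i < d) : ∃ x, Maximal (· ∈ S i) x := by
    obtain ⟨z, hz, hzi⟩ := h.exists_mem_eq (Finset.coe_subset.2 hB₀F) hB₀ hcard hi
    exact (S i).exists_maximal
      ⟨z, Finset.mem_filter.2 ⟨hB₀F hz, hzi, B₀, hB₀F, hB₀, hcard, hz⟩⟩
  choose! x hx using exists_maximal
  have mem_S (i : ℕ) (hi : i < d) := Finset.mem_filter.1 (hx i hi).prop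
  have dominates (i : ℕ) (hi : i < d) (B : Finset Q) (hBF : B ⊆ F)
      (hB : IsAntichain (· ≤ ·) (B : Set Q)) (hBd : B.card = d) :
      ∃ z ∈ B, col z = i ∧ z ≤ x i := by
    obtain ⟨z, hz, hzi⟩ := h.exists_mem_eq (Finset.coe_subset.2 hBF) hB hBd hi
    have hzS : z ∈ S i := Finset.mem_filter.2 ⟨hBF hz, hzi, B, hBF, hB, hBd, hz⟩
    refine ⟨z, hz, hzi, ?_⟩
    rcases h.comparable z (hBF hz) (x i) (mem_S i hi).1 (hzi.trans (mem_S i hi).2.1.symm)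
      with hle | hle
    exacts [hle, (hx i hi).le_of_ge hzS hle]
  have eq_of_le (i : ℕ) (hi : i < d) (j : ℕ) (hj : j < d) (hij : x i ≤ x j) : i = j := by
    obtain ⟨-, hcol, B, hBF, hB, hBd, hxB⟩ := mem_S j hj
    obtain ⟨z, hz, hzi, hzx⟩ := dominates i hi B hBF hB hBd
    rw [← hzi, hB.eq hz hxB (hzx.trans hij), hcol]
  have injOn : Set.InjOn x (Finset.range d) := fun i hi j hj hij =>
    eq_of_le i (Finset.mem_range.1 hi) j (Finset.mem_range.1 hj) hij.le
  refine ⟨(Finset.range d).image x, ?_, ?_, ?_, ?_⟩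
  · simpa [Finset.image_subset_iff] using fun i hi => (mem_S i hi).1
  · simp only [Finset.coe_image, Finset.coe_range]
    rintro _ ⟨i, hi, rfl⟩ _ ⟨j, hj, rfl⟩ hne hle
    exact hne (congrArg x (eq_of_le i hi j hj hle))
  · rw [Finset.card_image_of_injOn injOn, Finset.card_range]
  · simp only [Finset.forall_mem_image, Finset.mem_range]
    intro i hi B hBF hB hBd
    rw [(mem_S i hi).2.1]
    exact dominates i hi B hBF hB hBd

end IsChainColoring

theorem exists_maximum_antichain (F : Finset Q) :
    ∃ B ⊆ F, IsAntichain (· ≤ ·) (B : Set Q) ∧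
      ∀ B' ⊆ F, IsAntichain (· ≤ ·) (B' : Set Q) → B'.card ≤ B.card := by
  classical
  obtain ⟨B, hB, hmax⟩ := Finset.exists_max_image
    (F.powerset.filter fun B : Finset Q => IsAntichain (· ≤ ·) (B : Set Q)) Finset.card
    ⟨∅, by simp⟩
  simp only [Finset.mem_filter, Finset.mem_powerset] at hB hmax
  exact ⟨B, hB.1, hB.2, fun B' hB'F hB' => hmax B' ⟨hB'F, hB'⟩⟩

/-- Galvin's proof of Dilworth's theorem. -/
theorem exists_isChainColoring (F : Finset Q) (d : ℕ)
    (hd : ∀ B ⊆ F, IsAntichain (· ≤ ·) (B : Set Q) → B.card ≤ d) :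
    ∃ col, IsChainColoring (F : Set Q) d col := by
  classical
  induction F using Finset.strongInduction generalizing d with
  | H F ih =>
  rcases F.eq_empty_or_nonempty with rfl | nonempty
  · exact ⟨0, by simp, by simp⟩
  obtain ⟨a, ha⟩ := F.exists_maximal nonempty
  obtain ⟨B, hBF, hB, hBmax⟩ := exists_maximum_antichain (F.erase a)
  obtain ⟨col, hcol⟩ := ih _ (Finset.erase_ssubset ha.prop) B.card hBmax
  obtain ⟨A, hAF, hA, hAcard, dominates⟩ := hcol.exists_dominating_antichain hBF hB rfl
  by_cases exists_le : ∃ x ∈ A, x ≤ a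
  · obtain ⟨x, hx, hxa⟩ := exists_le
    let C : Set Q := {z | z ∈ F.erase a ∧ col z = col x ∧ z ≤ x}
    have C_isChain : IsChain (· ≤ ·) C := fun y hy z hz _ =>
      hcol.comparable y hy.1 z hz.1 (hy.2.1.trans hz.2.1.symm)
    have chain : IsChain (· ≤ ·) (insert a C) :=
      C_isChain.insert fun z hz _ => Or.inr (hz.2.2.trans hxa)
    have card_lt (B' : Finset Q) (hB'F : B' ⊆ F.filter (· ∉ insert a C))
        (hB' : IsAntichain (· ≤ ·) (B' : Set Q)) : B'.card ≤ B.card - 1 := by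
      have hB'F' : B' ⊆ F.erase a := fun z hz => Finset.mem_erase.2
        ⟨fun e => (Finset.mem_filter.1 (hB'F hz)).2 (Or.inl e), (Finset.mem_filter.1 (hB'F hz)).1⟩
      refine Nat.le_sub_one_of_lt <| (hBmax B' hB'F' hB').lt_of_ne fun e => ?_
      obtain ⟨z, hz, hzx, hle⟩ := dominates x hx B' hB'F' hB' e
      exact (Finset.mem_filter.1 (hB'F hz)).2 (Or.inr ⟨hB'F' hz, hzx, hle⟩)
    obtain ⟨col', hcol'⟩ := ih _ (Finset.filter_ssubset.2 ⟨a, ha.prop, by simp⟩) _ card_lt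
    have card_pos : 0 < B.card := hAcard ▸ Finset.card_pos.2 ⟨x, hx⟩
    have card_le : B.card ≤ d := hd B (hBF.trans (Finset.erase_subset a F)) hB
    rw [Finset.coe_filter] at hcol'
    exact ⟨_, (hcol'.ite_of_sdiff (K := insert a C) chain).mono_right (by omega)⟩
  · push Not at exists_le
    have a_notMem : a ∉ A := fun h => exists_le a h le_rfl
    have antichain : IsAntichain (· ≤ ·) ((insert a A : Finset Q) : Set Q) := by
      rw [Finset.coe_insert]
      exact hA.insert (fun x hx _ => exists_le x hx) fun x hx hne hle =>
        hne (le_antisymm hle (ha.le_of_ge (Finset.mem_of_mem_erase (hAF hx)) hle))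
    have card_le := hd (insert a A)
      (Finset.insert_subset ha.prop (hAF.trans (Finset.erase_subset a F))) antichain
    rw [Finset.card_insert_of_notMem a_notMem, hAcard] at card_le
    rw [Finset.coe_erase] at hcol
    exact ⟨_, (hcol.ite_of_sdiff IsChain.singleton).mono_right card_le⟩

theorem IsChainColoring.exists_flag {F : Set Q} {d : ℕ} {col : Q → ℕ}
    (h : IsChainColoring F d col) :
    ∃ (col' : Q → ℕ) (s : Flag Q), IsChainColoring F d col' ∧ ∀ x ∈ F, col' x = 0 ↔ x ∈ s := by
  classical
  have chain : IsChain (· ≤ ·) {x | x ∈ F ∧ col x = 0} := fun x hx y hy _ =>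
    h.comparable x hx.1 y hy.1 (hx.2.trans hy.2.symm)
  obtain ⟨s, hs⟩ := chain.exists_subset_flag
  have ne_zero {x : Q} (hx : x ∈ F) (hxs : x ∉ s) : col x ≠ 0 := fun e => hxs (hs ⟨hx, e⟩)
  refine ⟨fun x => if x ∈ s then 0 else col x, s, ⟨fun x hx => ?_, fun x hx y hy hxy => ?_⟩,
    fun x hx => ?_⟩
  · have := h.lt x hx
    split_ifs <;> omega
  · by_cases hxs : x ∈ s <;> by_cases hys : y ∈ s <;> simp only [hxs, hys, if_true, if_false] at hxy
    exacts [s.le_or_le hxs hys, absurd hxy.symm (ne_zero hy hys), absurd hxy (ne_zero hx hxs),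
      h.comparable x hx y hy hxy]
  · by_cases hxs : x ∈ s <;> simp [hxs, ne_zero hx]

theorem exists_mem_flag_between {s : Flag Q} {x y z : Q} (hx : x ∈ s) (hy : y ∈ s) (hxz : x < z)
    (hzy : z < y) : ∃ w ∈ s, x < w ∧ w < y := by
  by_cases hz : z ∈ s
  · exact ⟨z, hz, hxz, hzy⟩
  obtain ⟨w, hw, not_le, not_ge⟩ : ∃ w ∈ s, ¬ w ≤ z ∧ ¬ z ≤ w := by
    by_contra! comparable
    exact hz (Flag.mem_iff_forall_le_or_ge.2 fun w hw =>
      (or_iff_not_imp_left.2 (comparable w hw)).symm)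
  refine ⟨w, hw, ?_, ?_⟩
  · exact ((s.le_or_le hx hw).resolve_right fun h => not_le (h.trans hxz.le)).lt_of_ne
      fun e => not_le (e ▸ hxz.le)
  · exact ((s.le_or_le hw hy).resolve_right fun h => not_ge (hzy.le.trans h)).lt_of_ne
      fun e => not_ge (e ▸ hzy.le)

end ChainColoring

/-! ### Equivariant chain decompositions -/

section IntegerEnumeration

theorem exists_strictMono_int_range_eq {T : Set ℤ} (not_bddAbove : ∀ m, ∃ t ∈ T, m < t)
    (not_bddBelow : ∀ m, ∃ t ∈ T, t < m) {t₀ : ℤ} (ht₀ : t₀ ∈ T) :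
    ∃ f : ℤ → ℤ, StrictMono f ∧ Set.range f = T ∧ f 0 = t₀ := by
  have : Nonempty T := ⟨⟨t₀, ht₀⟩⟩
  have : NoMaxOrder T := ⟨fun a => (not_bddAbove a).elim fun t ht => ⟨⟨t, ht.1⟩, ht.2⟩⟩
  let : LocallyFiniteOrder T := .ofFiniteIcc fun a b =>
    ((Set.finite_Icc (a : ℤ) b).preimage Subtype.val_injective.injOn).subset fun _ hx => hx
  have : NoMinOrder T := ⟨fun a => (not_bddBelow a).elim fun t ht => ⟨⟨t, ht.1⟩, ht.2⟩⟩
  let : SuccOrder T := LinearLocallyFiniteOrder.succOrder T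
  let : PredOrder T := LinearLocallyFiniteOrder.predOrder T
  let e : T ≃o ℤ := orderIsoIntOfLinearSuccPredArch
  let f : ℤ ≃o T := (OrderIso.addRight (e ⟨t₀, ht₀⟩)).trans e.symm
  refine ⟨fun n => f n, fun _ _ hmn => f.strictMono hmn, ?_, by simp [f]⟩
  rw [Set.range_comp' Subtype.val f, f.surjective.range_eq, Set.image_univ, Subtype.range_coe]

theorem int_orderIso_apply (e : ℤ ≃o ℤ) (n : ℤ) : e n = n + e 0 := by
  induction n using Int.induction_on with
  | zero => simp
  | succ k ih => rw [← Order.succ_eq_add_one (k : ℤ), e.map_succ, ih, Order.succ_eq_add_one,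
      Order.succ_eq_add_one, add_right_comm]
  | pred k ih => rw [← Order.pred_eq_sub_one (-k : ℤ), e.map_pred, ih, Order.pred_eq_sub_one,
      Order.pred_eq_sub_one, add_sub_right_comm]

variable {Q : Type*} [PartialOrder Q]

theorem exists_forall_eq_apply_add {c c' : ℤ → Q} (hc : StrictAnti c) (hc' : StrictAnti c')
    (h : Set.range c = Set.range c') : ∃ t, ∀ n, c n = c' (n + t) := by
  choose u hu using fun n => (h ▸ Set.mem_range_self n : c n ∈ Set.range c')
  have strictMono : StrictMono u := fun m n hmn => by
    rw [← hc'.lt_iff_gt, hu, hu]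
    exact hc hmn
  have surjective : Function.Surjective u := fun m => by
    obtain ⟨n, hn⟩ : c' m ∈ Set.range c := h ▸ Set.mem_range_self m
    exact ⟨n, hc'.injective ((hu n).trans hn)⟩
  have u_eq (n : ℤ) : u n = n + u 0 :=
    int_orderIso_apply (strictMono.orderIsoOfSurjective u surjective) n
  exact ⟨u 0, fun n => by rw [← u_eq, hu]⟩

theorem exists_strictAnti_range_eq {pos : Q → ℤ} (antitone : Antitone pos)
    (injective : Function.Injective pos) {T : Set Q} (hT : IsChain (· ≤ ·) T)
    (not_bddAbove : ∀ m, ∃ x ∈ T, m < pos x) (not_bddBelow : ∀ m, ∃ x ∈ T, pos x < m)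
    {a : Q} (ha : a ∈ T) : ∃ c : ℤ → Q, StrictAnti c ∧ Set.range c = T ∧ c 0 = a := by
  obtain ⟨f, hf, hfT, hf0⟩ := exists_strictMono_int_range_eq (T := pos '' T)
    (fun m => Set.exists_mem_image.2 (not_bddAbove m))
    (fun m => Set.exists_mem_image.2 (not_bddBelow m)) (Set.mem_image_of_mem pos ha)
  choose c hcT hc using fun n => (hfT ▸ Set.mem_range_self n : f n ∈ pos '' T)
  refine ⟨c, fun m n hmn => ?_, ?_, injective ((hc 0).trans hf0)⟩
  · have pos_lt : pos (c m) < pos (c n) := by rw [hc, hc]; exact hf hmn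
    have not_le : ¬ c m ≤ c n := fun hle => (antitone hle).not_gt pos_lt
    exact ((hT.total (hcT n) (hcT m)).resolve_right not_le).lt_of_not_ge not_le
  · refine (Set.range_subset_iff.2 hcT).antisymm fun x hx => ?_
    obtain ⟨n, hn⟩ : pos x ∈ Set.range f := hfT ▸ Set.mem_image_of_mem pos hx
    exact ⟨n, injective ((hc n).trans hn)⟩

end IntegerEnumeration

section RankedTranslation

variable {Q : Type*} [PartialOrder Q] {pos : Q → ℤ} {ℓ : ℤ} {g : Q ≃o Q}

/-- The automorphism `g` of a partial order, ranked by the integers through `pos`, moves every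
element strictly down, and by exactly `ℓ` ranks. Ranks increase in the descending direction. -/
structure IsRankedTranslation (pos : Q → ℤ) (ℓ : ℤ) (g : Q ≃o Q) : Prop where
  injective : Function.Injective pos
  antitone : Antitone pos
  length_pos : 0 < ℓ
  map_lt : ∀ x, g x < x
  pos_map : ∀ x, pos (g x) = pos x + ℓ

/-- An antichain whose size is maximal among the sizes of all finite antichains. -/
structure IsMaximumAntichain (A : Finset Q) : Prop where
  isAntichain : IsAntichain (· ≤ ·) (A : Set Q)
  card_le : ∀ B : Finset Q, IsAntichain (· ≤ ·) (B : Set Q) → B.card ≤ A.card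

theorem IsMaximumAntichain.exists_comparable {A : Finset Q} (hA : IsMaximumAntichain A) (x : Q) :
    ∃ a ∈ A, x ≤ a ∨ a ≤ x := by
  classical
  by_contra! incomparable
  have notMem : x ∉ A := fun hx => (incomparable x hx).1 le_rfl
  have card_le := hA.card_le (insert x A) <| by
    rw [Finset.coe_insert]
    exact hA.isAntichain.insert (fun b hb _ => (incomparable b hb).2)
      fun b hb _ => (incomparable b hb).1
  rw [Finset.card_insert_of_notMem notMem] at card_le
  omega

theorem IsMaximumAntichain.exists_comparable_apply {A : Finset Q} (hA : IsMaximumAntichain A)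
    (f : Q ≃o Q) (x : Q) : ∃ a ∈ A, x ≤ f a ∨ f a ≤ x := by
  simpa only [OrderIso.symm_apply_le, OrderIso.le_symm_apply] using hA.exists_comparable (f.symm x)

namespace IsRankedTranslation

theorem pos_zpow (h : IsRankedTranslation pos ℓ g) (n : ℤ) (x : Q) :
    pos ((g ^ n) x) = pos x + n * ℓ := by
  induction n using Int.induction_on with
  | zero => simp
  | succ k ih => rw [zpow_add_one, ← (Commute.zpow_self g k).eq.symm, RelIso.mul_apply, h.pos_map,
      ih, add_mul, one_mul, add_assoc]
  | pred k ih =>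
    have := h.pos_map ((g ^ (-k - 1 : ℤ)) x)
    rw [← RelIso.mul_apply, ← zpow_one_add, add_sub_cancel, ih] at this
    linarith

theorem tendsto_pos_zpow_atTop (h : IsRankedTranslation pos ℓ g) (x : Q) :
    Filter.Tendsto (fun n : ℤ => pos ((g ^ n) x)) Filter.atTop Filter.atTop := by
  simp only [h.pos_zpow]
  have tendsto_mul : Filter.Tendsto (fun n : ℤ => n * ℓ) Filter.atTop Filter.atTop :=
    Filter.tendsto_id.atTop_mul_const' h.length_pos
  exact Filter.tendsto_atTop_add_const_left _ (pos x) tendsto_mul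

theorem tendsto_pos_zpow_atBot (h : IsRankedTranslation pos ℓ g) (x : Q) :
    Filter.Tendsto (fun n : ℤ => pos ((g ^ n) x)) Filter.atBot Filter.atBot := by
  simp only [h.pos_zpow]
  have tendsto_mul : Filter.Tendsto (fun n : ℤ => n * ℓ) Filter.atBot Filter.atBot :=
    Filter.tendsto_id.atBot_mul_const' h.length_pos
  exact Filter.tendsto_atBot_add_const_left _ (pos x) tendsto_mul

theorem pow_apply_le (h : IsRankedTranslation pos ℓ g) (n : ℕ) (x : Q) : (g ^ n) x ≤ x := by
  induction n with
  | zero => simp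
  | succ n ih =>
    rw [pow_succ', RelIso.mul_apply]
    exact (h.map_lt _).le.trans ih

theorem le_of_pos_eq_add_mul (h : IsRankedTranslation pos ℓ g) {x y : Q} {k : ℤ} (hk : 0 ≤ k)
    (hxy : pos y = pos x + k * ℓ) : y ≤ x := by
  lift k to ℕ using hk
  rw [← h.pos_zpow] at hxy
  rw [h.injective hxy, zpow_natCast]
  exact h.pow_apply_le k x

theorem card_le_of_isAntichain (h : IsRankedTranslation pos ℓ g) {B : Finset Q}
    (hB : IsAntichain (· ≤ ·) (B : Set Q)) : B.card ≤ ℓ.toNat := by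
  have mapsTo : Set.MapsTo (pos · % ℓ) B (Finset.Ico 0 ℓ) := fun x _ => Finset.mem_coe.2 <|
    Finset.mem_Ico.2 ⟨Int.emod_nonneg _ h.length_pos.ne', Int.emod_lt_of_pos _ h.length_pos⟩
  have injOn : Set.InjOn (pos · % ℓ) B := by
    intro x hx y hy hxy
    obtain ⟨k, hk⟩ := Int.ModEq.dvd (show pos x ≡ pos y [ZMOD ℓ] from hxy)
    rcases le_total 0 k with hk0 | hk0
    · exact (hB.eq hy hx (h.le_of_pos_eq_add_mul hk0 (by linarith))).symm
    · exact hB.eq hx hy (h.le_of_pos_eq_add_mul (neg_nonneg.2 hk0) (by linarith))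
  simpa using Finset.card_le_card_of_injOn _ mapsTo injOn

theorem exists_isMaximumAntichain (h : IsRankedTranslation pos ℓ g) :
    ∃ A : Finset Q, IsMaximumAntichain A := by
  let cards : Set ℕ := {k | ∃ A : Finset Q, IsAntichain (· ≤ ·) (A : Set Q) ∧ A.card = k}
  have bddAbove : BddAbove cards := ⟨ℓ.toNat, by
    rintro _ ⟨A, hA, rfl⟩
    exact h.card_le_of_isAntichain hA⟩
  obtain ⟨A, hA, hcard⟩ := Nat.sSup_mem (s := cards) ⟨0, ∅, by simp, rfl⟩ bddAbove
  exact ⟨A, hA, fun B hB => hcard ▸ le_csSup bddAbove ⟨B, hB, rfl⟩⟩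

end IsRankedTranslation

/-- The elements between an antichain `A` and its image `g A`. -/
def antichainSpan (g : Q ≃o Q) (A : Finset Q) : Set Q :=
  {x | (∃ a ∈ A, x ≤ a) ∧ ∃ a ∈ A, g a ≤ x}

/-- The elements below an antichain `A` and not below its image `g A`: a fundamental domain for
the powers of `g` if the antichain is maximum. -/
def antichainDomain (g : Q ≃o Q) (A : Finset Q) : Set Q :=
  {x | (∃ a ∈ A, x ≤ a) ∧ ∀ a ∈ A, ¬ x ≤ g a}

theorem antichainDomain_subset_antichainSpan {A : Finset Q} (hA : IsMaximumAntichain A) :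
    antichainDomain g A ⊆ antichainSpan g A := by
  rintro x ⟨hx, not_le⟩
  obtain ⟨a, ha, hxa⟩ := hA.exists_comparable_apply g x
  exact ⟨hx, a, ha, hxa.resolve_left (not_le a ha)⟩

namespace IsRankedTranslation

variable {A : Finset Q}

theorem mem_antichainSpan (h : IsRankedTranslation pos ℓ g) {a : Q} (ha : a ∈ A) :
    a ∈ antichainSpan g A :=
  ⟨⟨a, ha, le_rfl⟩, a, ha, (h.map_lt a).le⟩

theorem map_mem_antichainSpan (h : IsRankedTranslation pos ℓ g) {a : Q} (ha : a ∈ A) :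
    g a ∈ antichainSpan g A :=
  ⟨⟨a, ha, (h.map_lt a).le⟩, a, ha, le_rfl⟩

theorem finite_antichainSpan (h : IsRankedTranslation pos ℓ g) :
    (antichainSpan g A).Finite := by
  refine (A.finite_toSet.biUnion fun a _ => A.finite_toSet.biUnion fun b _ =>
    (Set.finite_Icc (pos a) (pos (g b))).preimage h.injective.injOn).subset ?_
  rintro x ⟨⟨a, ha, hxa⟩, b, hb, hbx⟩
  simp only [Set.mem_iUnion]
  exact ⟨a, ha, b, hb, h.antitone hxa, h.antitone hbx⟩

theorem exists_mem_antichainDomain (h : IsRankedTranslation pos ℓ g) (hA : IsMaximumAntichain A)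
    (x : Q) : ∃ n : ℤ, ∃ y ∈ antichainDomain g A, (g ^ n) y = x := by
  let below (n : ℤ) : Prop := ∃ a ∈ A, x ≤ (g ^ n) a
  obtain ⟨i, hi, hi0⟩ := (((Finset.eventually_all A).2 fun a _ =>
    (h.tendsto_pos_zpow_atBot a).eventually_lt_atBot (pos x)).and
      (Filter.eventually_le_atBot 0)).exists
  obtain ⟨j, hj, hj0⟩ := (((Finset.eventually_all A).2 fun a _ =>
    (h.tendsto_pos_zpow_atTop a).eventually_gt_atTop (pos x)).and
      (Filter.eventually_ge_atTop 0)).exists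
  have below_i : below i := by
    obtain ⟨a, ha, hxa⟩ := hA.exists_comparable_apply (g ^ i) x
    exact ⟨a, ha, hxa.resolve_right fun hle => (h.antitone hle).not_gt (hi a ha)⟩
  have not_below_j : ¬ below j := fun ⟨a, ha, hle⟩ => (h.antitone hle).not_gt (hj a ha)
  obtain ⟨n, hn, hn'⟩ := exists_not_and_succ (p := fun n => ¬ below n) (hi0.trans hj0)
    (not_not.2 below_i) not_below_j
  refine ⟨n, (g ^ n).symm x, ⟨?_, fun a ha hle => hn' ⟨a, ha, ?_⟩⟩, (g ^ n).apply_symm_apply x⟩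
  · simpa only [OrderIso.symm_apply_le] using not_not.1 hn
  · rwa [OrderIso.symm_apply_le, ← RelIso.mul_apply, ← zpow_add_one] at hle

theorem zpow_apply_notMem_antichainDomain (h : IsRankedTranslation pos ℓ g) {y : Q}
    (hy : y ∈ antichainDomain g A) {n : ℤ} (hn : 0 < n) : (g ^ n) y ∉ antichainDomain g A := by
  obtain ⟨a, ha, hya⟩ := hy.1
  obtain ⟨k, rfl⟩ : ∃ k : ℕ, n = k + 1 := ⟨(n - 1).toNat, by omega⟩
  refine fun hmem => hmem.2 a ha ?_
  rw [add_comm, zpow_one_add, RelIso.mul_apply, OrderIso.le_iff_le, zpow_natCast]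
  exact (h.pow_apply_le k y).trans hya

theorem eq_of_zpow_apply_eq (h : IsRankedTranslation pos ℓ g) {x y : Q}
    (hx : x ∈ antichainDomain g A) (hy : y ∈ antichainDomain g A) {m n : ℤ}
    (hxy : (g ^ m) x = (g ^ n) y) : m = n ∧ x = y := by
  have eq_zpow_apply {x y : Q} {m n : ℤ} (hxy : (g ^ m) x = (g ^ n) y) : x = (g ^ (n - m)) y := by
    apply (g ^ m).injective
    rw [hxy, ← RelIso.mul_apply, ← zpow_add, add_sub_cancel]
  rcases lt_trichotomy m n with hmn | rfl | hmn
  · exact absurd (eq_zpow_apply hxy ▸ hx)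
      (h.zpow_apply_notMem_antichainDomain hy (sub_pos.2 hmn))
  · exact ⟨rfl, (g ^ m).injective hxy⟩
  · exact absurd (eq_zpow_apply hxy.symm ▸ hy)
      (h.zpow_apply_notMem_antichainDomain hx (sub_pos.2 hmn))

end IsRankedTranslation

end RankedTranslation

section EquivariantColoring

variable {Q κ : Type*} [PartialOrder Q] {pos : Q → ℤ} {ℓ : ℤ} {g : Q ≃o Q} {A : Finset Q}
  {col : Q → κ} {α : κ → Q} {τ : Equiv.Perm κ}

/-- A decomposition of the span of `A` and `g A` into chains, where the chain of color `i` starts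
at the element `α i` of `A` and ends at the element of `g A` that `g` assigns to the chain of color
`τ⁻¹ i`. -/
structure IsSpanColoring (g : Q ≃o Q) (A : Finset Q) (col : Q → κ) (α : κ → Q)
    (τ : Equiv.Perm κ) : Prop where
  comparable : ∀ x ∈ antichainSpan g A, ∀ y ∈ antichainSpan g A, col x = col y → x ≤ y ∨ y ≤ x
  mem : ∀ i, α i ∈ A
  col_apply : ∀ i, col (α i) = i
  col_map : ∀ i, col (g (α i)) = τ i

open Classical in
theorem IsRankedTranslation.exists_isSpanColoring (h : IsRankedTranslation pos ℓ g)
    (hA : IsMaximumAntichain A) {d : ℕ} (hd : A.card = d) :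
    ∃ (col : Q → Fin d) (α : Fin d → Q) (τ : Equiv.Perm (Fin d)) (s : Flag Q),
      IsSpanColoring g A col α τ ∧
      ∀ hd : 0 < d, ∀ x ∈ antichainSpan g A, col x = ⟨0, hd⟩ ↔ x ∈ s := by
  obtain ⟨col₀, hcol₀⟩ := exists_isChainColoring (h.finite_antichainSpan (A := A)).toFinset d
    fun B _ hB => hd ▸ hA.card_le B hB
  rw [Set.Finite.coe_toFinset] at hcol₀
  obtain ⟨col, s, hcol, hs⟩ := hcol₀.exists_flag
  have A_subset : (A : Set Q) ⊆ antichainSpan g A := fun a ha => h.mem_antichainSpan ha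
  have d_pos (x : Q) : 0 < d := by
    obtain ⟨a, ha, -⟩ := hA.exists_comparable x
    exact hd ▸ Finset.card_pos.2 ⟨a, ha⟩
  let fcol (x : Q) : Fin d := ⟨col x % d, Nat.mod_lt _ (d_pos x)⟩
  have val_fcol {x : Q} (hx : x ∈ antichainSpan g A) : (fcol x : ℕ) = col x :=
    Nat.mod_eq_of_lt (hcol.lt x hx)
  have comparable : ∀ x ∈ antichainSpan g A, ∀ y ∈ antichainSpan g A, fcol x = fcol y →
      x ≤ y ∨ y ≤ x := fun x hx y hy hxy =>
    hcol.comparable x hx y hy (by rw [← val_fcol hx, hxy, val_fcol hy])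
  choose α hαA hα using fun i : Fin d => hcol.exists_mem_eq A_subset hA.isAntichain hd i.2
  have fcol_α (i : Fin d) : fcol (α i) = i := Fin.ext ((val_fcol (A_subset (hαA i))).trans (hα i))
  have injective : Function.Injective fun i => fcol (g (α i)) := by
    intro i j hij
    rw [← fcol_α i, ← fcol_α j]
    rcases comparable _ (h.map_mem_antichainSpan (hαA i)) _ (h.map_mem_antichainSpan (hαA j)) hij
      with hle | hle <;> rw [OrderIso.le_iff_le] at hle
    exacts [congrArg fcol (hA.isAntichain.eq (hαA i) (hαA j) hle),
      congrArg fcol (hA.isAntichain.eq (hαA j) (hαA i) hle).symm]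
  refine ⟨fcol, α, Equiv.ofBijective _ (Finite.injective_iff_bijective.1 injective), s,
    ⟨comparable, hαA, fcol_α, fun _ => rfl⟩, fun _ x hx => ?_⟩
  rw [← hs x hx, Fin.ext_iff, val_fcol hx]

theorem IsRankedTranslation.exists_color (h : IsRankedTranslation pos ℓ g)
    (hA : IsMaximumAntichain A) (col : Q → κ) (τ : Equiv.Perm κ) :
    ∃ color : Q → κ, ∀ y ∈ antichainDomain g A, ∀ n : ℤ, color ((g ^ n) y) = (τ ^ n) (col y) := by
  choose level base hbase heq using h.exists_mem_antichainDomain hA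
  refine ⟨fun x => (τ ^ level x) (col (base x)), fun y hy n => ?_⟩
  obtain ⟨hlevel, hbase⟩ := h.eq_of_zpow_apply_eq (hbase ((g ^ n) y)) hy (heq _)
  simp only [hlevel, hbase]

namespace IsSpanColoring

theorem apply_col (hcol : IsSpanColoring g A col α τ) (h : IsRankedTranslation pos ℓ g)
    (hA : IsMaximumAntichain A) {a : Q} (ha : a ∈ A) : α (col a) = a := by
  rcases hcol.comparable _ (h.mem_antichainSpan (hcol.mem (col a))) a (h.mem_antichainSpan ha)
    (hcol.col_apply _) with hle | hle
  exacts [hA.isAntichain.eq (hcol.mem _) ha hle, (hA.isAntichain.eq ha (hcol.mem _) hle).symm]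

theorem le_apply_col (hcol : IsSpanColoring g A col α τ) (h : IsRankedTranslation pos ℓ g)
    (hA : IsMaximumAntichain A) {x : Q} (hx : x ∈ antichainSpan g A) : x ≤ α (col x) := by
  refine (hcol.comparable x hx _ (h.mem_antichainSpan (hcol.mem (col x)))
    (hcol.col_apply _).symm).elim id fun hle => ?_
  obtain ⟨a, ha, hxa⟩ := hx.1
  exact hxa.trans (hA.isAntichain.eq (hcol.mem _) ha (hle.trans hxa)).ge

theorem pow_apply_le (hcol : IsSpanColoring g A col α τ) (h : IsRankedTranslation pos ℓ g)
    (hA : IsMaximumAntichain A) (n : ℕ) (i : κ) : (g ^ n) (α i) ≤ α ((τ ^ n) i) := by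
  induction n with
  | zero => simp
  | succ n ih =>
    rw [pow_succ', pow_succ', RelIso.mul_apply, Equiv.Perm.mul_apply, ← hcol.col_map]
    exact ((OrderIso.le_iff_le g).2 ih).trans
      (hcol.le_apply_col h hA (h.map_mem_antichainSpan (hcol.mem _)))

theorem comparable_pow_apply (hcol : IsSpanColoring g A col α τ) (h : IsRankedTranslation pos ℓ g)
    (hA : IsMaximumAntichain A) {x y : Q} (hx : x ∈ antichainDomain g A)
    (hy : y ∈ antichainDomain g A) (n : ℕ) (hxy : (τ ^ n) (col x) = col y) :
    (g ^ n) x ≤ y ∨ y ≤ (g ^ n) x := by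
  have hxS := antichainDomain_subset_antichainSpan hA hx
  have hyS := antichainDomain_subset_antichainSpan hA hy
  cases n with
  | zero => exact hcol.comparable x hxS y hyS hxy
  | succ n =>
    rw [pow_succ', Equiv.Perm.mul_apply, ← hcol.col_map] at hxy
    have map_le : g (α ((τ ^ n) (col x))) ≤ y :=
      (hcol.comparable _ (h.map_mem_antichainSpan (hcol.mem _)) y hyS hxy).resolve_right
        (hy.2 _ (hcol.mem _))
    refine Or.inl (le_trans ?_ map_le)
    rw [pow_succ', RelIso.mul_apply, OrderIso.le_iff_le]
    exact ((OrderIso.le_iff_le _).2 (hcol.le_apply_col h hA hxS)).trans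
      (hcol.pow_apply_le h hA n _)

theorem exists_equivariant_extension (hcol : IsSpanColoring g A col α τ)
    (h : IsRankedTranslation pos ℓ g) (hA : IsMaximumAntichain A) :
    ∃ color : Q → κ, (∀ i, IsChain (· ≤ ·) (color ⁻¹' {i})) ∧
      (∀ (n : ℤ) x, color ((g ^ n) x) = (τ ^ n) (color x)) ∧
      ∀ x ∈ antichainSpan g A, color x = col x := by
  obtain ⟨color, hcolor⟩ := h.exists_color hA col τ
  have color_eq {x : Q} (hx : x ∈ antichainDomain g A) : color x = col x := hcolor x hx 0
  have color_zpow (n : ℤ) (x : Q) : color ((g ^ n) x) = (τ ^ n) (color x) := by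
    obtain ⟨m, y, hy, rfl⟩ := h.exists_mem_antichainDomain hA x
    rw [← RelIso.mul_apply, ← zpow_add, hcolor y hy, hcolor y hy, zpow_add, Equiv.Perm.mul_apply]
  have color_map (x : Q) : color (g x) = τ (color x) := by simpa using color_zpow 1 x
  have mem_domain {a : Q} (ha : a ∈ A) : a ∈ antichainDomain g A := by
    refine ⟨⟨a, ha, le_rfl⟩, fun b hb hab => ?_⟩
    obtain rfl := hA.isAntichain.eq ha hb (hab.trans (h.map_lt b).le)
    exact (h.map_lt a).not_ge hab
  refine ⟨color, fun i => ?_, color_zpow, fun x hx => ?_⟩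
  · have comparable {x y : Q} (hx : x ∈ antichainDomain g A) (hy : y ∈ antichainDomain g A)
        {m n : ℤ} (hmn : m ≤ n) (hxy : color ((g ^ m) y) = color ((g ^ n) x)) :
        (g ^ n) x ≤ (g ^ m) y ∨ (g ^ m) y ≤ (g ^ n) x := by
      obtain ⟨k, rfl⟩ := Int.le.dest hmn
      rw [hcolor y hy, hcolor x hx, zpow_add, Equiv.Perm.mul_apply, (τ ^ m).apply_eq_iff_eq,
        zpow_natCast] at hxy
      rw [zpow_add, RelIso.mul_apply, OrderIso.le_iff_le, OrderIso.le_iff_le, zpow_natCast]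
      exact hcol.comparable_pow_apply h hA hx hy k hxy.symm
    intro x hx y hy _
    obtain ⟨m, x, hx', rfl⟩ := h.exists_mem_antichainDomain hA x
    obtain ⟨n, y, hy', rfl⟩ := h.exists_mem_antichainDomain hA y
    rcases le_total m n with hmn | hmn
    · exact (comparable hy' hx' hmn (hx.trans hy.symm)).symm
    · exact comparable hx' hy' hmn (hy.trans hx.symm)
  · by_cases hx' : x ∈ antichainDomain g A
    · exact color_eq hx'
    obtain ⟨hxA, b, hb, hbx⟩ := hx
    obtain ⟨a, ha, hxa⟩ : ∃ a ∈ A, x ≤ g a := by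
      by_contra! not_le
      exact hx' ⟨hxA, not_le⟩
    obtain rfl := hA.isAntichain.eq hb ha ((OrderIso.le_iff_le g).1 (hbx.trans hxa))
    obtain rfl := le_antisymm hxa hbx
    rw [color_map, color_eq (mem_domain hb), ← hcol.col_map, hcol.apply_col h hA hb]

end IsSpanColoring

end EquivariantColoring

section EquivariantChains

variable {Q : Type*} [PartialOrder Q] {pos : Q → ℤ} {ℓ : ℤ} {g : Q ≃o Q} {A : Finset Q} {d : ℕ}

/-- A partition of `Q` into `d` descending bi-infinite chains that `g` permutes and shifts. The
chains start at the elements of `A`, and the chain of number `0` has no gaps between `A` and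
`g A`. -/
structure IsEquivariantChainPartition (g : Q ≃o Q) (A : Finset Q) (c : Fin d → ℤ → Q)
    (σ : Equiv.Perm (Fin d)) (t : Fin d → ℤ) : Prop where
  strictAnti : ∀ i, StrictAnti (c i)
  injective : ∀ i j n m, c i n = c j m → i = j ∧ n = m
  exists_eq : ∀ x, ∃ i n, c i n = x
  mem_iff : ∀ x, x ∈ A ↔ ∃ i, c i 0 = x
  map : ∀ i n, g (c i n) = c (σ i) (n + t i)
  covBy : ∀ (hd : 0 < d) (n : ℤ), c ⟨0, hd⟩ n ∈ antichainSpan g A →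
    c ⟨0, hd⟩ (n + 1) ∈ antichainSpan g A → c ⟨0, hd⟩ (n + 1) ⋖ c ⟨0, hd⟩ n

theorem IsRankedTranslation.exists_equivariant_enumeration {κ : Type*} [Finite κ] {color : Q → κ}
    {α : κ → Q} {τ : Equiv.Perm κ} (h : IsRankedTranslation pos ℓ g)
    (hchain : ∀ i, IsChain (· ≤ ·) (color ⁻¹' {i}))
    (hcolor : ∀ (n : ℤ) x, color ((g ^ n) x) = (τ ^ n) (color x)) (hα : ∀ i, color (α i) = i) :
    ∃ (c : κ → ℤ → Q) (t : κ → ℤ), (∀ i, StrictAnti (c i)) ∧ (∀ i, c i 0 = α i) ∧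
      (∀ i, Set.range (c i) = color ⁻¹' {i}) ∧ ∀ i n, g (c i n) = c (τ i) (n + t i) := by
  have mem_class (i : κ) (n : ℤ) : (g ^ n) (α ((τ ^ n).symm i)) ∈ color ⁻¹' {i} := by
    rw [Set.mem_preimage, hcolor, hα, Equiv.apply_symm_apply, Set.mem_singleton_iff]
  have not_bddAbove (i : κ) (m : ℤ) : ∃ x ∈ color ⁻¹' {i}, m < pos x := by
    obtain ⟨n, hn⟩ := (Filter.eventually_all.2 fun j =>
      (h.tendsto_pos_zpow_atTop (α j)).eventually_gt_atTop m).exists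
    exact ⟨_, mem_class i n, hn _⟩
  have not_bddBelow (i : κ) (m : ℤ) : ∃ x ∈ color ⁻¹' {i}, pos x < m := by
    obtain ⟨n, hn⟩ := (Filter.eventually_all.2 fun j =>
      (h.tendsto_pos_zpow_atBot (α j)).eventually_lt_atBot m).exists
    exact ⟨_, mem_class i n, hn _⟩
  choose c strictAnti range_eq zero using fun i => exists_strictAnti_range_eq h.antitone h.injective
    (hchain i) (not_bddAbove i) (not_bddBelow i) (hα i)
  have image_class (i : κ) : g '' (color ⁻¹' {i}) = color ⁻¹' {τ i} := by
    ext x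
    obtain ⟨y, rfl⟩ := g.surjective x
    have color_map : color (g y) = τ (color y) := by simpa using hcolor 1 y
    rw [g.injective.mem_set_image, Set.mem_preimage, Set.mem_preimage, Set.mem_singleton_iff,
      Set.mem_singleton_iff, color_map, τ.apply_eq_iff_eq]
  choose t ht using fun i => exists_forall_eq_apply_add
    (g.strictMono.comp_strictAnti (strictAnti i)) (strictAnti (τ i))
    (by rw [Set.range_comp, range_eq, range_eq, image_class])
  exact ⟨c, t, strictAnti, zero, range_eq, ht⟩

theorem IsRankedTranslation.exists_isEquivariantChainPartition (h : IsRankedTranslation pos ℓ g)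
    (hA : IsMaximumAntichain A) (hd : A.card = d) :
    ∃ (c : Fin d → ℤ → Q) (σ : Equiv.Perm (Fin d)) (t : Fin d → ℤ),
      IsEquivariantChainPartition g A c σ t := by
  obtain ⟨col, α, τ, s, hcol, hs⟩ := h.exists_isSpanColoring hA hd
  obtain ⟨color, hchain, hcolor, color_eq⟩ := hcol.exists_equivariant_extension h hA
  have color_α (i : Fin d) : color (α i) = i :=
    (color_eq _ (h.mem_antichainSpan (hcol.mem i))).trans (hcol.col_apply i)
  obtain ⟨c, t, strictAnti, zero, range_eq, map⟩ :=
    h.exists_equivariant_enumeration hchain hcolor color_α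
  have color_c (i : Fin d) (n : ℤ) : color (c i n) = i :=
    (range_eq i).le (Set.mem_range_self n)
  refine ⟨c, τ, t, strictAnti, fun i j n m e => ?_, fun x => ?_, fun x => ⟨fun hx => ?_, ?_⟩, map,
    fun hd n hn hn' => ⟨strictAnti _ (lt_add_one n), fun z hz hz' => ?_⟩⟩
  · obtain rfl : i = j := by rw [← color_c i n, e, color_c]
    exact ⟨rfl, (strictAnti i).injective e⟩
  · exact ⟨color x, (range_eq (color x)).ge rfl⟩
  · exact ⟨col x, (zero _).trans (hcol.apply_col h hA hx)⟩
  · rintro ⟨i, rfl⟩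
    rw [zero]
    exact hcol.mem i
  · have mem_flag {m : ℤ} (hm : c ⟨0, hd⟩ m ∈ antichainSpan g A) : c ⟨0, hd⟩ m ∈ s := by
      rw [← hs hd _ hm, ← color_eq _ hm, color_c]
    obtain ⟨w, hws, hlt, hlt'⟩ := exists_mem_flag_between (mem_flag hn') (mem_flag hn) hz hz'
    have hw : w ∈ antichainSpan g A := ⟨hn.1.imp fun a ha => ⟨ha.1, hlt'.le.trans ha.2⟩,
      hn'.2.imp fun a ha => ⟨ha.1, ha.2.trans hlt.le⟩⟩
    obtain ⟨k, rfl⟩ := (range_eq ⟨0, hd⟩).ge ((color_eq w hw).trans ((hs hd w hw).2 hws))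
    rw [(strictAnti _).lt_iff_gt] at hlt hlt'
    omega

end EquivariantChains

/-! ### The standard cubing -/

theorem range_mem_cubes_cubeCompletion {V : Type*} {G : SimpleGraph V} {m : ℕ}
    (f : hypercube m ↪g G) : Set.range f ∈ G.cubeCompletion.cubes :=
  ⟨m, ⟨f.isoInduceRange⟩⟩

theorem exists_range_eq_image {V W : Type*} {G : SimpleGraph V} {H : SimpleGraph W} (f : G ↪g H)
    {C : Set V} {n : ℕ} (e : hypercube n ≃g G.induce C) :
    ∃ f' : hypercube n ↪g H, Set.range f' = f '' C := by
  refine ⟨f.comp ((SimpleGraph.Embedding.induce C).comp e.toEmbedding), ?_⟩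
  change Set.range (f ∘ Subtype.val ∘ e) = f '' C
  rw [Set.range_comp, e.surjective.range_comp, Subtype.range_coe]

theorem image_mem_cubes_cubeCompletion {V W : Type*} {G : SimpleGraph V} {H : SimpleGraph W}
    (f : G ↪g H) {C : Set V} (hC : C ∈ G.cubeCompletion.cubes) :
    f '' C ∈ H.cubeCompletion.cubes := by
  obtain ⟨n, ⟨e⟩⟩ := hC
  obtain ⟨f', hf'⟩ := exists_range_eq_image f e
  exact hf' ▸ range_mem_cubes_cubeCompletion f'

section UnitVectors

variable {ι : Type*} [DecidableEq ι]

theorem units_eq_or_single_eq_neg (i : ι) (α β : ℤˣ) :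
    β = α ∨ (Pi.single i (β : ℤ) : ι → ℤ) = -Pi.single i (α : ℤ) := by
  refine or_iff_not_imp_left.2 fun hne => ?_
  rw [Int.units_ne_iff_eq_neg.1 hne, Units.val_neg, Pi.single_neg]

theorem add_single_neg_one_add_single_one (x : ι → ℤ) (i : ι) :
    x + Pi.single i (-1) + Pi.single i 1 = x := by
  rw [add_assoc, ← Pi.single_add, neg_add_cancel, Pi.single_zero, add_zero]

theorem single_eq_or_of_add_eq_add {i j k l : ι} {α β γ δ : ℤˣ}
    (h : (Pi.single i (α : ℤ) + Pi.single j (β : ℤ) : ι → ℤ) =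
      Pi.single k (γ : ℤ) + Pi.single l (δ : ℤ))
    (hne : (Pi.single i (α : ℤ) + Pi.single j (β : ℤ) : ι → ℤ) ≠ 0) :
    (Pi.single i (α : ℤ) : ι → ℤ) = Pi.single k (γ : ℤ) ∨
      (Pi.single i (α : ℤ) : ι → ℤ) = Pi.single l (δ : ℤ) := by
  by_contra! hcon
  have eq_neg_of_eq {x : ι} {ε : ℤˣ} (hx : i = x)
      (hε : (Pi.single i (α : ℤ) : ι → ℤ) ≠ Pi.single x (ε : ℤ)) : (ε : ℤ) = -α := by
    subst hx
    rw [Int.units_ne_iff_eq_neg.1 fun hα : α = ε => hε (by rw [hα]), Units.val_neg, neg_neg]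
  have eq_of_eq (hj : i = j) : (β : ℤ) = α := by
    subst hj
    refine congrArg Units.val ((units_eq_or_single_eq_neg i α β).resolve_right fun hβ => ?_)
    exact hne (by rw [hβ, add_neg_cancel])
  have hk := fun hk => eq_neg_of_eq hk hcon.1
  have hl := fun hl => eq_neg_of_eq hl hcon.2
  have coord_i := congrFun h i
  simp only [Pi.add_apply, Pi.single_apply] at coord_i
  have α_ne_zero : (α : ℤ) ≠ 0 := α.ne_zero
  grind

end UnitVectors

section StdCubing

variable {d m : ℕ}

theorem stdCubing_adj_iff {x y : Fin d → ℤ} : (stdCubing d).graph.Adj x y ↔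
    ∃ (i : Fin d) (ε : ℤˣ), y = x + Pi.single i (ε : ℤ) := by
  constructor
  · rintro ⟨i, hi, hne⟩
    have eq_add_single (ε : ℤˣ) (hε : y i = x i + ε) : y = x + Pi.single i (ε : ℤ) := by
      funext j
      rcases eq_or_ne j i with rfl | hj
      · simpa using hε
      · simp [hj, hne j hj]
    rcases hi with hi | hi
    · exact ⟨i, 1, eq_add_single 1 hi⟩
    · exact ⟨i, -1, eq_add_single (-1) (by simp [hi])⟩
  · rintro ⟨i, ε, rfl⟩
    refine ⟨i, ?_, fun j hj => by simp [hj]⟩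
    rcases Int.units_eq_one_or ε with rfl | rfl <;> simp

theorem stdCubing_adj_add_single (x : Fin d → ℤ) (i : Fin d) (ε : ℤˣ) :
    (stdCubing d).graph.Adj x (x + Pi.single i (ε : ℤ)) :=
  stdCubing_adj_iff.2 ⟨i, ε, rfl⟩

theorem exists_parallel_of_cycle {a b c e : Fin d → ℤ} {i : Fin d} {α : ℤˣ}
    (hb : b = a + Pi.single i (α : ℤ)) (hbc : (stdCubing d).graph.Adj b c)
    (hec : (stdCubing d).graph.Adj e c) (hae : (stdCubing d).graph.Adj a e)
    (hac : a ≠ c) (hbe : b ≠ e) :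
    ∃ j ≠ i, ∃ δ : ℤˣ, e = a + Pi.single j (δ : ℤ) ∧ c = b + Pi.single j (δ : ℤ) := by
  subst hb
  obtain ⟨k, β, rfl⟩ := stdCubing_adj_iff.1 hbc
  obtain ⟨j, δ, rfl⟩ := stdCubing_adj_iff.1 hae
  obtain ⟨l, γ, hc⟩ := stdCubing_adj_iff.1 hec
  rw [add_assoc, add_assoc, add_right_inj] at hc
  have sum_ne_zero : (Pi.single i (α : ℤ) + Pi.single k (β : ℤ) : Fin d → ℤ) ≠ 0 := by
    intro h
    rw [add_assoc, h, add_zero] at hac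
    exact hac rfl
  have ne : (Pi.single i (α : ℤ) : Fin d → ℤ) ≠ Pi.single j (δ : ℤ) := fun h => hbe (by rw [h])
  have eq := (single_eq_or_of_add_eq_add hc sum_ne_zero).resolve_left ne
  have opposite : (Pi.single k (β : ℤ) : Fin d → ℤ) = Pi.single j (δ : ℤ) := by
    rw [eq, add_comm] at hc
    exact add_right_cancel hc
  refine ⟨j, ?_, δ, rfl, by rw [opposite]⟩
  rintro rfl
  rcases units_eq_or_single_eq_neg j α δ with rfl | h
  · exact ne rfl
  · exact sum_ne_zero (by rw [opposite, h, add_neg_cancel])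

/-- The sum of the signed unit vectors `ε k • e (ι k)` with `y k = true`. -/
def cubeVector (ι : Fin m ↪ Fin d) (ε : Fin m → ℤˣ) (y : Fin m → Bool) : Fin d → ℤ :=
  ∑ k, if y k then Pi.single (ι k) (ε k : ℤ) else 0

theorem cubeVector_apply (ι : Fin m ↪ Fin d) (ε : Fin m → ℤˣ) (y : Fin m → Bool) (k : Fin m) :
    cubeVector ι ε y (ι k) = if y k then (ε k : ℤ) else 0 := by
  rw [cubeVector, Finset.sum_apply, Finset.sum_eq_single k (fun l _ hl => ?_) (by simp)]
  · split_ifs <;> simp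
  · split_ifs <;> simp [ι.injective.ne hl.symm]

theorem cubeVector_apply_eq_iff {ι : Fin m ↪ Fin d} {ε : Fin m → ℤˣ} {y y' : Fin m → Bool}
    {k : Fin m} : cubeVector ι ε y (ι k) = cubeVector ι ε y' (ι k) ↔ y k = y' k := by
  have hε : (0 : ℤ) ≠ ε k := (ε k).ne_zero.symm
  rw [cubeVector_apply, cubeVector_apply]
  cases y k <;> cases y' k <;> simp [hε]

theorem cubeVector_injective (ι : Fin m ↪ Fin d) (ε : Fin m → ℤˣ) :
    Function.Injective (cubeVector ι ε) := fun _ _ h =>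
  funext fun k => cubeVector_apply_eq_iff.1 (congrFun h (ι k))

theorem cubeVector_flipCoord (ι : Fin m ↪ Fin d) (ε : Fin m → ℤˣ) (y : Fin m → Bool) (k : Fin m) :
    cubeVector ι ε (flipCoord y k) =
      cubeVector ι ε y + Pi.single (ι k) ((if y k then -ε k else ε k : ℤˣ) : ℤ) := by
  rw [cubeVector, cubeVector, ← Finset.add_sum_erase _ _ (Finset.mem_univ k),
    ← Finset.add_sum_erase _ (fun l => if y l then (Pi.single (ι l) (ε l : ℤ) : Fin d → ℤ) else 0)
      (Finset.mem_univ k),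
    Finset.sum_congr rfl fun l hl => by rw [flipCoord_of_ne (Finset.ne_of_mem_erase hl)]]
  cases hy : y k <;> simp [flipCoord_self, hy, Pi.single_neg, add_comm, sub_eq_add_neg]

/-- The cube of the standard cubing spanned at the vertex `v` by the signed unit vectors
`ε k • e (ι k)`. -/
def stdFace (v : Fin d → ℤ) (ι : Fin m ↪ Fin d) (ε : Fin m → ℤˣ) :
    hypercube m ↪g (stdCubing d).graph where
  toFun y := v + cubeVector ι ε y
  inj' := (add_right_injective v).comp (cubeVector_injective ι ε)
  map_rel_iff' {y y'} := by
    change (stdCubing d).graph.Adj (v + cubeVector ι ε y) (v + cubeVector ι ε y') ↔ _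
    constructor
    · intro h
      obtain ⟨i, η, hη⟩ := stdCubing_adj_iff.1 h
      rw [add_assoc, add_right_inj] at hη
      have eq_direction {k : Fin m} (hk : y k ≠ y' k) : ι k = i := by
        by_contra hne
        have := congrFun hη (ι k)
        rw [Pi.add_apply, Pi.single_eq_of_ne hne, add_zero] at this
        exact hk (cubeVector_apply_eq_iff.1 this).symm
      obtain ⟨k, hk⟩ := Function.ne_iff.1 fun hy : y = y' => h.ne (by rw [hy])
      exact ⟨k, hk, fun l hl => ι.injective ((eq_direction hl).trans (eq_direction hk).symm)⟩
    · intro h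
      obtain ⟨k, rfl⟩ := hypercube_adj_iff.1 h
      rw [cubeVector_flipCoord, ← add_assoc]
      exact stdCubing_adj_add_single _ _ _

theorem stdFace_apply (v : Fin d → ℤ) (ι : Fin m ↪ Fin d) (ε : Fin m → ℤˣ) (y : Fin m → Bool) :
    stdFace v ι ε y = v + cubeVector ι ε y := rfl

theorem stdCubing_square_mem (x : Fin d → ℤ) {i j : Fin d} (hij : i ≠ j) :
    {x, x + Pi.single i 1, x + Pi.single i 1 + Pi.single j 1, x + Pi.single j 1} ∈
      (stdCubing d).cubes := by
  let ι : Fin 2 ↪ Fin d := ⟨![i, j], by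
    intro p q
    fin_cases p <;> fin_cases q <;> simp [hij, hij.symm]⟩
  have range_eq : {x, x + Pi.single i 1, x + Pi.single i 1 + Pi.single j 1, x + Pi.single j 1} =
      Set.range (stdFace x ι 1) := by
    have face_apply (y : Fin 2 → Bool) : stdFace x ι 1 y =
        x + ((if y 0 then Pi.single i 1 else 0) + if y 1 then Pi.single j 1 else 0) := by
      rw [stdFace_apply, cubeVector, Fin.sum_univ_two]
      rfl
    ext z
    simp only [Set.mem_insert_iff, Set.mem_singleton_iff, Set.mem_range, face_apply]
    constructor
    · rintro (rfl | rfl | rfl | rfl)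
      · exact ⟨![false, false], by simp⟩
      · exact ⟨![true, false], by simp⟩
      · exact ⟨![true, true], by simp [add_assoc]⟩
      · exact ⟨![false, true], by simp⟩
    · rintro ⟨y, rfl⟩
      cases y 0 <;> cases y 1 <;> simp [add_assoc]
  rw [range_eq]
  exact range_mem_cubes_cubeCompletion _

/-- The `ℓ¹`-distance between integer points. -/
def latticeDist (x y : Fin d → ℤ) : ℕ := ∑ i, (x i - y i).natAbs

theorem latticeDist_self (x : Fin d → ℤ) : latticeDist x x = 0 := by
  simp [latticeDist]

theorem latticeDist_triangle (x y z : Fin d → ℤ) :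
    latticeDist x z ≤ latticeDist x y + latticeDist y z := by
  rw [latticeDist, latticeDist, latticeDist, ← Finset.sum_add_distrib]
  exact Finset.sum_le_sum fun i _ => by omega

theorem latticeDist_le_one {x y : Fin d → ℤ} (h : (stdCubing d).graph.Adj x y) :
    latticeDist x y ≤ 1 := by
  obtain ⟨i, hi, hne⟩ := h
  rw [latticeDist, Finset.sum_eq_single i (fun j _ hj => by simp [hne j hj]) (by simp)]
  omega

theorem latticeDist_lt {x x' y : Fin d → ℤ} {i : Fin d} (hne : ∀ j ≠ i, x' j = x j)
    (hi : (x' i - y i).natAbs < (x i - y i).natAbs) : latticeDist x' y < latticeDist x y := by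
  refine Finset.sum_lt_sum (fun j _ => ?_) ⟨i, Finset.mem_univ _, hi⟩
  rcases eq_or_ne j i with rfl | hj
  · exact hi.le
  · rw [hne j hj]

theorem exists_add_single_closer {x y : Fin d → ℤ} (hxy : x ≠ y) :
    ∃ (i : Fin d) (ε : ℤˣ), (x i + ε - y i).natAbs < (x i - y i).natAbs ∧
      latticeDist (x + Pi.single i (ε : ℤ)) y < latticeDist x y := by
  obtain ⟨i, hi⟩ := Function.ne_iff.1 hxy
  obtain ⟨ε, hε⟩ : ∃ ε : ℤˣ, (x i + ε - y i).natAbs < (x i - y i).natAbs := by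
    rcases hi.lt_or_gt with h | h
    · exact ⟨1, by rw [Units.val_one]; omega⟩
    · exact ⟨-1, by rw [Units.val_neg, Units.val_one]; omega⟩
  exact ⟨i, ε, hε, latticeDist_lt (i := i) (fun j hj => by simp [hj]) (by simpa using hε)⟩

theorem lattice_path_induction {y : Fin d → ℤ} {motive : (Fin d → ℤ) → Prop} (base : motive y)
    (step : ∀ (x : Fin d → ℤ) (i : Fin d) (ε : ℤˣ), (x i + ε - y i).natAbs < (x i - y i).natAbs →
      motive (x + Pi.single i (ε : ℤ)) → motive x) (x : Fin d → ℤ) : motive x := by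
  induction hn : latticeDist x y using Nat.strong_induction_on generalizing x with
  | _ n ih =>
    rcases eq_or_ne x y with rfl | hxy
    · exact base
    · obtain ⟨i, ε, hε, hlt⟩ := exists_add_single_closer hxy
      exact step x i ε hε (ih _ (hn ▸ hlt) _ rfl)

theorem edist_eq_latticeDist {W : Type*} {G : SimpleGraph W} {φ : W → Fin d → ℤ}
    (le_one : ∀ u v, G.Adj u v → latticeDist (φ u) (φ v) ≤ 1)
    (closer : ∀ u v, u ≠ v →
      ∃ u', G.Adj u u' ∧ latticeDist (φ u') (φ v) < latticeDist (φ u) (φ v))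
    (u v : W) : G.edist u v = latticeDist (φ u) (φ v) := by
  have le_length {u v : W} (p : G.Walk u v) : latticeDist (φ u) (φ v) ≤ p.length := by
    induction p with
    | nil => simp [latticeDist_self]
    | cons h p ih =>
      rw [SimpleGraph.Walk.length_cons, add_comm]
      exact (latticeDist_triangle _ _ _).trans (add_le_add (le_one _ _ h) ih)
  obtain ⟨p, hp⟩ : ∃ p : G.Walk u v, p.length ≤ latticeDist (φ u) (φ v) := by
    induction hn : latticeDist (φ u) (φ v) using Nat.strong_induction_on generalizing u with
    | _ n ih =>
      rcases eq_or_ne u v with rfl | huv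
      · exact ⟨.nil, by simp⟩
      · obtain ⟨u', hadj, hlt⟩ := closer u v huv
        obtain ⟨p, hp⟩ := ih _ (hn ▸ hlt) u' rfl
        exact ⟨.cons hadj p, by rw [SimpleGraph.Walk.length_cons]; omega⟩
  refine le_antisymm ((SimpleGraph.edist_le p).trans (by exact_mod_cast hp)) ?_
  obtain ⟨q, hq⟩ := p.reachable.exists_walk_length_eq_edist
  rw [← hq]
  exact_mod_cast le_length q

theorem stdCubing_edist (x y : Fin d → ℤ) :
    (stdCubing d).graph.edist x y = latticeDist x y := by
  refine edist_eq_latticeDist (φ := id) (fun u v h => latticeDist_le_one h) (fun u v huv => ?_) x y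
  obtain ⟨i, ε, -, hlt⟩ := exists_add_single_closer huv
  exact ⟨_, stdCubing_adj_add_single u i ε, hlt⟩

/-- The edge `e` crosses from the level `n` to the level `n + 1` of the coordinate `i`. -/
def CrossesLevel (i : Fin d) (n : ℤ) (e : Sym2 (Fin d → ℤ)) : Prop :=
  ∃ u : Fin d → ℤ, u i = n ∧ e = s(u, u + Pi.single i 1)

theorem crossesLevel_add_single (x : Fin d → ℤ) (i : Fin d) (ε : ℤˣ) :
    CrossesLevel i (min (x i) (x i + ε)) s(x, x + Pi.single i (ε : ℤ)) := by
  rcases Int.units_eq_one_or ε with rfl | rfl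
  · exact ⟨x, by simp, rfl⟩
  · refine ⟨x + Pi.single i (-1), by simp, ?_⟩
    rw [add_single_neg_one_add_single_one, Sym2.eq_swap]
    rfl

theorem CrossesLevel.of_square {i : Fin d} {n : ℤ} {a b c e : Fin d → ℤ}
    (h : (stdCubing d).Square a b c e) (hab : CrossesLevel i n s(a, b)) :
    CrossesLevel i n s(e, c) := by
  have parallel {a b c e : Fin d → ℤ} (h : (stdCubing d).Square a b c e)
      (ha : a i = n) (hb : b = a + Pi.single i 1) : e i = n ∧ c = e + Pi.single i 1 := by
    obtain ⟨j, hj, δ, rfl, rfl⟩ :=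
      exists_parallel_of_cycle (α := 1) hb h.bc h.cd.symm h.da.symm h.ac h.bd
    exact ⟨by simp [ha, hj.symm], by rw [hb, add_right_comm]⟩
  obtain ⟨u, hu, huv⟩ := hab
  rcases Sym2.eq_iff.1 huv with ⟨rfl, hb⟩ | ⟨ha, rfl⟩
  · obtain ⟨he, rfl⟩ := parallel h hu hb
    exact ⟨e, he, rfl⟩
  · obtain ⟨hc, rfl⟩ := parallel h.reflect.rotate.rotate.rotate hu ha
    exact ⟨c, hc, Sym2.eq_swap⟩

theorem crossesLevel_iff_of_oppositeEdges {i : Fin d} {n : ℤ} {e f : Sym2 (Fin d → ℤ)}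
    (h : (stdCubing d).OppositeEdges e f) : CrossesLevel i n e ↔ CrossesLevel i n f := by
  obtain ⟨a, b, c, p, hab, hbc, hcp, hpa, hm, rfl, rfl⟩ := h
  rcases CubeComplex.square_or_eq_and_eq hab hbc hcp hpa hm with h | ⟨rfl, rfl⟩
  · exact ⟨.of_square h, .of_square h.reflect.rotate⟩
  · rw [Sym2.eq_swap]

theorem oppositeEdges_add_single {i j : Fin d} (hij : i ≠ j) (x : Fin d → ℤ) :
    (stdCubing d).OppositeEdges s(x, x + Pi.single i 1)
      s(x + Pi.single j 1, x + Pi.single j 1 + Pi.single i 1) := by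
  refine ⟨x, x + Pi.single i 1, x + Pi.single i 1 + Pi.single j 1, x + Pi.single j 1,
    stdCubing_adj_add_single x i 1, stdCubing_adj_add_single _ j 1, ?_,
    (stdCubing_adj_add_single x j 1).symm, stdCubing_square_mem x hij, rfl, ?_⟩
  · rw [add_right_comm]
    exact (stdCubing_adj_add_single _ i 1).symm
  · rw [add_right_comm]

theorem eqvGen_oppositeEdges_of_apply_eq {i : Fin d} {x y : Fin d → ℤ} (h : x i = y i) :
    Relation.EqvGen (stdCubing d).OppositeEdges s(x, x + Pi.single i 1)
      s(y, y + Pi.single i 1) := by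
  induction x using lattice_path_induction (y := y) with
  | base => exact .refl _
  | step x j ε hε ih =>
    have hij : i ≠ j := by
      rintro rfl
      rw [h, sub_self] at hε
      exact absurd hε (Nat.not_lt_zero _)
    refine .trans _ _ _ ?_ (ih (by simp [h, hij]))
    rcases Int.units_eq_one_or ε with rfl | rfl
    · exact .rel _ _ (oppositeEdges_add_single hij x)
    · have := oppositeEdges_add_single hij (x + Pi.single j (-1))
      rw [add_single_neg_one_add_single_one] at this
      exact .symm _ _ (.rel _ _ this)

theorem stdCubing_hyperplane {i : Fin d} {n : ℤ} {e : Sym2 (Fin d → ℤ)}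
    (he : CrossesLevel i n e) : (stdCubing d).hyperplane e = {f | CrossesLevel i n f} := by
  ext f
  constructor
  · have invariant {e f} (h : Relation.EqvGen (stdCubing d).OppositeEdges e f) :
        CrossesLevel i n e ↔ CrossesLevel i n f := by
      induction h with
      | rel _ _ h => exact crossesLevel_iff_of_oppositeEdges h
      | refl => rfl
      | symm _ _ _ ih => exact ih.symm
      | trans _ _ _ _ _ ih ih' => exact ih.trans ih'
    exact fun h => (invariant h).1 he
  · rintro ⟨v, hv, rfl⟩
    obtain ⟨u, hu, rfl⟩ := he
    exact eqvGen_oppositeEdges_of_apply_eq (hu.trans hv.symm)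

theorem deleteEdges_crossesLevel_adj_iff {i : Fin d} {n : ℤ} {v w : Fin d → ℤ} :
    ((stdCubing d).graph.deleteEdges {f | CrossesLevel i n f}).Adj v w ↔
      (stdCubing d).graph.Adj v w ∧ (n < v i ↔ n < w i) := by
  rw [SimpleGraph.deleteEdges_adj, and_congr_right_iff]
  intro hvw
  rw [Set.mem_ofPred_eq, not_iff_comm]
  constructor
  · intro hside
    obtain ⟨j, ε, rfl⟩ := stdCubing_adj_iff.1 hvw
    obtain rfl : j = i := by
      by_contra hji
      simp [Ne.symm hji] at hside
    rw [Pi.add_apply, Pi.single_eq_same] at hside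
    obtain rfl : n = min (v j) (v j + ε) := by
      rcases Int.units_eq_one_or ε with rfl | rfl <;> simp at hside ⊢ <;> omega
    exact crossesLevel_add_single v j ε
  · rintro ⟨u, hu, huv⟩
    rcases Sym2.eq_iff.1 huv with ⟨rfl, rfl⟩ | ⟨rfl, rfl⟩ <;> simp [hu]

theorem stdCubing_reachable_iff {i : Fin d} {n : ℤ} {e : Sym2 (Fin d → ℤ)}
    (he : CrossesLevel i n e) (v w : Fin d → ℤ) :
    ((stdCubing d).graph.deleteEdges ((stdCubing d).hyperplane e)).Reachable v w ↔
      (n < v i ↔ n < w i) := by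
  rw [stdCubing_hyperplane he]
  constructor
  · rintro ⟨p⟩
    induction p with
    | nil => rfl
    | cons h _ ih => exact (deleteEdges_crossesLevel_adj_iff.1 h).2.trans ih
  · intro hvw
    induction v using lattice_path_induction (y := w) with
    | base => rfl
    | step x j ε hε ih =>
      have same_side : n < x i ↔ n < (x + Pi.single j (ε : ℤ) : Fin d → ℤ) i := by
        rcases eq_or_ne i j with rfl | hij
        · rw [Pi.add_apply, Pi.single_eq_same]
          rcases Int.units_eq_one_or ε with rfl | rfl
          · rw [Units.val_one] at hε ⊢
            omega
          · rw [Units.val_neg, Units.val_one] at hε ⊢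
            omega
        · simp [hij]
      exact (SimpleGraph.Adj.reachable (deleteEdges_crossesLevel_adj_iff.2
        ⟨stdCubing_adj_add_single x j ε, same_side⟩)).trans (ih (same_side.symm.trans hvw))

theorem mem_stdCubing_halfspaces {K : Set (Fin d → ℤ)} : K ∈ (stdCubing d).halfspaces ↔
    ∃ (i : Fin d) (n : ℤ), K = {x | n < x i} ∨ K = {x | x i ≤ n} := by
  constructor
  · rintro ⟨e, he, v, rfl⟩
    induction e with | _ a b =>
    have hab : (stdCubing d).graph.Adj a b := he
    obtain ⟨i, ε, rfl⟩ := stdCubing_adj_iff.1 hab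
    simp only [stdCubing_reachable_iff (crossesLevel_add_single a i ε)]
    refine ⟨i, min (a i) (a i + ε), ?_⟩
    by_cases hv : min (a i) (a i + ε) < v i
    · exact .inl (by simp only [hv, true_iff])
    · exact .inr (by simp only [hv, false_iff, not_lt])
  · rintro ⟨i, n, h⟩
    let u : Fin d → ℤ := fun _ => n
    have hin : CrossesLevel i n s(u, u + Pi.single i 1) := ⟨u, rfl, rfl⟩
    have edge : s(u, u + Pi.single i 1) ∈ (stdCubing d).graph.edgeSet :=
      stdCubing_adj_add_single u i 1
    rcases h with rfl | rfl
    · refine ⟨_, edge, u + Pi.single i 1, ?_⟩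
      ext x
      simp [stdCubing_reachable_iff hin, u]
    · refine ⟨_, edge, u, ?_⟩
      ext x
      simp [stdCubing_reachable_iff hin, u]

variable {n : ℕ}

theorem embedding_flipCoord_sub (f : hypercube n ↪g (stdCubing d).graph) (x : Fin n → Bool)
    {k l : Fin n} (hkl : k ≠ l) :
    f (flipCoord (flipCoord x l) k) - f (flipCoord x l) = f (flipCoord x k) - f x := by
  have adj (x : Fin n → Bool) (k : Fin n) : (stdCubing d).graph.Adj (f x) (f (flipCoord x k)) :=
    f.map_rel_iff.2 (hypercube_adj_flipCoord x k)
  obtain ⟨i, α, hk⟩ := stdCubing_adj_iff.1 (adj x k)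
  obtain ⟨j, -, δ, hl, hkl⟩ := exists_parallel_of_cycle hk
    (by rw [flipCoord_comm]; exact adj _ l) (adj _ k) (adj x l)
    (f.injective.ne (flipCoord_flipCoord_ne hkl.symm x).symm)
    (f.injective.ne ((flipCoord_injective x).ne hkl))
  rw [hkl, hl]
  abel

/-- The vertex of the hypercube with coordinate `true` exactly in the directions `S`. -/
def cubeVertex (S : Finset (Fin n)) : Fin n → Bool := fun k => decide (k ∈ S)

theorem cubeVertex_injective : Function.Injective (cubeVertex (n := n)) := fun S T h => by
  ext k
  simpa [cubeVertex] using congrFun h k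

theorem cubeVertex_filter (x : Fin n → Bool) : cubeVertex {k | x k = true} = x := by
  funext k
  simp [cubeVertex]

theorem flipCoord_cubeVertex {S : Finset (Fin n)} {k : Fin n} (hk : k ∉ S) :
    flipCoord (cubeVertex S) k = cubeVertex (insert k S) := by
  funext l
  rcases eq_or_ne l k with rfl | hl
  · simp [flipCoord_self, cubeVertex, hk]
  · simp [flipCoord_of_ne hl, cubeVertex, hl]

theorem embedding_insert_sub (f : hypercube n ↪g (stdCubing d).graph) {S : Finset (Fin n)}
    {k : Fin n} (hk : k ∉ S) : f (cubeVertex (insert k S)) - f (cubeVertex S) =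
      f (cubeVertex {k}) - f (cubeVertex ∅) := by
  induction S using Finset.induction_on with
  | empty => rfl
  | insert l S hl ih =>
    have hkl : k ≠ l := fun h => hk (h ▸ Finset.mem_insert_self l S)
    have hkS : k ∉ S := fun h => hk (Finset.mem_insert_of_mem h)
    have := embedding_flipCoord_sub f (cubeVertex S) hkl
    rw [flipCoord_cubeVertex hl, flipCoord_cubeVertex hk, flipCoord_cubeVertex hkS] at this
    rw [this, ih hkS]

theorem embedding_cubeVertex (f : hypercube n ↪g (stdCubing d).graph) (S : Finset (Fin n)) :
    f (cubeVertex S) =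
      f (cubeVertex ∅) + ∑ k ∈ S, (f (cubeVertex {k}) - f (cubeVertex ∅)) := by
  induction S using Finset.induction_on with
  | empty => simp
  | insert l S hl ih =>
    rw [Finset.sum_insert hl, add_left_comm, ← ih, ← embedding_insert_sub f hl, sub_add_cancel]

theorem exists_eq_stdFace (f : hypercube n ↪g (stdCubing d).graph) :
    ∃ (u : Fin d → ℤ) (π : Fin n ↪ Fin d) (ε : Fin n → ℤˣ), f = stdFace u π ε := by
  have directions (k : Fin n) : ∃ (i : Fin d) (ε : ℤˣ),
      f (cubeVertex {k}) - f (cubeVertex ∅) = Pi.single i (ε : ℤ) := by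
    have adj : (stdCubing d).graph.Adj (f (cubeVertex ∅)) (f (cubeVertex {k})) := by
      rw [← insert_empty_eq k, ← flipCoord_cubeVertex (Finset.notMem_empty k)]
      exact f.map_rel_iff.2 (hypercube_adj_flipCoord _ k)
    obtain ⟨i, ε, h⟩ := stdCubing_adj_iff.1 adj
    exact ⟨i, ε, by rw [h, add_sub_cancel_left]⟩
  choose π ε hπ using directions
  have apply_eq (S : Finset (Fin n)) :
      f (cubeVertex S) = f (cubeVertex ∅) + ∑ k ∈ S, Pi.single (π k) (ε k : ℤ) := by
    rw [embedding_cubeVertex]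
    simp only [hπ]
  have injective : Function.Injective π := by
    intro k l hkl
    by_contra hne
    rcases units_eq_or_single_eq_neg (π k) (ε k) (ε l) with h | h
    · have : f (cubeVertex {k}) = f (cubeVertex {l}) := by
        rw [apply_eq {k}, apply_eq {l}, Finset.sum_singleton, Finset.sum_singleton, hkl, h]
      exact hne (Finset.singleton_injective (cubeVertex_injective (f.injective this)))
    · have : f (cubeVertex {k, l}) = f (cubeVertex ∅) := by
        rw [apply_eq, Finset.sum_pair hne, ← hkl, h, add_neg_cancel, add_zero]
      exact Finset.insert_ne_empty _ _ (cubeVertex_injective (f.injective this))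
  refine ⟨f (cubeVertex ∅), ⟨π, injective⟩, ε, RelEmbedding.ext fun x => ?_⟩
  rw [stdFace_apply, cubeVector, ← Finset.sum_filter, ← cubeVertex_filter x, apply_eq,
    cubeVertex_filter]
  rfl

theorem le_of_hypercube_embedding (f : hypercube n ↪g (stdCubing d).graph) : n ≤ d := by
  obtain ⟨-, π, -⟩ := exists_eq_stdFace f
  simpa using Fintype.card_le_of_embedding π

theorem exists_range_eq_of_hypercube_embedding (f : hypercube d ↪g (stdCubing d).graph) :
    ∃ v : Fin d → ℤ, Set.range f = {x | ∀ i, x i = v i ∨ x i = v i + 1} := by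
  obtain ⟨u, π, ε, rfl⟩ := exists_eq_stdFace f
  let ρ := Equiv.ofBijective π (Finite.injective_iff_bijective.1 π.injective)
  have coord (y : Fin d → Bool) (i : Fin d) : stdFace u π ε y i =
      u i + if y (ρ.symm i) then (ε (ρ.symm i) : ℤ) else 0 := by
    obtain ⟨k, rfl⟩ := ρ.surjective i
    rw [ρ.symm_apply_apply, stdFace_apply, Pi.add_apply]
    exact congrArg _ (cubeVector_apply π ε y k)
  refine ⟨fun i => u i + min 0 (ε (ρ.symm i) : ℤ), ?_⟩
  ext x
  constructor
  · rintro ⟨y, rfl⟩ i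
    rw [coord]
    rcases Int.units_eq_one_or (ε (ρ.symm i)) with h | h <;> cases y (ρ.symm i) <;> simp [h]
  · intro hx
    refine ⟨fun k => decide (x (ρ k) ≠ u (ρ k)), funext fun i => ?_⟩
    have := hx i
    rw [coord, ρ.apply_symm_apply]
    rcases Int.units_eq_one_or (ε (ρ.symm i)) with h | h
    all_goals
      simp only [h, Units.val_one, Units.val_neg, decide_eq_true_eq] at this ⊢
      split_ifs <;> omega

end StdCubing

/-! ### Coordinates on Sageev complexes -/

namespace SageevVertex

variable {V : Type*} {𝓗 : Set (Set V)} {H K : Set V}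

theorem compl_mem_iff (σ : SageevVertex 𝓗) (hH : H ∈ 𝓗) : Hᶜ ∈ σ ↔ H ∉ σ := by
  rcases σ.choice H hH with ⟨mem, compl_notMem⟩ | ⟨compl_mem, notMem⟩
  · exact ⟨fun h => absurd h compl_notMem, fun h => absurd mem h⟩
  · exact ⟨fun _ => notMem, fun _ => compl_mem⟩

theorem mem_of_subset (σ : SageevVertex 𝓗) (hK : K ∈ 𝓗) (hH : H ∈ σ) (hHK : H ⊆ K) : K ∈ σ := by
  by_contra hK'
  rw [← σ.compl_mem_iff hK] at hK'
  exact σ.meet _ hH _ hK' (by rwa [compl_compl])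

theorem sdiff_eq_singleton_compl {σ τ : SageevVertex 𝓗} (h : σ.carrier \ τ.carrier = {H}) :
    τ.carrier \ σ.carrier = {Hᶜ} := by
  have mem_sdiff_iff (K : Set V) : K ∈ τ.carrier \ σ.carrier ↔ Kᶜ ∈ σ.carrier \ τ.carrier := by
    constructor
    · rintro ⟨hτ, hσ⟩
      have hK := τ.subset hτ
      exact ⟨(σ.compl_mem_iff hK).2 hσ, fun hc => (τ.compl_mem_iff hK).1 hc hτ⟩
    · rintro ⟨hσ, hτ⟩
      have hK := σ.subset hσ
      rw [← compl_compl K]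
      exact ⟨(τ.compl_mem_iff hK).2 hτ, fun hc => (σ.compl_mem_iff hK).1 hc hσ⟩
  ext K
  rw [mem_sdiff_iff, h, Set.mem_singleton_iff, Set.mem_singleton_iff, compl_eq_comm, eq_comm]

theorem graph_adj_iff {σ τ : SageevVertex 𝓗} :
    (graph 𝓗).Adj σ τ ↔ ∃ H, σ.carrier \ τ.carrier = {H} :=
  ⟨fun ⟨H, h, _⟩ => ⟨H, h⟩, fun ⟨H, h⟩ => ⟨H, h, sdiff_eq_singleton_compl h⟩⟩

end SageevVertex

namespace IsRankedSystem

variable {V : Type*} {P S : Set (Set V)} {pos : Set V → ℤ} {M : ℤ}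

theorem isWF_of_forall_pos_le (h : IsRankedSystem P pos) (hS : ∀ H ∈ S, H ∈ P)
    (hM : ∀ H ∈ S, pos H ≤ M) : S.IsWF := by
  refine Set.WellFoundedOn.mono' (fun H hH K hK hHK => ?_)
    (measure fun H => (M - pos H).toNat).wf.wellFoundedOn
  have pos_lt := h.lt_of_ssubset (hS H hH) (hS K hK) hHK
  have pos_le := hM H hH
  change (M - pos H).toNat < (M - pos K).toNat
  omega

theorem isWF_of_forall_le_pos_compl (h : IsRankedSystem P pos) (hS : ∀ H ∈ S, Hᶜ ∈ P)
    (hM : ∀ H ∈ S, M ≤ pos Hᶜ) : S.IsWF := by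
  refine Set.WellFoundedOn.mono' (fun H hH K hK hHK => ?_)
    (measure fun H => (pos Hᶜ - M).toNat).wf.wellFoundedOn
  have pos_lt := h.lt_of_ssubset (hS K hK) (hS H hH) (compl_lt_compl_iff_lt.2 hHK)
  have le_pos := hM H hH
  change (pos Hᶜ - M).toNat < (pos Kᶜ - M).toNat
  omega

end IsRankedSystem

/-- A decomposition of `P` into the bi-infinite descending chains `c i`. -/
structure IsChainSystem {V : Type*} (P : Set (Set V)) {d : ℕ} (c : Fin d → ℤ → Set V) :
    Prop where
  mem : ∀ i n, c i n ∈ P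
  surj : ∀ H ∈ P, ∃ i n, c i n = H
  inj : ∀ i j n m, c i n = c j m → i = j ∧ n = m
  anti : ∀ i n m, n < m → c i m ⊂ c i n

/-- The coordinates `φ` on the vertices of the Sageev complex of `𝓗 = P ∪ {H | Hᶜ ∈ P}` given by a
chain decomposition `c` of `P`: the `i`-th coordinate of `σ` is the index of the first member of
the `i`-th chain that does not belong to `σ`. -/
structure IsSageevChart {V : Type*} (P 𝓗 : Set (Set V)) (pos : Set V → ℤ) {d : ℕ}
    (c : Fin d → ℤ → Set V) (φ : SageevVertex 𝓗 → Fin d → ℤ) : Prop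
    extends IsRankedSystem P pos, IsChainSystem P c where
  mem_iff : ∀ H, H ∈ 𝓗 ↔ H ∈ P ∨ Hᶜ ∈ P
  coord : ∀ σ i n, c i n ∈ σ ↔ n < φ σ i

section Charts

variable {V : Type*} {P 𝓗 : Set (Set V)} {pos : Set V → ℤ} {d : ℕ} {c : Fin d → ℤ → Set V}

namespace IsChainSystem

theorem subset_iff (hc : IsChainSystem P c) (i : Fin d) {n m : ℤ} : c i m ⊆ c i n ↔ n ≤ m := by
  constructor
  · intro h
    by_contra! hmn
    exact (hc.anti i m n hmn).not_subset h
  · intro h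
    rcases h.eq_or_lt with rfl | hnm
    exacts [subset_rfl, (hc.anti i n m hnm).subset]

theorem exists_coord (hc : IsChainSystem P c) (hP : P ⊆ 𝓗) (σ : SageevVertex 𝓗) (i : Fin d) :
    ∃ k, ∀ n, c i n ∈ σ ↔ n < k := by
  have mem_of_le (n m : ℤ) (hnm : n ≤ m) (hm : c i m ∈ σ) : c i n ∈ σ :=
    σ.mem_of_subset (hP (hc.mem i n)) hm ((hc.subset_iff i).2 hnm)
  have no_descending := Set.isWF_iff_no_descending_seq.1 σ.dcc
  have exists_mem : ∃ n, c i n ∈ σ := by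
    by_contra! none_mem
    refine no_descending (fun k => (c i (-(k : ℤ)))ᶜ) (fun a b hab => ?_) fun k =>
      (σ.compl_mem_iff (hP (hc.mem i _))).2 (none_mem _)
    exact compl_lt_compl_iff_lt.2 (hc.anti i _ _ (by omega))
  have bounded : ∃ N, ∀ n, c i n ∈ σ → n ≤ N := by
    by_contra! unbounded
    refine no_descending (fun k => c i k) (fun a b hab => hc.anti i a b (by exact_mod_cast hab))
      fun k => ?_
    obtain ⟨n, hn, hk⟩ := unbounded k
    exact mem_of_le _ _ hk.le hn
  obtain ⟨k, hk, le_k⟩ := Int.exists_greatest_of_bdd bounded exists_mem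
  exact ⟨k + 1, fun n => ⟨fun hn => Int.lt_add_one_of_le (le_k n hn),
    fun hn => mem_of_le _ _ (Int.le_of_lt_add_one hn) hk⟩⟩

end IsChainSystem

theorem exists_isSageevChart (hP : IsRankedSystem P pos) (hc : IsChainSystem P c)
    (h𝓗 : ∀ H, H ∈ 𝓗 ↔ H ∈ P ∨ Hᶜ ∈ P) : ∃ φ, IsSageevChart P 𝓗 pos c φ := by
  choose φ hφ using hc.exists_coord (𝓗 := 𝓗) fun H hH => (h𝓗 H).2 (Or.inl hH)
  exact ⟨φ, ⟨hP, hc, h𝓗, hφ⟩⟩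

/-- The choice of one half-space from each pair of opposite ones that a chart describes by the
integer point `k`. -/
def coordFilter (c : Fin d → ℤ → Set V) (k : Fin d → ℤ) : Set (Set V) :=
  {H | ∃ i n, H = c i n ∧ n < k i} ∪ {H | ∃ i n, H = (c i n)ᶜ ∧ k i ≤ n}

namespace IsSageevChart

variable {φ : SageevVertex 𝓗 → Fin d → ℤ} (h : IsSageevChart P 𝓗 pos c φ)
include h

theorem chain_mem (i : Fin d) (n : ℤ) : c i n ∈ 𝓗 :=
  (h.mem_iff _).2 (Or.inl (h.mem i n))

theorem compl_chain_mem (i : Fin d) (n : ℤ) : (c i n)ᶜ ∈ 𝓗 :=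
  (h.mem_iff _).2 (Or.inr ((compl_compl (c i n)).symm ▸ h.mem i n))

theorem exists_eq_or_eq_compl {H : Set V} (hH : H ∈ 𝓗) : ∃ i n, H = c i n ∨ H = (c i n)ᶜ := by
  rcases (h.mem_iff H).1 hH with mem | compl_mem
  · obtain ⟨i, n, rfl⟩ := h.surj H mem
    exact ⟨i, n, Or.inl rfl⟩
  · obtain ⟨i, n, hn⟩ := h.surj _ compl_mem
    exact ⟨i, n, Or.inr (by rw [hn, compl_compl])⟩

theorem chain_ne_compl (i j : Fin d) (n m : ℤ) : c i n ≠ (c j m)ᶜ := fun heq =>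
  h.not_subset_compl _ (h.mem i n) _ (h.mem j m) heq.subset

theorem compl_coord (σ : SageevVertex 𝓗) (i : Fin d) (n : ℤ) : (c i n)ᶜ ∈ σ ↔ φ σ i ≤ n := by
  rw [σ.compl_mem_iff (h.chain_mem i n), h.coord, not_lt]

theorem injective : Function.Injective φ := by
  intro σ τ hστ
  have mem_iff_mem (H : Set V) (hH : H ∈ 𝓗) : H ∈ σ ↔ H ∈ τ := by
    obtain ⟨i, n, rfl | rfl⟩ := h.exists_eq_or_eq_compl hH
    · rw [h.coord, h.coord, hστ]
    · rw [h.compl_coord, h.compl_coord, hστ]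
  exact SageevVertex.ext (Set.ext fun H => ⟨fun hH => (mem_iff_mem H (σ.subset hH)).1 hH,
    fun hH => (mem_iff_mem H (τ.subset hH)).2 hH⟩)

theorem lt_of_subset (σ : SageevVertex 𝓗) {i j : Fin d} {n m : ℤ}
    (hs : c i n ⊆ c j m) (hn : n < φ σ i) : m < φ σ j := by
  rw [← h.coord] at hn ⊢
  exact σ.mem_of_subset (h.chain_mem j m) hn hs

theorem pos_lt_of_subset {i j : Fin d} {n m : ℤ} (hs : c i n ⊆ c j m)
    (hne : ¬ (i = j ∧ n = m)) : pos (c j m) < pos (c i n) :=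
  h.lt_of_ssubset (h.mem i n) (h.mem j m) (hs.ssubset_of_ne fun heq => hne (h.inj _ _ _ _ heq))

theorem pos_le_of_le (i : Fin d) {n m : ℤ} (hnm : n ≤ m) : pos (c i n) ≤ pos (c i m) :=
  h.le_of_subset _ (h.mem i m) _ (h.mem i n) ((h.subset_iff i).2 hnm)

variable {k : Fin d → ℤ}

theorem chain_mem_coordFilter (i : Fin d) (n : ℤ) : c i n ∈ coordFilter c k ↔ n < k i := by
  refine ⟨?_, fun hn => Or.inl ⟨i, n, rfl, hn⟩⟩
  rintro (⟨j, m, heq, hm⟩ | ⟨j, m, heq, -⟩)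
  · obtain ⟨rfl, rfl⟩ := h.inj _ _ _ _ heq
    exact hm
  · exact absurd heq (h.chain_ne_compl i j n m)

theorem compl_chain_mem_coordFilter (i : Fin d) (n : ℤ) :
    (c i n)ᶜ ∈ coordFilter c k ↔ k i ≤ n := by
  refine ⟨?_, fun hn => Or.inr ⟨i, n, rfl, hn⟩⟩
  rintro (⟨j, m, heq, -⟩ | ⟨j, m, heq, hm⟩)
  · exact absurd heq.symm (h.chain_ne_compl j i m n)
  · obtain ⟨rfl, rfl⟩ := h.inj _ _ _ _ (compl_injective heq)
    exact hm

theorem isWF_coordFilter : (coordFilter c k).IsWF := by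
  have finite : (Set.range fun i => pos (c i (k i))).Finite := Set.finite_range _
  obtain ⟨M, hM⟩ := finite.bddAbove
  obtain ⟨m, hm⟩ := finite.bddBelow
  refine (h.isWF_of_forall_pos_le (M := M) ?_ ?_).union
    (h.isWF_of_forall_le_pos_compl (M := m) ?_ ?_)
  · rintro _ ⟨i, n, rfl, -⟩
    exact h.mem i n
  · rintro _ ⟨i, n, rfl, hn⟩
    exact (h.pos_le_of_le i hn.le).trans (hM ⟨i, rfl⟩)
  · rintro _ ⟨i, n, rfl, -⟩
    rw [compl_compl]
    exact h.mem i n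
  · rintro _ ⟨i, n, rfl, hn⟩
    rw [compl_compl]
    exact (hm ⟨i, rfl⟩).trans (h.pos_le_of_le i hn)

theorem not_subset_compl_of_mem_coordFilter
    (hk : ∀ i j n m, c i n ⊆ c j m → n < k i → m < k j) :
    ∀ H ∈ coordFilter c k, ∀ K ∈ coordFilter c k, ¬ H ⊆ Kᶜ := by
  rintro _ (⟨i, n, rfl, hn⟩ | ⟨i, n, rfl, hn⟩) _ (⟨j, m, rfl, hm⟩ | ⟨j, m, rfl, hm⟩) hs
  · exact h.not_subset_compl _ (h.mem i n) _ (h.mem j m) hs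
  · rw [compl_compl] at hs
    exact absurd (hk _ _ _ _ hs hn) hm.not_gt
  · rw [Set.compl_subset_compl] at hs
    exact absurd (hk _ _ _ _ hs hm) hn.not_gt
  · rw [compl_compl] at hs
    exact h.not_compl_subset _ (h.mem i n) _ (h.mem j m) hs

theorem exists_coord_eq (hk : ∀ i j n m, c i n ⊆ c j m → n < k i → m < k j) :
    ∃ σ, φ σ = k := by
  have subset : coordFilter c k ⊆ 𝓗 := by
    rintro _ (⟨i, n, rfl, -⟩ | ⟨i, n, rfl, -⟩)
    exacts [h.chain_mem i n, h.compl_chain_mem i n]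
  have choice : ∀ H ∈ 𝓗, Xor (H ∈ coordFilter c k) (Hᶜ ∈ coordFilter c k) := by
    intro H hH
    obtain ⟨i, n, rfl | rfl⟩ := h.exists_eq_or_eq_compl hH
    · rw [h.chain_mem_coordFilter, h.compl_chain_mem_coordFilter, ← not_lt, xor_not_right]
    · rw [compl_compl, h.chain_mem_coordFilter, h.compl_chain_mem_coordFilter, ← not_lt,
        xor_not_left]
  let σ : SageevVertex 𝓗 :=
    ⟨coordFilter c k, subset, choice, h.not_subset_compl_of_mem_coordFilter hk, h.isWF_coordFilter⟩
  refine ⟨σ, funext fun i => ?_⟩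
  have lt_iff (n : ℤ) : n < φ σ i ↔ n < k i := by
    rw [← h.coord, ← h.chain_mem_coordFilter]
    rfl
  exact eq_of_forall_lt_iff lt_iff

theorem sdiff_eq_singleton_iff {σ τ : SageevVertex 𝓗} {i : Fin d} {n : ℤ} :
    σ.carrier \ τ.carrier = {c i n} ↔ φ σ = φ τ + Pi.single i 1 ∧ φ τ i = n := by
  have mem_sdiff (j : Fin d) (m : ℤ) :
      c j m ∈ σ.carrier \ τ.carrier ↔ φ τ j ≤ m ∧ m < φ σ j := by
    rw [Set.mem_sdiff, ← not_lt, ← h.coord, ← h.coord, and_comm]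
    rfl
  have compl_mem_sdiff (j : Fin d) (m : ℤ) :
      (c j m)ᶜ ∈ σ.carrier \ τ.carrier ↔ φ σ j ≤ m ∧ m < φ τ j := by
    rw [Set.mem_sdiff, ← h.compl_coord, ← not_le, ← h.compl_coord]
    rfl
  have chain_eq_iff (j : Fin d) (m : ℤ) : c j m = c i n ↔ j = i ∧ m = n :=
    ⟨h.inj _ _ _ _, fun ⟨hj, hm⟩ => by rw [hj, hm]⟩
  constructor
  · intro heq
    simp only [heq, Set.mem_singleton_iff, chain_eq_iff, (h.chain_ne_compl _ _ _ _).symm]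
      at mem_sdiff compl_mem_sdiff
    have mem_n := (mem_sdiff i n).1 ⟨rfl, rfl⟩
    have mem_τ (j : Fin d) := mem_sdiff j (φ τ j)
    refine ⟨funext fun j => ?_, by grind⟩
    have not_lt_τ := compl_mem_sdiff j (φ σ j)
    have mem_last := mem_sdiff j (φ σ j - 1)
    rw [Pi.add_apply, Pi.single_apply]
    grind
  · rintro ⟨hσ, hn⟩
    ext H
    refine ⟨fun hH => ?_, ?_⟩
    · obtain ⟨j, m, rfl | rfl⟩ := h.exists_eq_or_eq_compl (σ.subset hH.1)
      · rw [mem_sdiff, hσ, Pi.add_apply, Pi.single_apply] at hH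
        rw [Set.mem_singleton_iff, chain_eq_iff]
        grind
      · rw [compl_mem_sdiff, hσ, Pi.add_apply, Pi.single_apply] at hH
        grind
    · rintro rfl
      rw [mem_sdiff, hσ, Pi.add_apply, Pi.single_eq_same, hn]
      omega

theorem exists_sdiff_eq_singleton_iff {σ τ : SageevVertex 𝓗} :
    (∃ i n, σ.carrier \ τ.carrier = {c i n}) ↔ ∃ i, φ σ = φ τ + Pi.single i 1 := by
  simp only [h.sdiff_eq_singleton_iff, exists_and_left, exists_eq', and_true]

theorem adj_iff {σ τ : SageevVertex 𝓗} :
    (SageevVertex.graph 𝓗).Adj σ τ ↔ (stdCubing d).graph.Adj (φ σ) (φ τ) := by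
  rw [stdCubing_adj_iff]
  constructor
  · intro hadj
    obtain ⟨H, hH⟩ := SageevVertex.graph_adj_iff.1 hadj
    have mem : H ∈ σ.carrier := (hH.symm ▸ Set.mem_singleton H : H ∈ σ.carrier \ τ.carrier).1
    obtain ⟨i, n, rfl | rfl⟩ := h.exists_eq_or_eq_compl (σ.subset mem)
    · obtain ⟨j, hj⟩ := h.exists_sdiff_eq_singleton_iff.1 ⟨i, n, hH⟩
      exact ⟨j, -1, by rw [hj, Units.val_neg, Units.val_one, Pi.single_neg, add_neg_cancel_right]⟩
    · have hH' := SageevVertex.sdiff_eq_singleton_compl hH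
      rw [compl_compl] at hH'
      obtain ⟨j, hj⟩ := h.exists_sdiff_eq_singleton_iff.1 ⟨i, n, hH'⟩
      exact ⟨j, 1, hj⟩
  · rintro ⟨i, ε, hε⟩
    rcases Int.units_eq_one_or ε with rfl | rfl
    · obtain ⟨j, n, hn⟩ := h.exists_sdiff_eq_singleton_iff.2 ⟨i, hε⟩
      exact (SageevVertex.graph_adj_iff.2 ⟨_, hn⟩).symm
    · rw [Units.val_neg, Units.val_one] at hε
      have hσ : φ σ = φ τ + Pi.single i 1 := by rw [hε, add_single_neg_one_add_single_one]
      obtain ⟨j, n, hn⟩ := h.exists_sdiff_eq_singleton_iff.2 ⟨i, hσ⟩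
      exact SageevVertex.graph_adj_iff.2 ⟨_, hn⟩

/-- Of the half-spaces `c i (φ σ i)` that separate `σ` from `τ`, the one of least rank is minimal
for inclusion among the half-spaces not chosen by `σ`, so it can be crossed. -/
theorem exists_coord_add_one {σ τ : SageevVertex 𝓗} (hlt : ∃ i, φ σ i < φ τ i) :
    ∃ i σ', φ σ i < φ τ i ∧ φ σ' = φ σ + Pi.single i 1 := by
  obtain ⟨i, hi, hmin⟩ := Set.exists_min_image {i | φ σ i < φ τ i} (fun i => pos (c i (φ σ i)))
    (Set.toFinite _) hlt
  obtain ⟨σ', hσ'⟩ := h.exists_coord_eq (k := φ σ + Pi.single i 1) fun a b n m hs hn => by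
    by_contra! hm
    rw [Pi.add_apply, Pi.single_apply] at hn hm
    have hle : φ σ b ≤ m := by grind
    have hnσ : ¬ n < φ σ a := fun hlt => (h.lt_of_subset σ hs hlt).not_ge hle
    obtain ⟨rfl, rfl⟩ : a = i ∧ n = φ σ a := by grind
    have min_le := hmin b (hle.trans_lt (h.lt_of_subset τ hs hi))
    have pos_le := h.pos_le_of_le b hle
    have pos_lt := h.pos_lt_of_subset hs (by grind)
    omega
  exact ⟨i, σ', hi, hσ'⟩

theorem exists_coord_sub_one {σ τ : SageevVertex 𝓗} (hlt : ∃ i, φ τ i < φ σ i) :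
    ∃ i σ', φ τ i < φ σ i ∧ φ σ' = φ σ + Pi.single i (-1) := by
  obtain ⟨i, hi, hmax⟩ := Set.exists_max_image {i | φ τ i < φ σ i}
    (fun i => pos (c i (φ σ i - 1))) (Set.toFinite _) hlt
  obtain ⟨σ', hσ'⟩ := h.exists_coord_eq (k := φ σ + Pi.single i (-1)) fun a b n m hs hn => by
    by_contra! hm
    rw [Pi.add_apply, Pi.single_apply] at hn hm
    have hna : n < φ σ a := by grind
    have hmb := h.lt_of_subset σ hs hna
    obtain ⟨rfl, rfl⟩ : b = i ∧ m = φ σ b - 1 := by grind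
    have hnτ : φ τ a ≤ n := not_lt.1 fun hlt =>
      (h.lt_of_subset τ hs hlt).not_ge (Int.le_sub_one_of_lt hi)
    have le_max := hmax a (hnτ.trans_lt hna)
    have pos_le := h.pos_le_of_le a (Int.le_sub_one_of_lt hna)
    have pos_lt := h.pos_lt_of_subset hs (by grind)
    omega
  exact ⟨i, σ', hi, hσ'⟩

theorem exists_closer {σ τ : SageevVertex 𝓗} (hστ : σ ≠ τ) :
    ∃ σ', (SageevVertex.graph 𝓗).Adj σ σ' ∧
      latticeDist (φ σ') (φ τ) < latticeDist (φ σ) (φ τ) := by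
  obtain ⟨i, σ', ε, hσ', hlt⟩ : ∃ i σ', ∃ ε : ℤˣ, φ σ' = φ σ + Pi.single i (ε : ℤ) ∧
      (φ σ i + ε - φ τ i).natAbs < (φ σ i - φ τ i).natAbs := by
    obtain ⟨j, hj⟩ := Function.ne_iff.1 (h.injective.ne hστ)
    rcases hj.lt_or_gt with hlt | hgt
    · obtain ⟨i, σ', hi, hσ'⟩ := h.exists_coord_add_one ⟨j, hlt⟩
      exact ⟨i, σ', 1, hσ', by rw [Units.val_one]; omega⟩
    · obtain ⟨i, σ', hi, hσ'⟩ := h.exists_coord_sub_one ⟨j, hgt⟩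
      exact ⟨i, σ', -1, hσ', by rw [Units.val_neg, Units.val_one]; omega⟩
  refine ⟨σ', h.adj_iff.2 (hσ' ▸ stdCubing_adj_add_single _ i ε), ?_⟩
  rw [hσ']
  refine latticeDist_lt (i := i) (fun j hj => by simp [hj]) ?_
  rwa [Pi.add_apply, Pi.single_eq_same]

theorem edist_eq (σ τ : SageevVertex 𝓗) :
    (stdCubing d).graph.edist (φ σ) (φ τ) = (SageevVertex.graph 𝓗).edist σ τ := by
  rw [stdCubing_edist]
  exact (edist_eq_latticeDist (fun u v huv => latticeDist_le_one (h.adj_iff.1 huv))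
    (fun u v huv => h.exists_closer huv) σ τ).symm

end IsSageevChart

end Charts

section CoordinateHalfspaces

variable {d : ℕ} {i j : Fin d} {n m : ℤ}

theorem setOf_lt_coord_inj (h : {x : Fin d → ℤ | n < x i} = {x | m < x j}) : i = j ∧ n = m := by
  have lt_iff (x : Fin d → ℤ) : n < x i ↔ m < x j := Set.ext_iff.1 h x
  have hij : i = j := by
    by_contra! hij
    have := lt_iff (Function.update (fun _ => m) i (n + 1))
    rw [Function.update_self, Function.update_of_ne hij.symm] at this
    omega
  exact ⟨hij, eq_of_forall_gt_iff fun k => lt_iff fun _ => k⟩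

theorem setOf_lt_coord_ne_compl : {x : Fin d → ℤ | n < x i} ≠ {x | m < x j}ᶜ := fun h => by
  have := Set.ext_iff.1 h fun _ => max n m + 1
  simp only [Set.mem_compl_iff, Set.mem_ofPred_eq] at this
  omega

theorem coordHalfspaces_eq (i : Fin d) :
    coordHalfspaces d i = {K | ∃ n : ℤ, K = {x | n < x i}} := by
  have half_le_iff (n m : ℤ) : (n : ℝ) + 1 / 2 ≤ m ↔ n < m := by
    constructor
    · intro h
      have : (n : ℝ) < m := by linarith
      exact_mod_cast this
    · intro h
      have : (n : ℝ) + 1 ≤ m := by exact_mod_cast h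
      linarith
  simp only [coordHalfspaces, half_le_iff]

end CoordinateHalfspaces

section ChartHalfspaces

variable {V : Type*} {P 𝓗 : Set (Set V)} {pos : Set V → ℤ} {d : ℕ} {c : Fin d → ℤ → Set V}

/-- The half-space of the standard cubing that corresponds to a member of a chain or to its
complement. -/
def chartHalf (c : Fin d → ℤ → Set V) (H : Set V) : Set (Fin d → ℤ) :=
  {x | H ∈ coordFilter c x}

namespace IsSageevChart

variable {φ : SageevVertex 𝓗 → Fin d → ℤ} (h : IsSageevChart P 𝓗 pos c φ)
include h

theorem chartHalf_chain (i : Fin d) (n : ℤ) : chartHalf c (c i n) = {x | n < x i} :=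
  Set.ext fun _ => h.chain_mem_coordFilter i n

theorem chartHalf_compl_chain (i : Fin d) (n : ℤ) : chartHalf c (c i n)ᶜ = {x | n < x i}ᶜ :=
  Set.ext fun _ => (h.compl_chain_mem_coordFilter i n).trans not_lt.symm

theorem preimage_chartHalf {H : Set V} (hH : H ∈ 𝓗) :
    φ ⁻¹' chartHalf c H = SageevVertex.half 𝓗 H := by
  ext σ
  obtain ⟨i, n, rfl | rfl⟩ := h.exists_eq_or_eq_compl hH
  · rw [h.chartHalf_chain]
    exact (h.coord σ i n).symm
  · rw [h.chartHalf_compl_chain]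
    exact not_lt.trans (h.compl_coord σ i n).symm

theorem bijOn_chartHalf : Set.BijOn (chartHalf c) 𝓗 (stdCubing d).halfspaces := by
  have compl_eq (i : Fin d) (n : ℤ) : {x : Fin d → ℤ | n < x i}ᶜ = {x | x i ≤ n} :=
    Set.ext fun x => (not_lt : ¬ n < x i ↔ x i ≤ n)
  refine ⟨fun H hH => ?_, fun H hH K hK hHK => ?_, fun K hK => ?_⟩
  · obtain ⟨i, n, rfl | rfl⟩ := h.exists_eq_or_eq_compl hH
    · exact mem_stdCubing_halfspaces.2 ⟨i, n, Or.inl (h.chartHalf_chain i n)⟩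
    · exact mem_stdCubing_halfspaces.2
        ⟨i, n, Or.inr ((h.chartHalf_compl_chain i n).trans (compl_eq i n))⟩
  · obtain ⟨i, n, rfl | rfl⟩ := h.exists_eq_or_eq_compl hH <;>
    obtain ⟨j, m, rfl | rfl⟩ := h.exists_eq_or_eq_compl hK <;>
    simp only [h.chartHalf_chain, h.chartHalf_compl_chain] at hHK
    · obtain ⟨rfl, rfl⟩ := setOf_lt_coord_inj hHK
      rfl
    · exact absurd hHK setOf_lt_coord_ne_compl
    · exact absurd hHK.symm setOf_lt_coord_ne_compl
    · obtain ⟨rfl, rfl⟩ := setOf_lt_coord_inj (compl_injective hHK)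
      rfl
  · obtain ⟨i, n, rfl | rfl⟩ := mem_stdCubing_halfspaces.1 hK
    · exact ⟨c i n, h.chain_mem i n, h.chartHalf_chain i n⟩
    · exact ⟨(c i n)ᶜ, h.compl_chain_mem i n,
        (h.chartHalf_compl_chain i n).trans (compl_eq i n)⟩

theorem image_chartHalf : chartHalf c '' P = stdPosHalfspaces d := by
  ext K
  simp only [stdPosHalfspaces, coordHalfspaces_eq, Set.mem_iUnion, Set.mem_image,
    Set.mem_ofPred_eq]
  constructor
  · rintro ⟨H, hH, rfl⟩
    obtain ⟨i, n, rfl⟩ := h.surj H hH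
    exact ⟨i, n, h.chartHalf_chain i n⟩
  · rintro ⟨i, n, rfl⟩
    exact ⟨c i n, h.mem i n, h.chartHalf_chain i n⟩

theorem chartHalf_mem_coordHalfspaces (i j : Fin d) (n : ℤ) :
    chartHalf c (c j n) ∈ coordHalfspaces d i ↔ j = i := by
  rw [coordHalfspaces_eq, h.chartHalf_chain]
  constructor
  · rintro ⟨m, hm⟩
    exact (setOf_lt_coord_inj hm).1
  · rintro rfl
    exact ⟨n, rfl⟩

end IsSageevChart

end ChartHalfspaces

/-! ### Cubes of Sageev complexes -/

namespace IsSageevChart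

variable {V : Type*} {P 𝓗 : Set (Set V)} {pos : Set V → ℤ} {d : ℕ} {c : Fin d → ℤ → Set V}
  {φ : SageevVertex 𝓗 → Fin d → ℤ} {C : Set (SageevVertex 𝓗)}

section Embedding

variable (h : IsSageevChart P 𝓗 pos c φ)
include h

/-- The coordinates as an embedding of graphs. -/
def embedding : SageevVertex.graph 𝓗 ↪g (stdCubing d).graph :=
  ⟨⟨φ, h.injective⟩, h.adj_iff.symm⟩

theorem image_cube_mem (hC : C ∈ (SageevVertex.complex 𝓗).cubes) :
    φ '' C ∈ (stdCubing d).cubes :=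
  image_mem_cubes_cubeCompletion h.embedding hC

theorem dim_cube_le {n : ℕ} (hC : (SageevVertex.complex 𝓗).IsCubeOfDim n C) : n ≤ d := by
  obtain ⟨-, ⟨e⟩⟩ := hC
  obtain ⟨f, -⟩ := exists_range_eq_image h.embedding e
  exact le_of_hypercube_embedding f

theorem exists_image_cube_eq (hC : (SageevVertex.complex 𝓗).IsCubeOfDim d C) :
    ∃ v : Fin d → ℤ, φ '' C = {x | ∀ i, x i = v i ∨ x i = v i + 1} := by
  obtain ⟨-, ⟨e⟩⟩ := hC
  obtain ⟨f, hf⟩ := exists_range_eq_image h.embedding e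
  obtain ⟨v, hv⟩ := exists_range_eq_of_hypercube_embedding f
  exact ⟨v, hf.symm.trans hv⟩

end Embedding

section DualHalfspaces

variable (h : IsSageevChart P 𝓗 pos c φ) {v : Fin d → ℤ}
  (hC : φ '' C = {x | ∀ i, x i = v i ∨ x i = v i + 1})
include hC

theorem exists_coord_eq_corner : ∃ x ∈ C, φ x = v := by
  have mem : v ∈ φ '' C := hC ▸ fun _ => Or.inl rfl
  exact mem

theorem exists_coord_eq_corner_add_single (i : Fin d) :
    ∃ y ∈ C, φ y = v + Pi.single i 1 := by
  have mem : v + Pi.single i 1 ∈ φ '' C := by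
    rw [hC]
    intro j
    rcases eq_or_ne j i with rfl | hj
    · simp
    · simp [hj]
  exact mem

include h

theorem mem_dual_iff (H : Set V) :
    (H ∈ P ∧ ∃ x ∈ C, ∃ y ∈ C, (SageevVertex.graph 𝓗).Adj x y ∧ x ∉ SageevVertex.half 𝓗 H ∧
      y ∈ SageevVertex.half 𝓗 H) ↔ ∃ i, c i (v i) = H := by
  constructor
  · rintro ⟨hH, x, hx, y, hy, -, x_notMem, y_mem⟩
    obtain ⟨i, n, rfl⟩ := h.surj H hH
    have x_coord : φ x i = v i ∨ φ x i = v i + 1 := (hC ▸ Set.mem_image_of_mem φ hx) i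
    have y_coord : φ y i = v i ∨ φ y i = v i + 1 := (hC ▸ Set.mem_image_of_mem φ hy) i
    have x_le : ¬ n < φ x i := fun hn => x_notMem ((h.coord x i n).2 hn)
    have lt_y : n < φ y i := (h.coord y i n).1 y_mem
    exact ⟨i, congrArg (c i) (by omega)⟩
  · rintro ⟨i, rfl⟩
    obtain ⟨x, hx, hxv⟩ := exists_coord_eq_corner hC
    obtain ⟨y, hy, hyv⟩ := exists_coord_eq_corner_add_single hC i
    refine ⟨h.mem _ _, x, hx, y, hy, h.adj_iff.2 ?_, fun mem => ?_, (h.coord y i (v i)).2 ?_⟩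
    · rw [hxv, hyv]
      exact stdCubing_adj_add_single v i 1
    · have := (h.coord x i (v i)).1 mem
      rw [hxv] at this
      exact lt_irrefl _ this
    · rw [hyv, Pi.add_apply, Pi.single_eq_same]
      exact lt_add_one _

theorem eq_of_corner_subset {i j : Fin d} (hij : c i (v i) ⊆ c j (v j)) : i = j := by
  by_contra! hne
  obtain ⟨y, -, hy⟩ := exists_coord_eq_corner_add_single hC i
  have lt_i : v i < φ y i := by rw [hy, Pi.add_apply, Pi.single_eq_same]; exact lt_add_one _
  have lt_j := h.lt_of_subset y hij lt_i
  rw [hy, Pi.add_apply, Pi.single_eq_of_ne hne.symm, add_zero] at lt_j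
  exact lt_irrefl _ lt_j

end DualHalfspaces

section UnitCube

variable (h : IsSageevChart P 𝓗 pos c φ) (antichain : ∀ i j, c i 0 ⊆ c j 0 → i = j)
include h antichain

theorem le_zero_of_subset {i j : Fin d} {n m : ℤ} (hs : c i n ⊆ c j m) (hn : n ≤ 0) : m ≤ 0 := by
  by_contra! hm
  have subset : c i 0 ⊆ c j m := ((h.subset_iff i).2 hn).trans hs
  have ssubset := h.anti j 0 m hm
  obtain rfl := antichain i j (subset.trans ssubset.subset)
  exact ssubset.not_subset subset

theorem exists_coord_eq_of_mem_unitCube {k : Fin d → ℤ} (hk : k ∈ unitCube d) :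
    ∃ σ, φ σ = k := by
  refine h.exists_coord_eq fun i j n m hs hn => ?_
  have hi := hk i
  have hj := hk j
  rcases (h.le_zero_of_subset antichain hs (by omega)).lt_or_eq with hm | rfl
  · omega
  · obtain rfl := antichain i j (((h.subset_iff i).2 (by omega)).trans hs)
    have := (h.subset_iff i).1 hs
    omega

theorem exists_isCubeOfDim : ∃ C, (SageevVertex.complex 𝓗).IsCubeOfDim d C := by
  let face : hypercube d ↪g (stdCubing d).graph := stdFace 0 (Function.Embedding.refl _) 1
  have face_mem (x : Fin d → Bool) : face x ∈ unitCube d := fun i => by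
    have face_apply : face x i = if x i then 1 else 0 := by
      rw [stdFace_apply, zero_add]
      exact cubeVector_apply (Function.Embedding.refl _) 1 x i
    rw [face_apply]
    cases x i <;> simp
  choose s hs using fun x => h.exists_coord_eq_of_mem_unitCube antichain (face_mem x)
  have s_injective : Function.Injective s := fun x y hxy =>
    face.injective (by rw [← hs, ← hs, hxy])
  let f : hypercube d ↪g SageevVertex.graph 𝓗 := ⟨⟨s, s_injective⟩, fun {x y} => by
    change (SageevVertex.graph 𝓗).Adj (s x) (s y) ↔ _
    rw [h.adj_iff, hs, hs]
    exact face.map_rel_iff⟩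
  exact ⟨Set.range f, range_mem_cubes_cubeCompletion f, ⟨f.isoInduceRange⟩⟩

theorem dim_eq : (SageevVertex.complex 𝓗).dim = d := by
  obtain ⟨C, hC⟩ := h.exists_isCubeOfDim antichain
  refine le_antisymm (sSup_le ?_) (le_sSup ⟨d, C, hC, rfl⟩)
  rintro _ ⟨n, C', hC', rfl⟩
  exact_mod_cast h.dim_cube_le hC'

end UnitCube

end IsSageevChart

section EquivariantChainSystems

variable {V G : Type*} [Group G] [MulAction G V] {P 𝓗 : Set (Set V)} {pos : Set V → ℤ} {ℓ : ℤ}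
  {g : G} {d : ℕ} {c : Fin d → ℤ → Set V}

/-- The members of `P` between the chain members `c i 0` and their images under `g`. -/
def chainSpan (P : Set (Set V)) (c : Fin d → ℤ → Set V) (g : G) : Set (Set V) :=
  {K ∈ P | (∃ i, K ⊆ c i 0) ∧ ∃ i, g • c i 0 ⊆ K}

/-- A decomposition of `P` into chains that are permuted and shifted by `g`, whose members of
index zero are pairwise incomparable. The chain of number `0` has no gaps between these members
and their images. -/
structure IsEquivariantChainSystem (P : Set (Set V)) (g : G) (c : Fin d → ℤ → Set V)
    (σ : Equiv.Perm (Fin d)) (t : Fin d → ℤ) : Prop extends IsChainSystem P c where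
  smul : ∀ i n, g • c i n = c (σ i) (n + t i)
  antichain : ∀ i j, c i 0 ⊆ c j 0 → i = j
  saturated : ∀ (hd : 0 < d) (n : ℤ), c ⟨0, hd⟩ n ∈ chainSpan P c g →
    c ⟨0, hd⟩ (n + 1) ∈ chainSpan P c g → ∀ Z ∈ P, c ⟨0, hd⟩ (n + 1) ⊂ Z → ¬ Z ⊂ c ⟨0, hd⟩ n

theorem IsEquivariantChainPartition.isEquivariantChainSystem {f : P ≃o P} {A : Finset P}
    {b : Fin d → ℤ → P} {σ : Equiv.Perm (Fin d)} {t : Fin d → ℤ}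
    (h : IsEquivariantChainPartition f A b σ t) (hA : IsMaximumAntichain A)
    (hf : ∀ H, (f H : Set V) = g • (H : Set V)) :
    IsEquivariantChainSystem P g (fun i n => (b i n : Set V)) σ t where
  mem i n := (b i n).2
  surj H hH := (h.exists_eq ⟨H, hH⟩).imp fun _ => Exists.imp fun _ => congrArg Subtype.val
  inj i j n m hnm := h.injective i j n m (Subtype.ext hnm)
  anti i _ _ hnm := h.strictAnti i hnm
  smul i n := by rw [← hf, h.map]
  antichain i j hij :=
    (h.injective i j 0 0 (hA.isAntichain.eq ((h.mem_iff _).2 ⟨i, rfl⟩)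
      ((h.mem_iff _).2 ⟨j, rfl⟩) hij)).1
  saturated hd n hn hn' Z hZ hnZ hZn := by
    have mem_span (H : P) (hH : H.1 ∈ chainSpan P (fun i n => (b i n : Set V)) g) :
        H ∈ antichainSpan f A := by
      obtain ⟨-, ⟨i, hi⟩, j, hj⟩ := hH
      refine ⟨⟨b i 0, (h.mem_iff _).2 ⟨i, rfl⟩, hi⟩, b j 0, (h.mem_iff _).2 ⟨j, rfl⟩, ?_⟩
      rw [← hf] at hj
      exact hj
    exact (h.covBy hd n (mem_span _ hn) (mem_span _ hn')).2 (c := ⟨Z, hZ⟩) hnZ hZn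

namespace IsTranslatedSystem

variable (h : IsTranslatedSystem P pos ℓ g)
include h

/-- The action of `g` on `P`. -/
def smulIso : P ≃o P where
  toFun H := ⟨g • H.1, h.smul_mem H.1 H.2⟩
  invFun H := ⟨g⁻¹ • H.1, h.inv_smul_mem H.1 H.2⟩
  left_inv H := Subtype.ext (inv_smul_smul g H.1)
  right_inv H := Subtype.ext (smul_inv_smul g H.1)
  map_rel_iff' := Set.smul_set_subset_smul_set_iff

theorem isRankedTranslation : IsRankedTranslation (fun H : P => pos H) ℓ h.smulIso where
  injective H K hHK := Subtype.ext (h.injOn H.2 K.2 hHK)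
  antitone H K hHK := h.le_of_subset H.1 H.2 K.1 K.2 hHK
  length_pos := h.length_pos
  map_lt H := h.smul_ssubset H.1 H.2
  pos_map H := h.pos_smul H.1 H.2

theorem exists_isEquivariantChainSystem {A : Finset P} (hA : IsMaximumAntichain A)
    (hd : A.card = d) :
    ∃ (c : Fin d → ℤ → Set V) (σ : Equiv.Perm (Fin d)) (t : Fin d → ℤ),
      IsEquivariantChainSystem P g c σ t ∧ ∀ H : P, H ∈ A ↔ ∃ i, c i 0 = H := by
  obtain ⟨c, σ, t, hc⟩ := h.isRankedTranslation.exists_isEquivariantChainPartition hA hd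
  refine ⟨_, σ, t, hc.isEquivariantChainSystem hA fun _ => rfl, fun H => ?_⟩
  simp only [hc.mem_iff, Subtype.ext_iff]

theorem eq_zero_of_pow_eq_one {H : Set V} (hH : H ∈ P) {n : ℕ} (hn : g ^ n = 1) : n = 0 := by
  have mem_and_pos (n : ℕ) : g ^ n • H ∈ P ∧ pos (g ^ n • H) = pos H + n * ℓ := by
    induction n with
    | zero => simpa using hH
    | succ n ih =>
      rw [pow_succ', mul_smul, h.pos_smul _ ih.1, ih.2]
      exact ⟨h.smul_mem _ ih.1, by push_cast; ring⟩
  have mul_length : (n : ℤ) * ℓ = 0 := by simpa [hn] using (mem_and_pos n).2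
  exact_mod_cast (mul_eq_zero.1 mul_length).resolve_right h.length_pos.ne'

end IsTranslatedSystem

end EquivariantChainSystems

/-! ### Equivariance of the coordinates -/

section LatticeShift

variable {d : ℕ}

/-- The automorphism of the standard cubing that permutes the coordinates by `σ` and translates
by `t`. -/
def latticeShift (σ : Equiv.Perm (Fin d)) (t : Fin d → ℤ) :
    (stdCubing d).graph ≃g (stdCubing d).graph where
  toEquiv := (σ.arrowCongr (Equiv.refl ℤ)).trans (Equiv.addRight (t ∘ σ.symm))
  map_rel_iff' {x y} := σ.symm.exists_congr fun i => and_congr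
    (by simp [add_right_comm _ (t _) 1])
    (σ.symm.forall_congr fun j => by simp)

theorem latticeShift_apply (σ : Equiv.Perm (Fin d)) (t x : Fin d → ℤ) (j : Fin d) :
    latticeShift σ t x j = x (σ.symm j) + t (σ.symm j) := rfl

end LatticeShift

section CyclicActions

variable {G : Type*} [Group G] {g : G}

theorem mem_zpowers_generator (γ : Subgroup.zpowers g) :
    γ ∈ Subgroup.zpowers (⟨g, Subgroup.mem_zpowers g⟩ : Subgroup.zpowers g) := by
  obtain ⟨_, n, rfl⟩ := γ
  exact ⟨n, rfl⟩

theorem exists_zpowers_action {d : ℕ} (T : (stdCubing d).graph ≃g (stdCubing d).graph)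
    (hT : ∀ n : ℕ, g ^ n = 1 → T ^ n = 1) :
    ∃ α : Subgroup.zpowers g →* Equiv.Perm (Fin d → ℤ),
      (∀ γ, ∀ Q ∈ (stdCubing d).cubes, α γ '' Q ∈ (stdCubing d).cubes) ∧
      ∀ x, α ⟨g, Subgroup.mem_zpowers g⟩ x = T x := by
  have orderOf_dvd : orderOf T ∣ orderOf (⟨g, Subgroup.mem_zpowers g⟩ : Subgroup.zpowers g) := by
    rw [Subgroup.orderOf_mk]
    exact orderOf_dvd_of_pow_eq_one (hT _ (pow_orderOf_eq_one g))
  let β := monoidHomOfForallMemZpowers mem_zpowers_generator orderOf_dvd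
  refine ⟨MonoidHom.mk' (fun γ => (β γ).toEquiv) fun γ δ => ?_,
    fun γ Q hQ => image_mem_cubes_cubeCompletion (β γ).toEmbedding hQ, fun x => ?_⟩
  · rw [map_mul]
    rfl
  · change β _ x = T x
    rw [monoidHomOfForallMemZpowers_apply_gen]

theorem map_smul_of_mem_zpowers {W Y : Type*} [MulAction G W] {α : G →* Equiv.Perm Y}
    {φ : W → Y} (hg : ∀ x, φ (g • x) = α g (φ x)) {γ : G} (hγ : γ ∈ Subgroup.zpowers g) (x : W) :
    φ (γ • x) = α γ (φ x) := by
  obtain ⟨n, rfl⟩ := hγ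
  induction n using Int.induction_on generalizing x with
  | zero => simp
  | succ n ih => simp only [zpow_add_one, mul_smul, ih, hg, map_mul, Equiv.Perm.mul_apply]
  | pred n ih =>
    have map_inv_smul : φ (g⁻¹ • x) = (α g)⁻¹ (φ x) := by
      rw [Equiv.Perm.eq_inv_iff_eq, ← hg, smul_inv_smul]
    simp only [zpow_sub_one, mul_smul, ih, map_inv_smul, map_mul, map_inv, Equiv.Perm.mul_apply]

end CyclicActions

section

variable {V G : Type*} [Group G] [MulAction G V] {P 𝓗 : Set (Set V)} {pos : Set V → ℤ} {ℓ : ℤ}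
  {g : G} {d : ℕ} {c : Fin d → ℤ → Set V} {σ : Equiv.Perm (Fin d)} {t : Fin d → ℤ}
  {φ : SageevVertex 𝓗 → Fin d → ℤ}

theorem IsSageevChart.interval_eq (h : IsSageevChart P 𝓗 pos c φ) {x y : SageevVertex 𝓗}
    (hxy : φ x ≤ φ y) :
    SageevVertex.interval x y = {H | ∃ i n, c i n = H ∧ φ x i ≤ n ∧ n < φ y i} := by
  ext H
  constructor
  · rintro ⟨hH, y_mem : H ∈ y, x_notMem : H ∉ x⟩
    obtain ⟨i, n, rfl | rfl⟩ := h.exists_eq_or_eq_compl hH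
    · rw [h.coord] at y_mem x_notMem
      exact ⟨i, n, rfl, not_lt.1 x_notMem, y_mem⟩
    · rw [h.compl_coord] at y_mem x_notMem
      exact absurd ((hxy i).trans y_mem) x_notMem
  · rintro ⟨i, n, rfl, x_le, lt_y⟩
    exact ⟨h.chain_mem i n, (h.coord y i n).2 lt_y, fun mem => x_le.not_gt ((h.coord x i n).1 mem)⟩

namespace IsEquivariantChainSystem

variable (hs : IsEquivariantChainSystem P g c σ t)
include hs

theorem smul_symm (j : Fin d) (n : ℤ) : g • c (σ.symm j) (n - t (σ.symm j)) = c j n := by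
  rw [hs.smul, Equiv.apply_symm_apply, sub_add_cancel]

theorem nonneg_of_subset {i j : Fin d} {n : ℤ} (h : c j n ⊆ c i 0) : 0 ≤ n := by
  by_contra! hn
  have ssubset := hs.anti j n 0 hn
  obtain rfl := hs.antichain j i (ssubset.subset.trans h)
  exact ssubset.not_subset h

theorem shift_nonneg (hg : ∀ H ∈ P, g • H ⊆ H) (i : Fin d) : 0 ≤ t i := by
  have subset := hg _ (hs.mem i 0)
  rw [hs.smul, zero_add] at subset
  exact hs.nonneg_of_subset subset

theorem latticeShift_pow_eq_one (hT : IsTranslatedSystem P pos ℓ g) {n : ℕ} (hn : g ^ n = 1) :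
    latticeShift σ t ^ n = 1 := by
  rcases d.eq_zero_or_pos with rfl | hd
  · ext x i
    exact i.elim0
  · rw [hT.eq_zero_of_pow_eq_one (hs.mem ⟨0, hd⟩ 0) hn, pow_zero]

variable (h : IsSageevChart P 𝓗 pos c φ)
include h

theorem coord_eq_latticeShift {x y : SageevVertex 𝓗} (hxy : y.carrier = g • x.carrier) :
    φ y = latticeShift σ t (φ x) := by
  funext j
  refine eq_of_forall_lt_iff fun n => ?_
  calc n < φ y j ↔ g • c (σ.symm j) (n - t (σ.symm j)) ∈ y.carrier := by
        rw [hs.smul_symm]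
        exact (h.coord y j n).symm
    _ ↔ c (σ.symm j) (n - t (σ.symm j)) ∈ x.carrier := by
        rw [hxy, Set.smul_mem_smul_set_iff]
    _ ↔ n - t (σ.symm j) < φ x (σ.symm j) := h.coord x _ _
    _ ↔ n < latticeShift σ t (φ x) j := by rw [latticeShift_apply, sub_lt_iff_lt_add]

theorem mem_chainSpan_iff (j : Fin d) (n : ℤ) :
    c j n ∈ chainSpan P c g ↔ 0 ≤ n ∧ n ≤ t (σ.symm j) := by
  constructor
  · rintro ⟨-, ⟨i, subset⟩, k, smul_subset⟩
    refine ⟨hs.nonneg_of_subset subset, ?_⟩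
    rw [← hs.smul_symm j n, Set.smul_set_subset_smul_set_iff] at smul_subset
    exact sub_nonpos.1 (h.le_zero_of_subset hs.antichain smul_subset le_rfl)
  · rintro ⟨n_nonneg, n_le⟩
    refine ⟨hs.mem j n, ⟨j, (h.subset_iff j).2 n_nonneg⟩, σ.symm j, ?_⟩
    rw [hs.smul, Equiv.apply_symm_apply, zero_add]
    exact (h.subset_iff j).2 n_le

theorem tightlyNested (hd : 0 < d) {n : ℤ} (hn : c ⟨0, hd⟩ n ∈ chainSpan P c g)
    (hn' : c ⟨0, hd⟩ (n + 1) ∈ chainSpan P c g) :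
    TightlyNested 𝓗 (c ⟨0, hd⟩ n) (c ⟨0, hd⟩ (n + 1)) := by
  have ssubset := hs.anti ⟨0, hd⟩ n (n + 1) (lt_add_one n)
  refine ⟨Or.inr ssubset, ?_⟩
  rintro ⟨L, hL, ⟨hnL, hLn⟩ | ⟨hnL, hLn⟩⟩
  · exact (hnL.trans hLn).not_subset ssubset.subset
  · rcases (h.mem_iff L).1 hL with hL | hL
    · exact hs.saturated hd n hn hn' L hL hnL hLn
    · refine h.not_subset_compl _ (hs.mem ⟨0, hd⟩ (n + 1)) _ hL ?_
      rw [compl_compl]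
      exact hnL.subset

theorem exists_isSegment (hd : 0 < d) :
    ∃ l : List (Set V), IsSegment 𝓗 l ∧
      {H | H ∈ l} = chainSpan P c g ∩ chartHalf c ⁻¹' coordHalfspaces d ⟨0, hd⟩ := by
  refine ⟨(List.range (t (σ.symm ⟨0, hd⟩) + 1).toNat).map fun k : ℕ => c ⟨0, hd⟩ k,
    ⟨?_, ?_⟩, ?_⟩
  · intro H hH
    obtain ⟨k, -, rfl⟩ := List.mem_map.1 hH
    exact h.chain_mem _ _
  · rw [List.isChain_map, List.isChain_range]
    intro k hk
    rw [Nat.cast_succ]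
    exact ⟨hs.anti _ _ _ (lt_add_one _), hs.tightlyNested h hd
      ((hs.mem_chainSpan_iff h _ _).2 (by omega)) ((hs.mem_chainSpan_iff h _ _).2 (by omega))⟩
  · ext H
    simp only [Set.mem_ofPred_eq, List.mem_map, List.mem_range, Set.mem_inter_iff,
      Set.mem_preimage]
    constructor
    · rintro ⟨k, hk, rfl⟩
      exact ⟨(hs.mem_chainSpan_iff h _ _).2 (by omega),
        (h.chartHalf_mem_coordHalfspaces _ _ _).2 rfl⟩
    · rintro ⟨mem_span, mem_coord⟩
      obtain ⟨j, n, rfl⟩ := hs.surj H mem_span.1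
      obtain rfl := (h.chartHalf_mem_coordHalfspaces _ _ _).1 mem_coord
      have bounds := (hs.mem_chainSpan_iff h _ _).1 mem_span
      exact ⟨n.toNat, by omega, by rw [Int.toNat_of_nonneg bounds.1]⟩

end IsEquivariantChainSystem

theorem unitCube_eq :
    unitCube d = {x | ∀ i, x i = (0 : Fin d → ℤ) i ∨ x i = (0 : Fin d → ℤ) i + 1} := by
  simp only [unitCube, Pi.zero_apply, zero_add]

/-- The half-spaces dual to a cube of maximal dimension form a maximum antichain, so that the
chains can be made to start at them. -/
theorem IsTranslatedSystem.exists_chart_of_cube (hT : IsTranslatedSystem P pos ℓ g)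
    (h𝓗 : ∀ H, H ∈ 𝓗 ↔ H ∈ P ∨ Hᶜ ∈ P)
    (hmax : ∀ B : Finset P, IsAntichain (· ≤ ·) (B : Set P) → B.card ≤ d)
    {φ₀ : SageevVertex 𝓗 → Fin d → ℤ} (h₀ : IsSageevChart P 𝓗 pos c φ₀)
    {C : Set (SageevVertex 𝓗)} (hC : (SageevVertex.complex 𝓗).IsCubeOfDim d C) :
    ∃ (c : Fin d → ℤ → Set V) (σ : Equiv.Perm (Fin d)) (t : Fin d → ℤ)
      (φ : SageevVertex 𝓗 → Fin d → ℤ), IsSageevChart P 𝓗 pos c φ ∧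
      IsEquivariantChainSystem P g c σ t ∧ φ '' C = unitCube d := by
  obtain ⟨v, hv⟩ := h₀.exists_image_cube_eq hC
  let a : Fin d ↪ P := ⟨fun i => ⟨c i (v i), h₀.mem _ _⟩, fun i j hij =>
    (h₀.inj _ _ _ _ (congrArg Subtype.val hij)).1⟩
  have card_dual : (Finset.univ.map a).card = d := by simp
  have dual_maximum : IsMaximumAntichain (Finset.univ.map a) := by
    refine ⟨?_, fun B hB => (hmax B hB).trans_eq card_dual.symm⟩
    rw [Finset.coe_map, Finset.coe_univ, Set.image_univ]
    rintro _ ⟨i, rfl⟩ _ ⟨j, rfl⟩ hne hle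
    exact hne (congrArg a (h₀.eq_of_corner_subset hv hle))
  obtain ⟨c', σ, t, hs, mem_iff⟩ := hT.exists_isEquivariantChainSystem dual_maximum card_dual
  obtain ⟨φ, h⟩ := exists_isSageevChart hT.toIsRankedSystem hs.toIsChainSystem h𝓗
  refine ⟨c', σ, t, φ, h, hs, ?_⟩
  obtain ⟨w, hw⟩ := h.exists_image_cube_eq hC
  have corner_eq_zero : w = 0 := by
    funext i
    obtain ⟨k, hk⟩ := (h₀.mem_dual_iff hv _).1 ((h.mem_dual_iff hw _).2 ⟨i, rfl⟩)
    obtain ⟨j, hj⟩ := (mem_iff (a k)).1 (Finset.mem_map_of_mem a (Finset.mem_univ k))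
    exact (h.inj _ _ _ _ (hj.trans hk)).2.symm
  rw [hw, corner_eq_zero, unitCube_eq]

end

namespace CubeComplex

variable {V : Type*} {X : CubeComplex V} {G : Type*} [Group G] [MulAction G V]
  {g : G} {d : ℕ} {c : Fin d → ℤ → Set V} {σ : Equiv.Perm (Fin d)} {t : Fin d → ℤ}
  {pos : Set V → ℤ} {ℓ : ℤ} {φ : X.EssVertex g → Fin d → ℤ} {C : Set (X.EssVertex g)}

section MinimalVertex

variable (h : IsSageevChart (X.axisPos g) (X.axis g) pos c φ) (hC : φ '' C = unitCube d)
include h hC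

theorem dualPos_eq : X.dualPos g C = {H | ∃ i, c i 0 = H} :=
  Set.ext (h.mem_dual_iff (hC.trans unitCube_eq))

theorem isMinimalVertex_iff {o : X.EssVertex g} :
    X.IsMinimalVertex g C o ↔ o ∈ C ∧ φ o = 0 := by
  constructor
  · rintro ⟨ho, y, -, dual_eq⟩
    refine ⟨ho, funext fun i => ?_⟩
    have mem_interval : c i 0 ∈ SageevVertex.interval o y := by
      rw [← dual_eq, dualPos_eq h hC]
      exact ⟨i, rfl⟩
    have not_pos : ¬ 0 < φ o i := fun pos_coord => mem_interval.2.2 ((h.coord o i 0).2 pos_coord)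
    have mem_cube : φ o ∈ unitCube d := hC ▸ Set.mem_image_of_mem φ ho
    exact (mem_cube i).resolve_right fun eq_one => not_pos (by omega)
  · rintro ⟨ho, o_coord⟩
    obtain ⟨y, hy, y_coord⟩ : (1 : Fin d → ℤ) ∈ φ '' C := hC ▸ fun _ => Or.inr rfl
    refine ⟨ho, y, hy, ?_⟩
    rw [dualPos_eq h hC, h.interval_eq (by rw [o_coord, y_coord]; exact zero_le_one), o_coord,
      y_coord]
    ext H
    constructor
    · rintro ⟨i, rfl⟩
      exact ⟨i, 0, rfl, le_rfl, zero_lt_one⟩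
    · rintro ⟨i, n, rfl, (n_nonneg : 0 ≤ n), (n_lt : n < 1)⟩
      exact ⟨i, congrArg (c i) (by omega)⟩

theorem exists_isMinimalVertex : ∃ o, X.IsMinimalVertex g C o := by
  obtain ⟨o, ho, o_coord⟩ : (0 : Fin d → ℤ) ∈ φ '' C := hC ▸ fun _ => Or.inl rfl
  exact ⟨o, (isMinimalVertex_iff h hC).2 ⟨ho, o_coord⟩⟩

end MinimalVertex

theorem closedSpan_eq (hg : ∀ H ∈ X.axisPos g, g • H ⊆ H) (hc : ∀ i, c i 0 ∈ X.axisPos g) :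
    X.closedSpan g {H | ∃ i, c i 0 = H} = chainSpan (X.axisPos g) c g := by
  have smul_subset (i : Fin d) : g • c i 0 ⊆ c i 0 := hg _ (hc i)
  ext K
  constructor
  · rintro ⟨hK, H, hH, H', hH', lower, upper⟩
    refine ⟨hK, ?_, ?_⟩
    · rcases hH with ⟨i, rfl⟩ | ⟨_, ⟨i, rfl⟩, rfl⟩
      exacts [⟨i, upper⟩, ⟨i, upper.trans (smul_subset i)⟩]
    · rcases hH' with ⟨i, rfl⟩ | ⟨_, ⟨i, rfl⟩, rfl⟩
      exacts [⟨i, (smul_subset i).trans lower⟩, ⟨i, lower⟩]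
  · rintro ⟨hK, ⟨i, upper⟩, j, lower⟩
    exact ⟨hK, _, Or.inl ⟨i, rfl⟩, _, Or.inr ⟨_, ⟨j, rfl⟩, rfl⟩, lower, upper⟩

section Spans

variable (hg : ∀ H ∈ X.axisPos g, g • H ⊆ H) (hs : IsEquivariantChainSystem (X.axisPos g) g c σ t)
  (h : IsSageevChart (X.axisPos g) (X.axis g) pos c φ)
include hg hs h

theorem halfOpenSpan_eq :
    X.halfOpenSpan g {H | ∃ i, c i 0 = H} =
      {H | ∃ j n, c j n = H ∧ 0 ≤ n ∧ n < t (σ.symm j)} := by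
  have mem_smul_iff (j : Fin d) (n : ℤ) :
      c j n ∈ g • {H | ∃ i, c i 0 = H} ↔ n = t (σ.symm j) := by
    rw [Set.mem_smul_set_iff_inv_smul_mem, ← hs.smul_symm, inv_smul_smul, ← sub_eq_zero]
    exact ⟨fun ⟨_, hi⟩ => (hs.inj _ _ _ _ hi).2.symm, fun hn => ⟨_, congrArg (c _) hn.symm⟩⟩
  rw [halfOpenSpan, closedSpan_eq hg fun i => hs.mem i 0]
  ext H
  constructor
  · rintro ⟨mem_span, notMem_smul⟩
    obtain ⟨j, n, rfl⟩ := hs.surj H mem_span.1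
    rw [mem_smul_iff] at notMem_smul
    obtain ⟨n_nonneg, n_le⟩ := (hs.mem_chainSpan_iff h _ _).1 mem_span
    exact ⟨j, n, rfl, n_nonneg, lt_of_le_of_ne n_le notMem_smul⟩
  · rintro ⟨j, n, rfl, n_nonneg, n_lt⟩
    exact ⟨(hs.mem_chainSpan_iff h _ _).2 ⟨n_nonneg, n_lt.le⟩,
      fun mem_smul => n_lt.ne ((mem_smul_iff _ _).1 mem_smul)⟩

theorem halfOpenSpan_eq_interval {x y : X.EssVertex g} (hx : φ x = 0)
    (hy : φ y = latticeShift σ t (φ x)) :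
    X.halfOpenSpan g {H | ∃ i, c i 0 = H} = SageevVertex.interval x y := by
  have y_coord (j : Fin d) : φ y j = t (σ.symm j) := by
    rw [hy, latticeShift_apply, hx, Pi.zero_apply, zero_add]
  have x_le_y : φ x ≤ φ y := fun j => by
    rw [hx, y_coord]
    exact hs.shift_nonneg hg _
  simp only [halfOpenSpan_eq hg hs h, h.interval_eq x_le_y, hx, y_coord, Pi.zero_apply]

end Spans

end CubeComplex

theorem mainTheorem4_general {V : Type*} (X : CubeComplex V) (hX : X.IsCAT0)
    {G : Type*} [Group G] [MulAction G V] [CubicalAction G X]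
    (g : G) (hg : 0 < X.translationDist g) (hnt : X.ActsNonTransversely g) :
    ∃ d : ℕ, (X.ess g).dim = d ∧
      ∀ C : Set (X.EssVertex g), (X.ess g).IsCubeOfDim d C →
        ∃ (α : Subgroup.zpowers g →* Equiv.Perm (Fin d → ℤ))
          (φ : X.EssVertex g → Fin d → ℤ)
          (Φ : Set V → Set (Fin d → ℤ)),
          (∀ h, ∀ Q ∈ (stdCubing d).cubes, α h '' Q ∈ (stdCubing d).cubes) ∧
          (∀ h x, φ (h • x) = α h (φ x)) ∧
          (∀ x y, (stdCubing d).graph.edist (φ x) (φ y) = (X.ess g).graph.edist x y) ∧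
          (∀ Q ∈ (X.ess g).cubes, φ '' Q ∈ (stdCubing d).cubes) ∧
          φ '' C = unitCube d ∧
          (∀ H ∈ X.axis g, φ ⁻¹' Φ H = SageevVertex.half (X.axis g) H) ∧
          Set.BijOn Φ (X.axis g) (stdCubing d).halfspaces ∧
          Φ '' X.axisPos g = stdPosHalfspaces d ∧
          (∀ hd : 0 < d, ∃ l : List (Set V), IsSegment (X.axis g) l ∧
            {H | H ∈ l} = X.closedSpan g (X.dualPos g C) ∩ Φ ⁻¹' coordHalfspaces d ⟨0, hd⟩) ∧
          (∃ o, X.IsMinimalVertex g C o) ∧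
          (∀ o, X.IsMinimalVertex g C o → X.halfOpenSpan g (X.dualPos g C) =
            SageevVertex.interval o ((⟨g, Subgroup.mem_zpowers g⟩ : Subgroup.zpowers g) • o)) := by
  obtain ⟨pos, hT⟩ := hX.exists_isTranslatedSystem hg hnt
  obtain ⟨A, hA⟩ := hT.isRankedTranslation.exists_isMaximumAntichain
  obtain ⟨c₀, σ₀, t₀, hs₀, -⟩ := hT.exists_isEquivariantChainSystem hA rfl
  obtain ⟨φ₀, h₀⟩ := exists_isSageevChart hT.toIsRankedSystem hs₀.toIsChainSystem fun _ => Iff.rfl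
  refine ⟨A.card, h₀.dim_eq hs₀.antichain, fun C hC => ?_⟩
  obtain ⟨c, σ, t, φ, h, hs, hφC⟩ := hT.exists_chart_of_cube (fun _ => Iff.rfl) hA.card_le h₀ hC
  obtain ⟨α, hα, hαg⟩ :=
    exists_zpowers_action (latticeShift σ t) fun _ => hs.latticeShift_pow_eq_one hT
  have hφg (x : X.EssVertex g) :
      φ ((⟨g, Subgroup.mem_zpowers g⟩ : Subgroup.zpowers g) • x) = latticeShift σ t (φ x) :=
    hs.coord_eq_latticeShift h rfl
  have smul_subset (H : Set V) (hH : H ∈ X.axisPos g) : g • H ⊆ H := (hT.smul_ssubset H hH).subset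
  refine ⟨α, φ, chartHalf c, hα, fun γ x => ?_, h.edist_eq, fun Q hQ => h.image_cube_mem hQ, hφC,
    fun H hH => h.preimage_chartHalf hH, h.bijOn_chartHalf, h.image_chartHalf, fun hd => ?_,
    CubeComplex.exists_isMinimalVertex h hφC, fun o ho => ?_⟩
  · exact map_smul_of_mem_zpowers (fun x => (hφg x).trans (hαg _).symm) (mem_zpowers_generator γ) x
  · rw [CubeComplex.dualPos_eq h hφC, CubeComplex.closedSpan_eq smul_subset fun i => hs.mem i 0]
    exact hs.exists_isSegment h hd
  · rw [CubeComplex.dualPos_eq h hφC]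
    exact CubeComplex.halfOpenSpan_eq_interval smul_subset hs h
      ((CubeComplex.isMinimalVertex_iff h hφC).1 ho).2 (hφg o)

theorem mainTheorem4 {V : Type*} (X : CubeComplex V) (hX : X.IsCAT0)
    {G : Type*} [Group G] [MulAction G V] [CubicalAction G X]
    (hG : ∀ h : G, X.ActsWithoutInversion h)
    (g : G) (hg : X.IsHyperbolic g) (hnt : X.ActsNonTransversely g) :
    ∃ d : ℕ, (X.ess g).dim = d ∧
      ∀ C : Set (X.EssVertex g), (X.ess g).IsCubeOfDim d C →
        ∃ (α : Subgroup.zpowers g →* Equiv.Perm (Fin d → ℤ))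
          (φ : X.EssVertex g → Fin d → ℤ)
          (Φ : Set V → Set (Fin d → ℤ)),
          -- `⟨g⟩` acts on `ℝ^d` by automorphisms of its standard cubing
          (∀ h, ∀ Q ∈ (stdCubing d).cubes, α h '' Q ∈ (stdCubing d).cubes) ∧
          -- `φ` is an equivariant isometric embedding of cube complexes
          (∀ h x, φ (h • x) = α h (φ x)) ∧
          (∀ x y, (stdCubing d).graph.edist (φ x) (φ y) = (X.ess g).graph.edist x y) ∧
          (∀ Q ∈ (X.ess g).cubes, φ '' Q ∈ (stdCubing d).cubes) ∧
          -- (1)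
          φ '' C = unitCube d ∧
          -- (2): `Φ` is the map on half-spaces induced by `φ`
          (∀ H ∈ X.axis g, φ ⁻¹' Φ H = SageevVertex.half (X.axis g) H) ∧
          Set.BijOn Φ (X.axis g) (stdCubing d).halfspaces ∧
          Φ '' X.axisPos g = stdPosHalfspaces d ∧
          -- (3)
          (∀ hd : 0 < d, ∃ l : List (Set V), IsSegment (X.axis g) l ∧
            {H | H ∈ l} = X.closedSpan g (X.dualPos g C) ∩ Φ ⁻¹' coordHalfspaces d ⟨0, hd⟩) ∧
          -- (4)
          (∃ o, X.IsMinimalVertex g C o) ∧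
          (∀ o, X.IsMinimalVertex g C o → X.halfOpenSpan g (X.dualPos g C) =
            SageevVertex.interval o ((⟨g, Subgroup.mem_zpowers g⟩ : Subgroup.zpowers g) • o)) :=
  mainTheorem4_general X hX g hg.2 hnt
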